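/- A finite simplicial complex is a finite family $\Gamma$ of finite sets that contains $\emptyset$ and is closed under taking subsets; $\dim\sigma=|\sigma|-1$ for $\sigma\in\Gamma$, $\dim\Gamma$ is the maximum dimension of a face, $V(\Gamma)=\{v:\{v\}\in\Gamma\}$, a facet is an inclusion-maximal face, and $\overline{\sigma}$ is the set of all subsets of $\sigma$. $\Gamma$ is shellable if its facets can be ordered $\sigma_1,\dots,\sigma_t$ so that for every $2\le j\le t$ the complex $\bigl(\bigcup_{i<j}\overline{\sigma_i}\bigr)\cap\overline{\sigma_j}$ is pure of dimension $\dim\sigma_j-1$ (all its facets have that dimension). For $W\subseteq V(\Gamma)$ let $\Gamma[W]=\{\sigma\in\Gamma:\sigma\subseteq W\}$. $\Gamma$ is an obstruction to shellability if $\Gamma$ is not shellable but $\Gamma[W]$ is shellable for every $W\subsetneq V(\Gamma)$. A complex $\Gamma'$ is obtained from $\Gamma$ by adding zero or more edges if $\Gamma\subseteq\Gamma'$ and every face in $\Gamma'\setminus\Gamma$ has dimension $1$. A 2-dimensional obstruction to shellability $\Gamma$ is edge-minimal if no 2-dimensional obstruction to shellability $\Delta\ne\Gamma$ exists such that $\Gamma$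 is obtained from $\Delta$ by adding edges. Write $ijk$ for $\{i,j,k\}$ and $ij$ for $\{i,j\}$. Consider the following twelve complexes, given by their facets: * (1a) $012,\ 345,\ 03,\ 14,\ 25$; * (1b) $012,\ 345,\ 23,\ 03,\ 04,\ 14$; * (1c) $012,\ 345,\ 03,\ 13,\ 14,\ 04$; * (2) $012,\ 034,\ 13$; * (3a) $012,\ 034,\ 123$; * (3b) $012,\ 034,\ 123,\ 124$; * (3c) $012,\ 034,\ 123,\ 134$; * (3d) $012,\ 034,\ 123,\ 124,\ 134$; * (3e) $012,\ 034,\ 123,\ 124,\ 134,\ 234$; * (4a), (4b), (4c): the triangles $\{i,i+1,i+2\}$, $i\in\mathbb{Z}/n$, on the vertex set $\mathbb{Z}/n$ with $n=5,6,7$, respectively. **Theorem.** A finite simplicial complex is a 2-dimensional edge-minimal obstruction to shellability if and only if it is isomorphic to one of the twelve complexes (1a)–(1c), (2), (3a)–(3e), (4a)–(4c). Hence the obstructions to shellability of dimension $\le 2$ are exactly the complexes that are isomorphic to $2K_2$ (the complex on four vertices whose facets are two disjoint edges) or are obtained by adding zero or more edges to a complex isomorphic to one of these twelve. -/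

import Mathlib

/-- A finite abstract simplicial complex: a finite family of finite subsets of `E`, closed under
taking subsets and containing the empty face (of dimension `-1`). Mathlib's
`PreAbstractSimplicialComplex` excludes the empty face, hence this structure.
Elements of `E` need not be vertices. -/
@[ext]
structure FinComplex (E : Type*) where
  faces : Finset (Finset E)
  empty_mem : ∅ ∈ faces
  down_closed : ∀ s ∈ faces, ∀ t, t ⊆ s → t ∈ faces

namespace FinComplex

/-- The dimension of a face, `|σ| - 1`. -/
def faceDim {E : Type*} (σ : Finset E) : ℤ := (σ.card : ℤ) - 1

/-- The set of vertices `V(Γ) = {v | {v} ∈ Γ}`. -/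
def vertexSet {E : Type*} (Γ : FinComplex E) : Set E := {v | {v} ∈ Γ.faces}

/-- The dimension of a complex: the maximum dimension of its faces. -/
def dim {E : Type*} (Γ : FinComplex E) : ℤ := ((Γ.faces.sup Finset.card : ℕ) : ℤ) - 1

/-- A facet is a face that is maximal with respect to inclusion. -/
def IsFacet {E : Type*} (Γ : FinComplex E) (σ : Finset E) : Prop :=
  Maximal (fun τ => τ ∈ Γ.faces) σ

/-- A family of faces is pure of dimension `d` if it is nonempty and all its
inclusion-maximal members have dimension `d`. -/
def IsPureOfDim {E : Type*} (F : Finset (Finset E)) (d : ℤ) : Prop :=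
  F.Nonempty ∧ ∀ σ, Maximal (fun τ => τ ∈ F) σ → faceDim σ = d

/-- The restriction `Γ[W]`: the faces of `Γ` contained in `W`. -/
def restrict {E : Type*} [DecidableEq E] (Γ : FinComplex E) (W : Finset E) : FinComplex E where
  faces := Γ.faces.filter (fun s => s ⊆ W)
  empty_mem := by simp [Γ.empty_mem]
  down_closed := by
    intro s hs t hts
    rw [Finset.mem_filter] at hs ⊢
    exact ⟨Γ.down_closed s hs.1 t hts, hts.trans hs.2⟩

/-- A (nonpure) shelling: an enumeration `σ₀, σ₁, …` of all facets such that, for each `j ≥ 1`,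
the complex `(⋃ i < j, closure of σᵢ) ∩ (closure of σⱼ)` is pure of dimension `dim σⱼ - 1`. The
closure of a face is the family of all its subsets. -/
def IsShelling {E : Type*} [DecidableEq E] (Γ : FinComplex E) (l : List (Finset E)) : Prop :=
  l.Nodup ∧ (∀ σ, σ ∈ l ↔ Γ.IsFacet σ) ∧
    ∀ (j : ℕ) (hj : j < l.length), 1 ≤ j →
      IsPureOfDim ((l.take j).toFinset.biUnion Finset.powerset ∩ (l[j]).powerset)
        (faceDim l[j] - 1)

def IsShellable {E : Type*} [DecidableEq E] (Γ : FinComplex E) : Prop :=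
  ∃ l : List (Finset E), Γ.IsShelling l

/-- An obstruction to shellability: not shellable, but all proper restrictions are. -/
def IsObstruction {E : Type*} [DecidableEq E] (Γ : FinComplex E) : Prop :=
  ¬ Γ.IsShellable ∧ ∀ W : Finset E, (W : Set E) ⊂ Γ.vertexSet → (Γ.restrict W).IsShellable

/-- `Γ'` arises from `Γ` by adding zero or more edges: `Γ ⊆ Γ'`, and all new faces are
1-dimensional. In particular `Γ` and `Γ'` have the same vertices. -/
def IsAddEdges {E : Type*} (Γ Γ' : FinComplex E) : Prop :=
  Γ.faces ⊆ Γ'.faces ∧ ∀ s ∈ Γ'.faces, s ∉ Γ.faces → faceDim s = 1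

/-- A 2-dimensional obstruction to shellability is edge-minimal if removing edges from it never
gives another 2-dimensional obstruction. -/
def IsEdgeMinimalObstruction {E : Type*} [DecidableEq E] (Γ : FinComplex E) : Prop :=
  (Γ.IsObstruction ∧ Γ.dim = 2) ∧
    ∀ Δ : FinComplex E, Δ.IsObstruction → Δ.dim = 2 → IsAddEdges Δ Γ → Δ = Γ

/-- Isomorphism of complexes: a bijection of the vertex sets under which faces correspond to
faces. -/
def IsIso {E F : Type*} (Γ : FinComplex E) (Δ : FinComplex F) : Prop :=
  ∃ f : Γ.vertexSet ≃ Δ.vertexSet, ∀ s : Finset Γ.vertexSet,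
    s.map (Function.Embedding.subtype _) ∈ Γ.faces ↔
      (s.map f.toEmbedding).map (Function.Embedding.subtype _) ∈ Δ.faces

/-- The complex generated by a family of sets: all subsets of its members, and `∅`. -/
def generatedBy {E : Type*} [DecidableEq E] (F : Finset (Finset E)) : FinComplex E where
  faces := insert ∅ (F.biUnion Finset.powerset)
  empty_mem := by simp
  down_closed := by
    intro s hs t hts
    simp only [Finset.mem_insert, Finset.mem_biUnion, Finset.mem_powerset] at hs ⊢
    rcases hs with rfl | ⟨a, ha, hsa⟩
    · exact Or.inl (Finset.subset_empty.mp hts)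
    · exact Or.inr ⟨a, ha, hts.trans hsa⟩

/-- `2K₂`: two disjoint edges on four vertices. -/
def twoK2 : FinComplex (Fin 4) := generatedBy {{0, 1}, {2, 3}}

/-- Two disjoint triangles and a perfect matching of three edges between them. -/
def complex1a : FinComplex (Fin 7) :=
  generatedBy {{0, 1, 2}, {3, 4, 5}, {0, 3}, {1, 4}, {2, 5}}

/-- Two disjoint triangles and a path of four edges between them. -/
def complex1b : FinComplex (Fin 7) :=
  generatedBy {{0, 1, 2}, {3, 4, 5}, {2, 3}, {0, 3}, {0, 4}, {1, 4}}

/-- Two disjoint triangles and a cycle of four edges between them. -/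
def complex1c : FinComplex (Fin 7) :=
  generatedBy {{0, 1, 2}, {3, 4, 5}, {0, 3}, {1, 3}, {1, 4}, {0, 4}}

/-- Two triangles sharing one vertex and one edge joining them. -/
def complex2 : FinComplex (Fin 7) :=
  generatedBy {{0, 1, 2}, {0, 3, 4}, {1, 3}}

/-- Two triangles sharing the vertex `0`, and one triangle on `1, 2, 3, 4`. -/
def complex3a : FinComplex (Fin 7) :=
  generatedBy {{0, 1, 2}, {0, 3, 4}, {1, 2, 3}}

/-- Two triangles sharing the vertex `0`, and the two triangles on `1, 2, 3, 4` that
contain `{1, 2}`. -/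
def complex3b : FinComplex (Fin 7) :=
  generatedBy {{0, 1, 2}, {0, 3, 4}, {1, 2, 3}, {1, 2, 4}}

/-- Two triangles sharing the vertex `0`, and two triangles on `1, 2, 3, 4`, one containing
`{1, 2}` and one containing `{3, 4}`. -/
def complex3c : FinComplex (Fin 7) :=
  generatedBy {{0, 1, 2}, {0, 3, 4}, {1, 2, 3}, {1, 3, 4}}

/-- Two triangles sharing the vertex `0`, and three triangles on `1, 2, 3, 4`. -/
def complex3d : FinComplex (Fin 7) :=
  generatedBy {{0, 1, 2}, {0, 3, 4}, {1, 2, 3}, {1, 2, 4}, {1, 3, 4}}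

/-- Two triangles sharing the vertex `0`, and all four triangles on `1, 2, 3, 4`. -/
def complex3e : FinComplex (Fin 7) :=
  generatedBy {{0, 1, 2}, {0, 3, 4}, {1, 2, 3}, {1, 2, 4}, {1, 3, 4}, {2, 3, 4}}

/-- The band with triangles `{i, i+1, i+2}` modulo 5 (a Möbius band). -/
def complex4a : FinComplex (Fin 7) :=
  generatedBy {{0, 1, 2}, {1, 2, 3}, {2, 3, 4}, {3, 4, 0}, {4, 0, 1}}

/-- The band with triangles `{i, i+1, i+2}` modulo 6 (a cylinder). -/
def complex4b : FinComplex (Fin 7) :=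
  generatedBy {{0, 1, 2}, {1, 2, 3}, {2, 3, 4}, {3, 4, 5}, {4, 5, 0}, {5, 0, 1}}

/-- The band with triangles `{i, i+1, i+2}` modulo 7 (a Möbius band). -/
def complex4c : FinComplex (Fin 7) :=
  generatedBy {{0, 1, 2}, {1, 2, 3}, {2, 3, 4}, {3, 4, 5}, {4, 5, 6}, {5, 6, 0}, {6, 0, 1}}

/-- The twelve complexes of the classification. -/
def twelveComplexes : List (FinComplex (Fin 7)) :=
  [complex1a, complex1b, complex1c, complex2,
    complex3a, complex3b, complex3c, complex3d, complex3e,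
    complex4a, complex4b, complex4c]

end FinComplex

/-! ### Shellings built one face at a time -/

namespace FinComplex

set_option linter.unusedSectionVars false

variable {E : Type*} [DecidableEq E]

/-! In dimension at most two, shellability is a matter of the triangles and of the edge graph.
Dropping all smaller facets from a shelling leaves a shelling of the triangles
(`shelled_triangles`). Conversely, if the graph has no induced `2K₂`, a shelling of the triangles
extends to all facets (`isShellable_of_shelled_triangles`). As an induced `2K₂` is itself
nonshellable, a 2-dimensional obstruction has a graph without it, its triangles form a `Critical`
family `T`, and every vertex lies in a triangle. Edges outside the triangles matter only for
avoiding `2K₂`.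

There are three kinds of critical families. If `T` consists of two disjoint triangles, the edges
required between them lead to (1a)–(1c). If the link of some vertex has an induced `2K₂`, the five
vertices involved already carry a disconnected link, so there are no others; this leads to (2) and
(3a)–(3e). In the remaining case `T` is a band, as follows.

For a vertex `v`, take a maximal shelled family that contains all triangles without `v`. That no
further triangle attaches yields an edge `ab` of the link of `v` whose ends are separated in the
part of the link covered by triangles without `v` (`Critical.exists_sep`). Such a separation
produces a mod 2 cocycle that is not a coboundary (`not_shelled_of_sep`), which a shelled family
cannot have (`Shelled.exists_potential`). The argument only needs one triangle `axy` and one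
triangle `bzw` without `v`, so criticality confines all vertices to `v, a, b, x, y, z, w`
(`Critical.subset_of_sep`). According to the overlap of `xy` and `zw` there are five, six or seven
vertices, and separations at neighbouring vertices force the cyclic pattern of (4a)–(4c).

For the converse, each of the twelve complexes satisfies the finite conditions `Good`. One of them
forbids two disjoint pairs of vertices, edges or not, without an edge between them; unlike the
absence of induced `2K₂` this survives the addition of edges. Another says that each edge outside
the triangles is indispensable, which gives minimality. In dimension at most one, `2K₂` is the only
obstruction. -/

/-- The intersection of the closure of `σ` with the complex generated by `S` is empty or pure of
codimension one in `σ`. -/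
def Attaches (S : Finset (Finset E)) (σ : Finset E) : Prop :=
  ∀ τ ∈ S, ∃ τ' ∈ S, σ ∩ τ ⊆ τ' ∧ (σ ∩ τ').card + 1 = σ.card

/-- A family of sets that can be ordered so that each member attaches to the previous ones. -/
inductive Shelled : Finset (Finset E) → Prop
  | empty : Shelled ∅
  | attach {S : Finset (Finset E)} {σ : Finset E} :
      Shelled S → Attaches S σ → Shelled (insert σ S)

theorem Attaches.notMem {S : Finset (Finset E)} {σ : Finset E} (h : Attaches S σ) : σ ∉ S := by
  intro hσ
  obtain ⟨τ', -, h1, h2⟩ := h σ hσ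
  rw [Finset.inter_self] at h1
  rw [Finset.inter_eq_left.mpr h1] at h2
  omega

theorem attaches_empty (σ : Finset E) : Attaches ∅ σ := by simp [Attaches]

/-- The maximal faces of the intersection have the form `σ ∩ τ'` with `τ' ∈ S`, so purity can be
read off from these. An empty `S` is excluded because a pure family has to be nonempty. -/
theorem attaches_iff_isPureOfDim {S : Finset (Finset E)} {σ : Finset E} (hS : S.Nonempty) :
    Attaches S σ ↔
      IsPureOfDim (S.biUnion Finset.powerset ∩ σ.powerset) (faceDim σ - 1) := by
  have mem : ∀ ρ, ρ ∈ S.biUnion Finset.powerset ∩ σ.powerset ↔ (∃ τ ∈ S, ρ ⊆ τ) ∧ ρ ⊆ σ := by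
    intro ρ; simp
  constructor
  · intro h
    refine ⟨?_, ?_⟩
    · obtain ⟨τ, hτ⟩ := hS
      exact ⟨∅, (mem _).2 ⟨⟨τ, hτ, by simp⟩, by simp⟩⟩
    · intro ρ hρ
      obtain ⟨⟨τ, hτ, h1⟩, h2⟩ := (mem ρ).1 hρ.prop
      obtain ⟨τ', hτ', h3, h4⟩ := h τ hτ
      have h5 : ρ ⊆ σ ∩ τ' :=
        Finset.subset_inter h2 ((Finset.subset_inter h2 h1).trans h3)
      have h6 : ρ = σ ∩ τ' :=
        hρ.eq_of_le ((mem _).2 ⟨⟨τ', hτ', Finset.inter_subset_right⟩, Finset.inter_subset_left⟩) h5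
      rw [h6, faceDim, faceDim]
      omega
  · rintro ⟨-, h⟩ τ hτ
    obtain ⟨ρ, h1, hρ⟩ := Finset.exists_le_maximal _
      ((mem (σ ∩ τ)).2 ⟨⟨τ, hτ, Finset.inter_subset_right⟩, Finset.inter_subset_left⟩)
    obtain ⟨⟨τ', hτ', h3⟩, h4⟩ := (mem ρ).1 hρ.prop
    have h6 : ρ = σ ∩ τ' :=
      hρ.eq_of_le ((mem _).2 ⟨⟨τ', hτ', Finset.inter_subset_right⟩, Finset.inter_subset_left⟩)
        (Finset.subset_inter h4 h3)
    refine ⟨τ', hτ', h1.trans h3, ?_⟩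
    have := h ρ hρ
    rw [← h6]
    rw [faceDim, faceDim] at this
    omega

/-- The set of facets. -/
noncomputable def facets (Γ : FinComplex E) : Finset (Finset E) :=
  open Classical in Γ.faces.filter Γ.IsFacet

theorem mem_facets {Γ : FinComplex E} {σ : Finset E} : σ ∈ Γ.facets ↔ Γ.IsFacet σ := by
  simp only [facets, Finset.mem_filter, and_iff_right_iff_imp]
  exact fun h => h.prop

theorem exists_facet {Γ : FinComplex E} {s : Finset E} (hs : s ∈ Γ.faces) :
    ∃ σ ∈ Γ.facets, s ⊆ σ := by
  obtain ⟨ρ, h1, hρ⟩ := Finset.exists_le_maximal _ hs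
  exact ⟨ρ, mem_facets.2 hρ, h1⟩

theorem facet_mem_faces {Γ : FinComplex E} {σ : Finset E} (h : σ ∈ Γ.facets) : σ ∈ Γ.faces :=
  (mem_facets.1 h).prop

theorem facet_eq {Γ : FinComplex E} {σ s : Finset E} (h : σ ∈ Γ.facets) (hs : s ∈ Γ.faces)
    (hσ : σ ⊆ s) : σ = s :=
  (mem_facets.1 h).eq_of_le hs hσ

/-- Passing from lists to sets keeps only the existence of an order, which suits induction and
greedy extension. The first facet is unconstrained because every set attaches to the empty family.
-/
theorem isShellable_iff_shelled (Γ : FinComplex E) : Γ.IsShellable ↔ Shelled Γ.facets := by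
  constructor
  · rintro ⟨l, -, hl, hj⟩
    have key : ∀ n ≤ l.length, Shelled (l.take n).toFinset := by
      intro n
      induction n with
      | zero => intro _; simpa using Shelled.empty
      | succ n ih =>
        intro hn
        have hs := ih (by omega)
        have hn' : n < l.length := by omega
        have e : (l.take (n + 1)).toFinset = insert l[n] (l.take n).toFinset := by
          rw [List.take_succ_eq_append_getElem hn', List.toFinset_append, Finset.union_comm]
          rfl
        rw [e]
        refine hs.attach ?_
        rcases Nat.eq_zero_or_pos n with rfl | hpos
        · simpa using attaches_empty _
        · have hne : (l.take n).toFinset.Nonempty := by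
            refine ⟨l[0], ?_⟩
            rw [List.mem_toFinset, List.mem_take_iff_getElem]
            exact ⟨0, by omega, rfl⟩
          exact (attaches_iff_isPureOfDim hne).2 (hj n hn' hpos)
    have := key l.length le_rfl
    rw [List.take_length] at this
    convert this using 1
    ext σ
    rw [mem_facets, List.mem_toFinset, hl]
  · intro h
    have key : ∀ S : Finset (Finset E), Shelled S → ∃ l : List (Finset E), l.Nodup ∧
        l.toFinset = S ∧ ∀ (j : ℕ) (hj : j < l.length), 1 ≤ j →
          IsPureOfDim ((l.take j).toFinset.biUnion Finset.powerset ∩ (l[j]).powerset)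
            (faceDim l[j] - 1) := by
      intro S hS
      induction hS with
      | empty => exact ⟨[], by simp, by simp, by simp⟩
      | @attach S σ _ ha ih =>
        obtain ⟨l, h1, h2, h3⟩ := ih
        refine ⟨l ++ [σ], ?_, ?_, ?_⟩
        · have : σ ∉ l := by
            rw [← List.mem_toFinset, h2]; exact ha.notMem
          rw [List.nodup_append]
          refine ⟨h1, by simp, ?_⟩
          intro a haa b hb
          rw [List.mem_singleton] at hb
          rintro rfl
          exact this (hb ▸ haa)
        · ext x
          have := congrArg (x ∈ ·) h2
          simp only [List.mem_toFinset, eq_iff_iff] at this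
          simp [this]
        · intro j hj hj1
          rw [List.length_append, List.length_singleton] at hj
          rcases Nat.lt_or_ge j l.length with hlt | hge
          · rw [List.getElem_append_left hlt, List.take_append_of_le_length hlt.le]
            exact h3 j hlt hj1
          · have hjl : j = l.length := by omega
            subst hjl
            rw [List.getElem_append_right le_rfl, List.take_left]
            simp only [Nat.sub_self, List.getElem_cons_zero]
            rw [h2]
            refine (attaches_iff_isPureOfDim ?_).1 ha
            rw [← h2]
            exact ⟨l[0], by simp⟩
    obtain ⟨l, h1, h2, h3⟩ := key _ h
    refine ⟨l, h1, fun σ => ?_, h3⟩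
    rw [← mem_facets, ← h2, List.mem_toFinset]

/-! ### Reduction of shellability to the triangles and the edge graph -/

/-- The two-dimensional faces. -/
def triangles (Γ : FinComplex E) : Finset (Finset E) := Γ.faces.filter (fun s => s.card = 3)

theorem mem_triangles {Γ : FinComplex E} {s : Finset E} :
    s ∈ Γ.triangles ↔ s ∈ Γ.faces ∧ s.card = 3 := by
  simp [triangles]

theorem mem_restrict {Γ : FinComplex E} {W s : Finset E} :
    s ∈ (Γ.restrict W).faces ↔ s ∈ Γ.faces ∧ s ⊆ W := by
  simp [restrict]

theorem triangles_restrict (Γ : FinComplex E) (W : Finset E) :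
    (Γ.restrict W).triangles = Γ.triangles.filter (fun s => s ⊆ W) := by
  ext s
  simp only [mem_triangles, mem_restrict, Finset.mem_filter]
  tauto

/-- A triangle can attach only along triangles: a smaller facet meeting it in two vertices would be
contained in it, against maximality. So the smaller facets can be dropped from a shelling. -/
theorem shelled_triangles {Γ : FinComplex E} (hd : ∀ s ∈ Γ.faces, s.card ≤ 3)
    (h : Γ.IsShellable) : Shelled Γ.triangles := by
  rw [isShellable_iff_shelled] at h
  have key : ∀ S : Finset (Finset E), Shelled S → S ⊆ Γ.facets →
      Shelled (S.filter (fun s => s.card = 3)) := by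
    intro S hS
    induction hS with
    | empty => intro _; simpa using Shelled.empty
    | @attach S σ _ ha ih =>
      intro hsub
      have hS' := ih (fun x hx => hsub (Finset.mem_insert_of_mem hx))
      rw [Finset.filter_insert]
      split_ifs with hc
      · refine hS'.attach ?_
        intro τ hτ
        obtain ⟨τ', hτ', h1, h2⟩ := ha τ (Finset.mem_filter.1 hτ).1
        refine ⟨τ', Finset.mem_filter.2 ⟨hτ', ?_⟩, h1, h2⟩
        have hf := hsub (Finset.mem_insert_of_mem hτ')
        have h3 := hd τ' (facet_mem_faces hf)
        by_contra hne
        have h4 : σ ∩ τ' = τ' :=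
          Finset.eq_of_subset_of_card_le Finset.inter_subset_right (by omega)
        have h5 : τ' = σ := facet_eq hf
          (facet_mem_faces (hsub (Finset.mem_insert_self _ _))) (Finset.inter_eq_right.1 h4)
        rw [h5] at hne
        exact hne hc
      · exact hS'
  have := key _ h subset_rfl
  convert this using 1
  ext s
  rw [mem_triangles, Finset.mem_filter]
  constructor
  · rintro ⟨h1, h2⟩
    refine ⟨?_, h2⟩
    obtain ⟨σ, hσ, hs⟩ := exists_facet h1
    have := Finset.eq_of_subset_of_card_le hs (by rw [h2]; exact hd σ (facet_mem_faces hσ))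
    rwa [this]
  · rintro ⟨h1, h2⟩
    exact ⟨facet_mem_faces h1, h2⟩

/-- The graph of edges has no two disjoint edges without an edge between them. -/
def TwoK2Free (Γ : FinComplex E) : Prop :=
  ∀ a b c d : E, a ≠ b → c ≠ d → {a, b} ∈ Γ.faces → {c, d} ∈ Γ.faces →
    a ≠ c → a ≠ d → b ≠ c → b ≠ d →
    {a, c} ∈ Γ.faces ∨ {a, d} ∈ Γ.faces ∨ {b, c} ∈ Γ.faces ∨ {b, d} ∈ Γ.faces

/-- Greedy extension, which stops because `F` is finite. The failure of the remaining members to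
attach is what later arguments exploit. -/
theorem Shelled.exists_maximal {S F : Finset (Finset E)} (hS : Shelled S) (hF : S ⊆ F) :
    ∃ M, Shelled M ∧ S ⊆ M ∧ M ⊆ F ∧ ∀ σ ∈ F, σ ∉ M → ¬ Attaches M σ := by
  classical
  obtain ⟨M, h1, h2⟩ := Finset.exists_le_maximal (F.powerset.filter (fun M => Shelled M))
    (a := S) (by simp [hS, hF])
  have h3 := h2.prop
  rw [Finset.mem_filter, Finset.mem_powerset] at h3
  refine ⟨M, h3.2, h1, h3.1, fun σ hσ hσM ha => hσM ?_⟩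
  have : insert σ M = M := by
    refine (h2.eq_of_le (y := insert σ M) ?_ (Finset.subset_insert _ _)).symm
    rw [Finset.mem_filter, Finset.mem_powerset]
    exact ⟨Finset.insert_subset hσ h3.1, h3.2.attach ha⟩
  rw [← this]
  exact Finset.mem_insert_self _ _

/-- After the triangles come the edges, added greedily: an edge facet attaches as soon as it meets
some earlier facet, for then the intersection is generated by vertices. The process can only stop at
an edge that is disjoint from everything placed so far, and the absence of `2K₂` rules this out.
Isolated vertices come last. -/
theorem isShellable_of_shelled_triangles {Γ : FinComplex E} (hd : ∀ s ∈ Γ.faces, s.card ≤ 3)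
    (hG : Γ.TwoK2Free) (h : Shelled Γ.triangles) : Γ.IsShellable := by
  rw [isShellable_iff_shelled]
  have tri_facet : Γ.triangles ⊆ Γ.facets := by
    intro s hs
    rw [mem_triangles] at hs
    obtain ⟨σ, hσ, h1⟩ := exists_facet hs.1
    rwa [Finset.eq_of_subset_of_card_le h1 (by rw [hs.2]; exact hd σ (facet_mem_faces hσ))]
  -- the edges
  obtain ⟨M, hM, hTM, hMF, hmax⟩ := h.exists_maximal
    (F := Γ.facets.filter (fun s => 2 ≤ s.card)) (by
      intro s hs
      exact Finset.mem_filter.2 ⟨tri_facet hs, by rw [(mem_triangles.1 hs).2]; omega⟩)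
  have attach_edge : ∀ σ ∈ Γ.facets, σ.card = 2 → σ ∉ M → (∃ τ ∈ M, (σ ∩ τ).Nonempty) →
      Attaches M σ := by
    rintro σ hσ hc hσM ⟨τ₀, hτ₀, hne₀⟩
    have one : ∀ τ ∈ M, (σ ∩ τ).Nonempty → (σ ∩ τ).card + 1 = σ.card := by
      intro τ hτ hne
      have h1 : 0 < (σ ∩ τ).card := hne.card_pos
      have h2 : (σ ∩ τ).card ≤ σ.card := Finset.card_le_card Finset.inter_subset_left
      have h3 : (σ ∩ τ).card ≠ σ.card := by
        intro h4
        have h5 := Finset.eq_of_subset_of_card_le Finset.inter_subset_left h4.ge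
        have := facet_eq hσ (facet_mem_faces (Finset.mem_filter.1 (hMF hτ)).1)
          (Finset.inter_eq_left.1 h5)
        exact hσM (this ▸ hτ)
      omega
    intro τ hτ
    by_cases hne : (σ ∩ τ).Nonempty
    · exact ⟨τ, hτ, Finset.inter_subset_right, one τ hτ hne⟩
    · rw [Finset.not_nonempty_iff_eq_empty] at hne
      exact ⟨τ₀, hτ₀, by simp [hne], one τ₀ hτ₀ hne₀⟩
  have hMeq : M = Γ.facets.filter (fun s => 2 ≤ s.card) := by
    refine Finset.Subset.antisymm hMF ?_
    intro σ hσ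
    by_contra hσM
    have two : ∀ σ ∈ Γ.facets, 2 ≤ σ.card → σ ∉ M → σ.card = 2 := by
      intro σ hσ h2 hσM
      have h3 := hd σ (facet_mem_faces hσ)
      by_contra hne
      exact hσM (hTM (mem_triangles.2 ⟨facet_mem_faces hσ, by omega⟩))
    have hnot := hmax σ hσ hσM
    rw [Finset.mem_filter] at hσ
    have hc := two σ hσ.1 hσ.2 hσM
    have hdisj : ∀ τ ∈ M, ¬ (σ ∩ τ).Nonempty :=
      fun τ hτ hne => hnot (attach_edge σ hσ.1 hc hσM ⟨τ, hτ, hne⟩)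
    rcases M.eq_empty_or_nonempty with rfl | ⟨τ, hτ⟩
    · exact hnot (attaches_empty σ)
    have hτF := Finset.mem_filter.1 (hMF hτ)
    obtain ⟨a, ha, b, hb, hab⟩ := Finset.one_lt_card.1 hτF.2
    obtain ⟨c, d, hcd, rfl⟩ := Finset.card_eq_two.1 hc
    have habF : {a, b} ∈ Γ.faces := Γ.down_closed τ (facet_mem_faces hτF.1) _ (by
      intro x hx; simp at hx; rcases hx with rfl | rfl <;> assumption)
    have hτσ : ∀ x ∈ τ, ∀ y ∈ ({c, d} : Finset E), x ≠ y := by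
      rintro x hx y hy rfl
      exact hdisj τ hτ ⟨x, Finset.mem_inter.2 ⟨hy, hx⟩⟩
    -- An edge from `τ` to `{c, d}` would lie in a facet that is not yet placed, since `{c, d}`
    -- misses all placed facets. That facet is an edge meeting `τ`, so it would attach, against
    -- maximality of `M`.
    have cross : ∀ x ∈ τ, ∀ y ∈ ({c, d} : Finset E), {x, y} ∉ Γ.faces := by
      intro x hx y hy hxy
      obtain ⟨ρ, hρ, hs⟩ := exists_facet hxy
      have hxρ : x ∈ ρ := hs (by simp)
      have hyρ : y ∈ ρ := hs (by simp)
      have hρc : 2 ≤ ρ.card := by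
        have := Finset.card_le_card hs
        rwa [Finset.card_pair (hτσ x hx y hy)] at this
      have hρM : ρ ∉ M := fun hρM => hdisj ρ hρM ⟨y, Finset.mem_inter.2 ⟨hy, hyρ⟩⟩
      exact hmax ρ (Finset.mem_filter.2 ⟨hρ, hρc⟩) hρM
        (attach_edge ρ hρ (two ρ hρ hρc hρM) hρM ⟨τ, hτ, x, Finset.mem_inter.2 ⟨hxρ, hx⟩⟩)
    have hc' : c ∈ ({c, d} : Finset E) := by simp
    have hd' : d ∈ ({c, d} : Finset E) := by simp
    rcases hG a b c d hab hcd habF (facet_mem_faces hσ.1) (hτσ a ha c hc') (hτσ a ha d hd')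
      (hτσ b hb c hc') (hτσ b hb d hd') with h | h | h | h
    · exact cross a ha c hc' h
    · exact cross a ha d hd' h
    · exact cross b hb c hc' h
    · exact cross b hb d hd' h
  -- the remaining facets
  obtain ⟨N, hN, hMN, hNF, hmaxN⟩ := hM.exists_maximal (F := Γ.facets) (by
    rw [hMeq]; exact Finset.filter_subset _ _)
  have : N = Γ.facets := by
    refine Finset.Subset.antisymm hNF ?_
    intro σ hσ
    by_contra hσN
    apply hmaxN σ hσ hσN
    have hc : σ.card ≤ 1 := by
      by_contra hc
      exact hσN (hMN (by rw [hMeq]; exact Finset.mem_filter.2 ⟨hσ, by omega⟩))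
    intro τ hτ
    have hnsub : ¬ σ ⊆ τ := fun hs => hσN (by
      rw [facet_eq hσ (facet_mem_faces (hNF hτ)) hs]; exact hτ)
    have h1 : σ.card = 1 := by
      by_contra hne
      have : σ = ∅ := Finset.card_eq_zero.1 (by omega)
      exact hnsub (by simp [this])
    obtain ⟨x, rfl⟩ := Finset.card_eq_one.1 h1
    have hx : x ∉ τ := by simpa using hnsub
    -- An isolated vertex meets every other facet in `∅`, whose dimension `-1` is the required one.
    exact ⟨τ, hτ, Finset.inter_subset_right, by simp [hx]⟩
  rw [← this]
  exact hN

/-- Whichever of the two edges comes second meets the first only in `∅`, one dimension too low. -/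
theorem not_isShellable_of_disjoint_edges {Γ : FinComplex E} {a b c d : E}
    (hab : a ≠ b) (hcd : c ≠ d) (hac : a ≠ c) (had : a ≠ d) (hbc : b ≠ c) (hbd : b ≠ d)
    (h1 : {a, b} ∈ Γ.faces) (h2 : {c, d} ∈ Γ.faces)
    (h : ∀ s ∈ Γ.faces, s ⊆ {a, b} ∨ s ⊆ {c, d}) : ¬ Γ.IsShellable := by
  rw [isShellable_iff_shelled]
  have hdisj : ({a, b} : Finset E) ∩ {c, d} = ∅ := by
    ext x
    simp only [Finset.mem_inter, Finset.mem_insert, Finset.mem_singleton, Finset.notMem_empty,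
      iff_false]
    rintro ⟨rfl | rfl, rfl | rfl⟩ <;> contradiction
  have hdisj' : ({c, d} : Finset E) ∩ {a, b} = ∅ := by rw [Finset.inter_comm]; exact hdisj
  have facet : ∀ σ ∈ Γ.facets, σ = {a, b} ∨ σ = {c, d} := by
    intro σ hσ
    rcases h σ (facet_mem_faces hσ) with hs | hs
    · exact Or.inl (facet_eq hσ h1 hs)
    · exact Or.inr (facet_eq hσ h2 hs)
  have hne : ({a, b} : Finset E) ≠ {c, d} := by
    intro he
    rw [← he, Finset.inter_self] at hdisj
    simp at hdisj
  have key : ∀ S : Finset (Finset E), Shelled S → S ⊆ Γ.facets →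
      ¬ ({a, b} ∈ S ∧ {c, d} ∈ S) := by
    intro S hS
    induction hS with
    | empty => simp
    | @attach S σ _ ha ih =>
      intro hsub
      have ih' := ih (fun x hx => hsub (Finset.mem_insert_of_mem hx))
      rintro ⟨h3, h4⟩
      rw [Finset.mem_insert] at h3 h4
      have hσS := ha.notMem
      rcases facet σ (hsub (Finset.mem_insert_self _ _)) with rfl | rfl
      · have h4' : {c, d} ∈ S := h4.resolve_left (Ne.symm hne)
        obtain ⟨τ', hτ', -, hc⟩ := ha _ h4'
        rcases facet τ' (hsub (Finset.mem_insert_of_mem hτ')) with rfl | rfl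
        · exact hσS hτ'
        · rw [hdisj, Finset.card_pair hab] at hc; simp at hc
      · have h3' : {a, b} ∈ S := h3.resolve_left hne
        obtain ⟨τ', hτ', -, hc⟩ := ha _ h3'
        rcases facet τ' (hsub (Finset.mem_insert_of_mem hτ')) with rfl | rfl
        · rw [hdisj', Finset.card_pair hcd] at hc; simp at hc
        · exact hσS hτ'
  intro hS
  refine key _ hS subset_rfl ⟨?_, ?_⟩
  · obtain ⟨σ, hσ, hs⟩ := exists_facet h1
    rcases facet σ hσ with rfl | rfl
    · exact hσ
    · exfalso
      have := hs (Finset.mem_insert_self a {b})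
      simp [hac, had] at this
  · obtain ⟨σ, hσ, hs⟩ := exists_facet h2
    rcases facet σ hσ with rfl | rfl
    · exfalso
      have := hs (Finset.mem_insert_self c {d})
      simp [hac.symm, hbc.symm] at this
    · exact hσ

theorem not_isShellable_restrict {Γ : FinComplex E} {a b c d : E}
    (hab : a ≠ b) (hcd : c ≠ d) (hac : a ≠ c) (had : a ≠ d) (hbc : b ≠ c) (hbd : b ≠ d)
    (h1 : {a, b} ∈ Γ.faces) (h2 : {c, d} ∈ Γ.faces)
    (h : ¬ ({a, c} ∈ Γ.faces ∨ {a, d} ∈ Γ.faces ∨ {b, c} ∈ Γ.faces ∨ {b, d} ∈ Γ.faces)) :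
    (∀ s ∈ (Γ.restrict {a, b, c, d}).faces, s ⊆ {a, b} ∨ s ⊆ {c, d}) ∧
    ¬ (Γ.restrict {a, b, c, d}).IsShellable := by
  have hs : ∀ s ∈ (Γ.restrict {a, b, c, d}).faces, s ⊆ {a, b} ∨ s ⊆ {c, d} := by
    intro s hs
    rw [mem_restrict] at hs
    by_contra hcon
    rw [not_or, Finset.not_subset, Finset.not_subset] at hcon
    obtain ⟨⟨x, hx, hx'⟩, ⟨y, hy, hy'⟩⟩ := hcon
    have hxy : {y, x} ∈ Γ.faces := Γ.down_closed s hs.1 _ (by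
      intro z hz; simp at hz; rcases hz with rfl | rfl <;> assumption)
    have hxW := hs.2 hx
    have hyW := hs.2 hy
    simp only [Finset.mem_insert, Finset.mem_singleton] at hx' hy' hxW hyW
    have hx2 : x = c ∨ x = d := by tauto
    have hy2 : y = a ∨ y = b := by tauto
    rcases hx2 with rfl | rfl <;> rcases hy2 with rfl | rfl <;> tauto
  refine ⟨hs, not_isShellable_of_disjoint_edges hab hcd hac had hbc hbd ?_ ?_ hs⟩
  · rw [mem_restrict]
    exact ⟨h1, by intro z hz; simp at hz ⊢; tauto⟩
  · rw [mem_restrict]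
    exact ⟨h2, by intro z hz; simp at hz ⊢; tauto⟩

theorem dim_le_iff {Γ : FinComplex E} {n : ℕ} :
    Γ.dim ≤ n ↔ ∀ s ∈ Γ.faces, s.card ≤ n + 1 := by
  have : Γ.dim ≤ n ↔ Γ.faces.sup Finset.card ≤ n + 1 := by
    rw [dim]; omega
  rw [this, Finset.sup_le_iff]

theorem dim_eq_two_iff {Γ : FinComplex E} :
    Γ.dim = 2 ↔ (∀ s ∈ Γ.faces, s.card ≤ 3) ∧ Γ.triangles.Nonempty := by
  have h1 := dim_le_iff (Γ := Γ) (n := 2)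
  have h2 := dim_le_iff (Γ := Γ) (n := 1)
  constructor
  · intro h
    refine ⟨h1.1 (by rw [h]; rfl), ?_⟩
    by_contra hne
    have : ¬ Γ.dim ≤ (1 : ℕ) := by rw [h]; norm_num
    rw [h2] at this
    push Not at this
    obtain ⟨s, hs, hc⟩ := this
    have := h1.1 (by rw [h]; rfl) s hs
    exact hne ⟨s, mem_triangles.2 ⟨hs, by omega⟩⟩
  · rintro ⟨h, s, hs⟩
    have h3 : Γ.dim ≤ (2 : ℕ) := h1.2 h
    have h4 : ¬ Γ.dim ≤ (1 : ℕ) := by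
      rw [h2]
      intro h5
      have := h5 s (mem_triangles.1 hs).1
      rw [(mem_triangles.1 hs).2] at this
      omega
    push_cast at h3 h4
    omega

/-! ### What an obstruction imposes on its triangles and its graph -/

/-- A family of 3-sets that is not shelled, although all its proper restrictions are. -/
structure Critical (T : Finset (Finset E)) : Prop where
  card_eq : ∀ σ ∈ T, σ.card = 3
  not_shelled : ¬ Shelled T
  shelled_restrict : ∀ W : Finset E, (∃ σ ∈ T, ¬ σ ⊆ W) → Shelled (T.filter (fun σ => σ ⊆ W))

theorem TwoK2Free.restrict {Γ : FinComplex E} (h : Γ.TwoK2Free) (W : Finset E) :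
    (Γ.restrict W).TwoK2Free := by
  intro a b c d hab hcd h1 h2 hac had hbc hbd
  rw [mem_restrict] at h1 h2
  have ha : a ∈ W := h1.2 (by simp)
  have hb : b ∈ W := h1.2 (by simp)
  have hc : c ∈ W := h2.2 (by simp)
  have hd : d ∈ W := h2.2 (by simp)
  have pair : ∀ x ∈ W, ∀ y ∈ W, ({x, y} : Finset E) ⊆ W := by
    intro x hx y hy z hz
    simp at hz
    rcases hz with rfl | rfl <;> assumption
  simp only [mem_restrict]
  rcases h a b c d hab hcd h1.1 h2.1 hac had hbc hbd with h | h | h | h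
  · exact Or.inl ⟨h, pair _ ha _ hc⟩
  · exact Or.inr (Or.inl ⟨h, pair _ ha _ hd⟩)
  · exact Or.inr (Or.inr (Or.inl ⟨h, pair _ hb _ hc⟩))
  · exact Or.inr (Or.inr (Or.inr ⟨h, pair _ hb _ hd⟩))

theorem vertex_of_mem {Γ : FinComplex E} {s : Finset E} (hs : s ∈ Γ.faces) {x : E} (hx : x ∈ s) :
    x ∈ Γ.vertexSet :=
  Γ.down_closed s hs _ (by simpa using hx)

/-- Four vertices inducing `2K₂` span a nonshellable restriction; it is proper because the complex
has a triangle and `2K₂` has none. -/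
theorem IsObstruction.twoK2Free {Γ : FinComplex E} (h : Γ.IsObstruction)
    (hd : Γ.dim = 2) : Γ.TwoK2Free := by
  intro a b c d hab hcd h1 h2 hac had hbc hbd
  by_contra hcon
  obtain ⟨h3, h4⟩ := not_isShellable_restrict hab hcd hac had hbc hbd h1 h2 hcon
  apply h4
  apply h.2
  rw [Set.ssubset_iff_subset_ne]
  constructor
  · intro x hx
    simp only [Finset.coe_insert, Finset.coe_singleton, Set.mem_insert_iff,
      Set.mem_singleton_iff] at hx
    rcases hx with rfl | rfl | rfl | rfl
    · exact vertex_of_mem h1 (by simp)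
    · exact vertex_of_mem h1 (by simp)
    · exact vertex_of_mem h2 (by simp)
    · exact vertex_of_mem h2 (by simp)
  · intro he
    obtain ⟨-, s, hs⟩ := dim_eq_two_iff.1 hd
    rw [mem_triangles] at hs
    have : s ∈ (Γ.restrict {a, b, c, d}).faces := by
      rw [mem_restrict]
      refine ⟨hs.1, fun x hx => ?_⟩
      rw [← Finset.mem_coe, he]
      exact vertex_of_mem hs.1 hx
    rcases h3 s this with h5 | h5
    · have := Finset.card_le_card h5
      rw [hs.2, Finset.card_pair hab] at this
      omega
    · have := Finset.card_le_card h5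
      rw [hs.2, Finset.card_pair hcd] at this
      omega

theorem IsObstruction.critical {Γ : FinComplex E} (h : Γ.IsObstruction)
    (hd : Γ.dim = 2) : Critical Γ.triangles := by
  have hG := h.twoK2Free hd
  have hc := (dim_eq_two_iff.1 hd).1
  refine ⟨fun σ hσ => (mem_triangles.1 hσ).2,
    fun hs => h.1 (isShellable_of_shelled_triangles hc hG hs), ?_⟩
  rintro W ⟨σ, hσ, hσW⟩
  rw [mem_triangles] at hσ
  obtain ⟨x, hx, hxW⟩ := Finset.not_subset.1 hσW
  have hxV := vertex_of_mem hσ.1 hx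
  -- `W` may contain elements that are not vertices, whereas an obstruction only controls sets of
  -- vertices. The triangles inside `W` and inside `W'` are the same.
  set W' := W.filter (fun v => {v} ∈ Γ.faces) with hW'
  have h1 : (Γ.restrict W').IsShellable := by
    apply h.2
    rw [Set.ssubset_iff_of_subset]
    · exact ⟨x, hxV, by simp [hW', hxW]⟩
    · intro v hv
      simp [hW'] at hv
      exact hv.2
  have h2 := shelled_triangles (fun s hs => hc s (mem_restrict.1 hs).1) h1
  rw [triangles_restrict] at h2
  convert h2 using 1
  ext s
  simp only [Finset.mem_filter, mem_triangles, and_congr_right_iff]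
  intro hs
  refine ⟨fun hsW v hv => ?_, fun hsW v hv => ?_⟩
  · simp only [hW', Finset.mem_filter]
    exact ⟨hsW hv, vertex_of_mem hs.1 hv⟩
  · exact (Finset.mem_filter.1 (hsW hv)).1

/-- Deleting a vertex that is in no triangle keeps all triangles, and a shelling of these would
extend to the whole complex. -/
theorem IsObstruction.exists_triangle {Γ : FinComplex E} (h : Γ.IsObstruction)
    (hd : Γ.dim = 2) {v : E} (hv : v ∈ Γ.vertexSet) : ∃ σ ∈ Γ.triangles, v ∈ σ := by
  by_contra hcon
  push Not at hcon
  have hc := (dim_eq_two_iff.1 hd).1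
  apply h.1
  refine isShellable_of_shelled_triangles hc (h.twoK2Free hd) ?_
  set W := (Γ.faces.biUnion id).erase v with hW
  have h1 : (Γ.restrict W).IsShellable := by
    apply h.2
    rw [Set.ssubset_iff_of_subset]
    · exact ⟨v, hv, by simp [hW]⟩
    · intro x hx
      simp only [hW, Finset.coe_erase, Set.mem_sdiff, Finset.mem_coe, Finset.mem_biUnion] at hx
      obtain ⟨⟨s, hs, hxs⟩, -⟩ := hx
      exact vertex_of_mem hs hxs
  have h2 := shelled_triangles (fun s hs => hc s (mem_restrict.1 hs).1) h1
  rw [triangles_restrict, Finset.filter_true_of_mem] at h2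
  · exact h2
  · intro s hs x hx
    rw [hW, Finset.mem_erase, Finset.mem_biUnion]
    refine ⟨?_, s, (mem_triangles.1 hs).1, hx⟩
    rintro rfl
    exact hcon s hs hx

theorem isObstruction_of_triangles {Γ : FinComplex E} (hc : ∀ s ∈ Γ.faces, s.card ≤ 3)
    (hG : Γ.TwoK2Free) (hT : ¬ Shelled Γ.triangles)
    (h : ∀ W : Finset E, (W : Set E) ⊂ Γ.vertexSet →
      Shelled (Γ.triangles.filter (fun σ => σ ⊆ W))) : Γ.IsObstruction := by
  refine ⟨fun hs => hT (shelled_triangles hc hs), fun W hW => ?_⟩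
  refine isShellable_of_shelled_triangles (fun s hs => hc s (mem_restrict.1 hs).1)
    (hG.restrict W) ?_
  rw [triangles_restrict]
  exact h W hW

/-! ### Necessary conditions: connected links and vanishing mod 2 cohomology -/

theorem Shelled.link_connected {S : Finset (Finset E)} (h : Shelled S)
    (hc : ∀ σ ∈ S, σ.card = 3) {ρ : Finset E} (hρ : ρ.card ≤ 1) {A : Set E}
    (hA : ∀ σ ∈ S, ρ ⊆ σ → (∀ x ∈ σ, x ∉ ρ → x ∈ A) ∨ (∀ x ∈ σ, x ∉ ρ → x ∉ A)) :
    ∀ σ ∈ S, ρ ⊆ σ → ∀ τ ∈ S, ρ ⊆ τ → ∀ x ∈ σ, x ∉ ρ → ∀ y ∈ τ, y ∉ ρ → x ∈ A → y ∈ A := by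
  induction h with
  | empty => simp
  | @attach S σ _ ha ih =>
    have ih' := ih (fun τ hτ => hc τ (Finset.mem_insert_of_mem hτ))
      (fun τ hτ => hA τ (Finset.mem_insert_of_mem hτ))
    have hσ := hA σ (Finset.mem_insert_self _ _)
    -- The intersection of a newcomer `σ ⊇ ρ` with an earlier triangle over `ρ` lies in a shared
    -- edge `σ ∩ τ'`. Its two vertices exceed `|ρ| ≤ 1`, so a vertex outside `ρ` is shared and
    -- carries membership in `A` from one triangle to the other.
    have common : ρ ⊆ σ → ∀ τ ∈ S, ρ ⊆ τ → ∃ τ' ∈ S, ρ ⊆ τ' ∧ ∃ w ∈ σ, w ∈ τ' ∧ w ∉ ρ := by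
      intro hρσ τ hτ hρτ
      obtain ⟨τ', hτ', h1, h2⟩ := ha τ hτ
      refine ⟨τ', hτ', (Finset.subset_inter hρσ hρτ).trans h1, ?_⟩
      have h3 := hc σ (Finset.mem_insert_self _ _)
      obtain ⟨w, hw, hw'⟩ := Finset.exists_mem_notMem_of_card_lt_card
        (s := ρ) (t := σ ∩ τ') (by omega)
      rw [Finset.mem_inter] at hw
      exact ⟨w, hw.1, hw.2, hw'⟩
    intro σ₁ h1 hρ1 σ₂ h2 hρ2 x hx hxρ y hy hyρ hxA
    rw [Finset.mem_insert] at h1 h2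
    rcases h1 with rfl | h1
    · have allσ : ∀ z ∈ σ₁, z ∉ ρ → z ∈ A := by
        rcases hσ hρ1 with h | h
        · exact h
        · exact absurd hxA (h x hx hxρ)
      rcases h2 with rfl | h2
      · exact allσ y hy hyρ
      · obtain ⟨τ', hτ', hρτ', w, hw, hw', hwρ⟩ := common hρ1 σ₂ h2 hρ2
        exact ih' τ' hτ' hρτ' σ₂ h2 hρ2 w hw' hwρ y hy hyρ (allσ w hw hwρ)
    · rcases h2 with rfl | h2
      · obtain ⟨τ', hτ', hρτ', w, hw, hw', hwρ⟩ := common hρ2 σ₁ h1 hρ1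
        have hwA := ih' σ₁ h1 hρ1 τ' hτ' hρτ' x hx hxρ w hw' hwρ hxA
        rcases hσ hρ2 with h | h
        · exact h y hy hyρ
        · exact absurd hwA (h w hw hwρ)
      · exact ih' σ₁ h1 hρ1 σ₂ h2 hρ2 x hx hxρ y hy hyρ hxA

theorem Shelled.connected {S : Finset (Finset E)} (h : Shelled S)
    (hc : ∀ σ ∈ S, σ.card = 3) {A : Set E}
    (hA : ∀ σ ∈ S, (∀ x ∈ σ, x ∈ A) ∨ (∀ x ∈ σ, x ∉ A)) {σ τ : Finset E} (hσ : σ ∈ S)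
    (hτ : τ ∈ S) {x y : E} (hx : x ∈ σ) (hy : y ∈ τ) (hxA : x ∈ A) : y ∈ A :=
  h.link_connected hc (ρ := ∅) (by simp) (fun σ hσ _ => by simpa using hA σ hσ) σ hσ (by simp) τ hτ
    (by simp) x hx (by simp) y hy (by simp) hxA

theorem exists_triple_of_inter {σ τ : Finset E} (hσ : σ.card = 3) (h : (σ ∩ τ).card + 1 = σ.card) :
    ∃ x y z, x ≠ y ∧ x ≠ z ∧ y ≠ z ∧ σ = {x, y, z} ∧ x ∈ τ ∧ y ∈ τ ∧ z ∉ τ := by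
  obtain ⟨x, y, hxy, he⟩ := Finset.card_eq_two.1 (show (σ ∩ τ).card = 2 by omega)
  have hx : x ∈ σ ∩ τ := by rw [he]; simp
  have hy : y ∈ σ ∩ τ := by rw [he]; simp
  rw [Finset.mem_inter] at hx hy
  obtain ⟨z, hz, hz'⟩ := Finset.exists_mem_notMem_of_card_lt_card
    (s := σ ∩ τ) (t := σ) (by omega)
  have hxz : x ≠ z := by rintro rfl; exact hz' (Finset.mem_inter.2 hx)
  have hyz : y ≠ z := by rintro rfl; exact hz' (Finset.mem_inter.2 hy)
  refine ⟨x, y, z, hxy, hxz, hyz, ?_, hx.2, hy.2, fun h => hz' (Finset.mem_inter.2 ⟨hz, h⟩)⟩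
  symm
  apply Finset.eq_of_subset_of_card_le
  · intro w hw
    simp only [Finset.mem_insert, Finset.mem_singleton] at hw
    rcases hw with rfl | rfl | rfl
    exacts [hx.1, hy.1, hz]
  · rw [hσ, Finset.card_eq_three.2 ⟨x, y, z, hxy, hxz, hyz, rfl⟩]

/-- Every triangle but the first attaches along an edge, and the first is adjacent to the second;
`τ` ensures that there is a second one. -/
theorem Shelled.exists_adjacent {S : Finset (Finset E)} (h : Shelled S)
    (hc : ∀ σ ∈ S, σ.card = 3) : ∀ σ ∈ S, ∀ τ ∈ S, σ ≠ τ →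
      ∃ ρ ∈ S, ρ ≠ σ ∧ (σ ∩ ρ).card = 2 := by
  induction h with
  | empty => simp
  | @attach S σ₀ _ ha ih =>
    have ih' := ih (fun τ hτ => hc τ (Finset.mem_insert_of_mem hτ))
    have h0 := hc σ₀ (Finset.mem_insert_self _ _)
    have hn := ha.notMem
    have hfirst : ∀ τ ∈ S, ∃ ρ ∈ S, ρ ≠ σ₀ ∧ (σ₀ ∩ ρ).card = 2 := by
      intro τ hτ
      obtain ⟨ρ, hρ, -, h2⟩ := ha τ hτ
      exact ⟨ρ, hρ, fun h => hn (h ▸ hρ), by omega⟩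
    intro σ h1 τ h2 hne
    rw [Finset.mem_insert] at h1 h2
    rcases h1 with rfl | h1
    · obtain ⟨ρ, hρ, h3⟩ := hfirst τ (h2.resolve_left (Ne.symm hne))
      exact ⟨ρ, Finset.mem_insert_of_mem hρ, h3⟩
    · by_cases h3 : ∃ τ ∈ S, σ ≠ τ
      · obtain ⟨τ', hτ', hne'⟩ := h3
        obtain ⟨ρ, hρ, h3⟩ := ih' σ h1 τ' hτ' hne'
        exact ⟨ρ, Finset.mem_insert_of_mem hρ, h3⟩
      · push Not at h3
        obtain ⟨ρ, hρ, h4, h5⟩ := hfirst σ h1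
        rw [← h3 ρ hρ] at h4 h5
        exact ⟨σ₀, Finset.mem_insert_self _ _, h4.symm, by rw [Finset.inter_comm]; exact h5⟩

/-- Every mod 2 cocycle of a shelled family of triangles is a coboundary. -/
theorem Shelled.exists_potential {S : Finset (Finset E)} (h : Shelled S)
    (hc : ∀ σ ∈ S, σ.card = 3) {φ : E → E → ZMod 2} (hφ : ∀ x y, φ x y = φ y x)
    (hT : ∀ x y z, {x, y, z} ∈ S → φ x y + φ y z + φ x z = 0) :
    ∃ f : E → ZMod 2, ∀ σ ∈ S, ∀ x ∈ σ, ∀ y ∈ σ, x ≠ y → φ x y = f x + f y := by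
  have two : ∀ t : ZMod 2, t + t = 0 := by decide
  induction h with
  | empty => exact ⟨0, by simp⟩
  | @attach S σ _ ha ih =>
    obtain ⟨f, hf⟩ := ih (fun τ hτ => hc τ (Finset.mem_insert_of_mem hτ))
      (fun x y z h => hT x y z (Finset.mem_insert_of_mem h))
    have h0 := hc σ (Finset.mem_insert_self _ _)
    -- It suffices to match `φ` on two edges of the new triangle; the cocycle condition settles the
    -- third.
    have extend : ∀ (g : E → ZMod 2), (∀ τ ∈ S, ∀ x ∈ τ, ∀ y ∈ τ, x ≠ y → φ x y = g x + g y) →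
        (∃ x y z, x ≠ y ∧ x ≠ z ∧ y ≠ z ∧ σ = {x, y, z} ∧ φ x y = g x + g y ∧
          φ x z = g x + g z) → ∃ f : E → ZMod 2, ∀ τ ∈ insert σ S, ∀ x ∈ τ, ∀ y ∈ τ, x ≠ y →
            φ x y = f x + f y := by
      rintro g hg ⟨x, y, z, hxy, hxz, hyz, rfl, h1, h2⟩
      have h3 := hT x y z (Finset.mem_insert_self _ _)
      have h4 : φ y z = g y + g z := by
        rw [h1, h2] at h3
        have := two (g x)
        have e1 := two (g y)
        have e2 := two (g z)
        linear_combination h3 - this - e1 - e2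
      refine ⟨g, fun τ hτ => ?_⟩
      rw [Finset.mem_insert] at hτ
      rcases hτ with rfl | hτ
      · intro p hp q hq hpq
        simp only [Finset.mem_insert, Finset.mem_singleton] at hp hq
        rcases hp with rfl | rfl | rfl <;> rcases hq with rfl | rfl | rfl <;>
          first
          | exact absurd rfl hpq
          | assumption
          | (rw [hφ, add_comm]; assumption)
      · exact hg τ hτ
    rcases S.eq_empty_or_nonempty with rfl | ⟨τ, hτ⟩
    · obtain ⟨x, y, z, hxy, hxz, hyz, rfl⟩ := Finset.card_eq_three.1 h0
      refine extend (fun t => if t = x then 0 else φ x t) (by simp)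
        ⟨x, y, z, hxy, hxz, hyz, rfl, ?_, ?_⟩
      · simp [hxy.symm]
      · simp [hxz.symm]
    · obtain ⟨τ', hτ', -, h2⟩ := ha τ hτ
      obtain ⟨x, y, z, hxy, hxz, hyz, rfl, hx, hy, hz⟩ := exists_triple_of_inter h0 h2
      by_cases hzS : ∃ τ ∈ S, z ∈ τ
      -- Since `z` has occurred before, purity provides an edge of `σ` through `z` in an earlier
      -- triangle, so a second edge of `σ` is already matched.
      · obtain ⟨τ₁, hτ₁, hz1⟩ := hzS
        obtain ⟨τ₂, hτ₂, h3, h4⟩ := ha τ₁ hτ₁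
        have hz2 : z ∈ τ₂ := h3 (by simp [hz1])
        have hxy2 : x ∈ τ₂ ∨ y ∈ τ₂ := by
          by_contra hcon
          rw [not_or] at hcon
          have : ({x, y, z} : Finset E) ∩ τ₂ ⊆ {z} := by
            intro w hw
            simp only [Finset.mem_inter, Finset.mem_insert, Finset.mem_singleton] at hw ⊢
            rcases hw with ⟨rfl | rfl | rfl, hw⟩
            · exact absurd hw hcon.1
            · exact absurd hw hcon.2
            · rfl
          have := Finset.card_le_card this
          rw [Finset.card_singleton] at this
          omega
        rcases hxy2 with h5 | h5
        · exact extend f hf ⟨x, y, z, hxy, hxz, hyz, rfl, hf τ' hτ' x hx y hy hxy,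
            hf τ₂ hτ₂ x h5 z hz2 hxz⟩
        · refine extend f hf ⟨y, x, z, hxy.symm, hyz, hxz, ?_, hf τ' hτ' y hy x hx hxy.symm,
            hf τ₂ hτ₂ y h5 z hz2 hyz⟩
          exact Finset.insert_comm _ _ _
      · push Not at hzS
        -- Here `z` is new, so its potential is free and is chosen to match the edge `xz`.
        refine extend (Function.update f z (f x + φ x z)) ?_
          ⟨x, y, z, hxy, hxz, hyz, rfl, ?_, ?_⟩
        · intro ρ hρ p hp q hq hpq
          have hpz : p ≠ z := by rintro rfl; exact hzS ρ hρ hp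
          have hqz : q ≠ z := by rintro rfl; exact hzS ρ hρ hq
          rw [Function.update_of_ne hpz, Function.update_of_ne hqz]
          exact hf ρ hρ p hp q hq hpq
        · rw [Function.update_of_ne hxz, Function.update_of_ne hyz]
          exact hf τ' hτ' x hx y hy hxy
        · rw [Function.update_of_ne hxz, Function.update_self]
          linear_combination - two (f x)

/-! ### Separated edges of vertex links -/

/-- `{a, b, c}` belongs to `T`. -/
def Tri (T : Finset (Finset E)) (a b c : E) : Prop := ({a, b, c} : Finset E) ∈ T

section Tri

variable {T : Finset (Finset E)} {a b c : E}

theorem Tri.swap (h : Tri T a b c) : Tri T b a c := by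
  have : ({b, a, c} : Finset E) = {a, b, c} := Finset.insert_comm _ _ _
  rwa [Tri, this]

theorem Tri.rot (h : Tri T a b c) : Tri T b c a := by
  have : ({b, c, a} : Finset E) = {a, b, c} := by ext; simp; tauto
  rwa [Tri, this]

theorem Tri.swap' (h : Tri T a b c) : Tri T a c b := h.rot.swap.rot.rot

theorem Tri.rot' (h : Tri T a b c) : Tri T c a b := h.rot.rot

theorem Tri.rev (h : Tri T a b c) : Tri T c b a := h.rot.swap

theorem Tri.ne (h : Tri T a b c) (hc : ∀ σ ∈ T, σ.card = 3) : a ≠ b ∧ a ≠ c ∧ b ≠ c := by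
  have h3 := hc _ h
  refine ⟨?_, ?_, ?_⟩
  · rintro rfl
    rw [Finset.insert_eq_of_mem (by simp)] at h3
    have := Finset.card_le_two (a := a) (b := c)
    omega
  · rintro rfl
    rw [Finset.insert_comm, Finset.pair_eq_singleton] at h3
    have := Finset.card_le_two (a := b) (b := a)
    omega
  · rintro rfl
    rw [Finset.pair_eq_singleton] at h3
    have := Finset.card_le_two (a := a) (b := b)
    omega

theorem exists_tri_of_mem (hc : ∀ σ ∈ T, σ.card = 3) {σ : Finset E} (hσ : σ ∈ T)
    {v : E} (hv : v ∈ σ) : ∃ x y, Tri T v x y ∧ σ = {v, x, y} := by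
  obtain ⟨p, q, r, -, -, -, rfl⟩ := Finset.card_eq_three.1 (hc σ hσ)
  have h : Tri T p q r := hσ
  simp only [Finset.mem_insert, Finset.mem_singleton] at hv
  rcases hv with rfl | rfl | rfl
  · exact ⟨q, r, h, rfl⟩
  · exact ⟨p, r, h.swap, Finset.insert_comm _ _ _⟩
  · exact ⟨p, q, h.rot', by ext; simp; tauto⟩

end Tri

/-- The edge `{x, y}` lies in a triangle without `v`. -/
def Covered (T : Finset (Finset E)) (v x y : E) : Prop := ∃ z, z ≠ v ∧ Tri T x y z

/-- `a` and `b` are separated in the part of the link of `v` that is covered by the triangles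
without `v`. -/
def Sep (T : Finset (Finset E)) (v a b : E) : Prop :=
  ∃ A : Set E, a ∈ A ∧ b ∉ A ∧ ∀ x y, Tri T v x y → Covered T v x y → (x ∈ A ↔ y ∈ A)

section Sep

variable {T : Finset (Finset E)} {v a b c : E}

theorem Covered.symm (h : Covered T v a b) : Covered T v b a := by
  obtain ⟨z, hz, h⟩ := h
  exact ⟨z, hz, h.swap⟩

theorem Sep.symm (h : Sep T v a b) : Sep T v b a := by
  obtain ⟨A, h1, h2, h3⟩ := h
  exact ⟨Aᶜ, h2, fun h => h h1, fun x y hxy hc => not_congr (h3 x y hxy hc)⟩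

theorem Sep.trans_right (h : Sep T v a b) (hbc : Tri T v b c) (hc : Covered T v b c) :
    Sep T v a c := by
  obtain ⟨A, h1, h2, h3⟩ := h
  exact ⟨A, h1, fun h => h2 ((h3 b c hbc hc).2 h), h3⟩

theorem Sep.trans_left (h : Sep T v a b) (hac : Tri T v a c) (hc : Covered T v a c) :
    Sep T v c b := (h.symm.trans_right hac hc).symm

theorem Sep.not_covered (h : Sep T v a b) (hab : Tri T v a b) : ¬ Covered T v a b := by
  obtain ⟨A, h1, h2, h3⟩ := h
  exact fun hc => h2 ((h3 a b hab hc).1 h1)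

end Sep

/-- Topologically, the star of `v` and the family without `v` are both connected, but where they
meet `a` and `b` lie in different components; this creates a loop. The proof writes down a cocycle
that detects the loop and shows that it has no potential. -/
theorem not_shelled_of_sep {T : Finset (Finset E)} (hc : ∀ σ ∈ T, σ.card = 3) {v a b : E}
    (hv : Shelled (T.filter (fun σ => v ∉ σ))) (hab : Tri T v a b) (hs : Sep T v a b)
    (ha : ∃ σ ∈ T, v ∉ σ ∧ a ∈ σ) (hb : ∃ σ ∈ T, v ∉ σ ∧ b ∈ σ) : ¬ Shelled T := by
  classical
  intro hT
  have two : ∀ t : ZMod 2, t + t = 0 := by decide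
  obtain ⟨A, haA, hbA, hA⟩ := hs
  let g : E → ZMod 2 := fun x => if x ∈ A then 1 else 0
  -- On edges at `v` the cocycle is the indicator of `A`. It vanishes on edges of triangles without
  -- `v`; on an uncovered link edge `xy` the triangle `vxy` forces the value `g x + g y`.
  let φ : E → E → ZMod 2 := fun x y =>
    if x = v then g y else if y = v then g x else if Covered T v x y then 0 else g x + g y
  have hg : ∀ x y, (x ∈ A ↔ y ∈ A) → g x = g y := by
    intro x y h
    simp only [g, h]
  have hφv : ∀ y, φ v y = g y := by intro y; simp [φ]
  have hφv' : ∀ y, y ≠ v → φ y v = g y := by intro y hy; simp [φ, hy]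
  have hsymm : ∀ x y, φ x y = φ y x := by
    intro x y
    by_cases hx : x = v
    · by_cases hy : y = v
      · rw [hx, hy]
      · rw [hx, hφv, hφv' y hy]
    · by_cases hy : y = v
      · rw [hy, hφv, hφv' x hx]
      · have : Covered T v x y ↔ Covered T v y x := ⟨Covered.symm, Covered.symm⟩
        simp only [φ, hx, hy, if_false, this, add_comm]
  have hstar : ∀ x y, Tri T v x y → φ v x + φ x y + φ v y = 0 := by
    intro x y h
    obtain ⟨h1, h2, -⟩ := h.ne hc
    rw [hφv, hφv]
    by_cases hcov : Covered T v x y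
    · simp only [φ, h1.symm, h2.symm, if_false, hcov, if_true, hg x y (hA x y h hcov), add_zero]
      exact two _
    · simp only [φ, h1.symm, h2.symm, if_false, hcov]
      linear_combination two (g x) + two (g y)
  have hzero : ∀ x y z, Tri T x y z → x ≠ v → y ≠ v → z ≠ v → φ x y = 0 := by
    intro x y z h hx hy hz
    have : Covered T v x y := ⟨z, hz, h⟩
    simp [φ, hx, hy, this]
  obtain ⟨f, hf⟩ := hT.exists_potential hc hsymm (by
    intro x y z h
    have h : Tri T x y z := h
    by_cases hx : x = v
    · subst hx; exact hstar y z h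
    by_cases hy : y = v
    · subst hy
      rw [hsymm x y]
      linear_combination hstar x z h.swap
    by_cases hz : z = v
    · subst hz
      rw [hsymm x z, hsymm y z]
      linear_combination hstar x y h.rot'
    rw [hzero x y z h hx hy hz, hzero y z x h.rot hy hz hx, hzero x z y h.swap' hx hz hy]
    simp)
  -- On triangles without `v` the cocycle vanishes, so the potential is constant on each of them,
  -- and connectedness carries its value from `a` to `b`. But `φ v a` and `φ v b` differ.
  have hfab : f a = f b := by
    obtain ⟨σ, hσ, hvσ, haσ⟩ := ha
    obtain ⟨τ, hτ, hvτ, hbτ⟩ := hb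
    refine (hv.connected (fun σ hσ => hc σ (Finset.mem_filter.1 hσ).1) (A := {x | f a = f x}) ?_
      (Finset.mem_filter.2 ⟨hσ, hvσ⟩) (Finset.mem_filter.2 ⟨hτ, hvτ⟩) haσ hbτ rfl)
    intro ρ hρ
    rw [Finset.mem_filter] at hρ
    have hconst : ∀ x ∈ ρ, ∀ y ∈ ρ, f x = f y := by
      intro x hx y hy
      by_cases hxy : x = y
      · rw [hxy]
      have h1 := hf ρ hρ.1 x hx y hy hxy
      obtain ⟨p, q, hpq, rfl⟩ := exists_tri_of_mem hc hρ.1 hx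
      have hnv : v ≠ x ∧ v ≠ p ∧ v ≠ q := by simpa using hρ.2
      have h2 : φ x y = 0 := by
        simp only [Finset.mem_insert, Finset.mem_singleton] at hy
        rcases hy with rfl | rfl | rfl
        · exact absurd rfl hxy
        · exact hzero _ _ _ hpq hnv.1.symm hnv.2.1.symm hnv.2.2.symm
        · exact hzero _ _ _ hpq.swap' hnv.1.symm hnv.2.2.symm hnv.2.1.symm
      rw [h2] at h1
      linear_combination -h1 - two (f y)
    by_cases h : ∃ x ∈ ρ, f a = f x
    · obtain ⟨x, hx, hax⟩ := h
      exact Or.inl fun y hy => hax.trans (hconst x hx y hy)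
    · push Not at h
      exact Or.inr h
  obtain ⟨h1, h2, h3⟩ := hab.ne hc
  have e1 := hf _ hab v (by simp) a (by simp) h1
  have e2 := hf _ hab v (by simp) b (by simp) h2
  rw [hφv] at e1 e2
  have e3 : g a = g b := by rw [e1, e2, hfab]
  simp [g, haA, hbA] at e3

/-! ### Sufficient conditions for attaching a triangle -/

section SufficientAttach

variable {S : Finset (Finset E)}

/-- A common pair of vertices has codimension one, an empty intersection lies in every face, and a
single common vertex is harmless once it lies on a shared edge. -/
theorem attaches_of_edges (hc : ∀ σ ∈ S, σ.card = 3) {σ : Finset E} (hσ : σ.card = 3)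
    (hσS : σ ∉ S) (h0 : ∃ τ ∈ S, 2 ≤ (σ ∩ τ).card)
    (h1 : ∀ x ∈ σ, (∃ τ ∈ S, x ∈ τ) → ∃ τ ∈ S, x ∈ τ ∧ 2 ≤ (σ ∩ τ).card) : Attaches S σ := by
  have le : ∀ τ ∈ S, 2 ≤ (σ ∩ τ).card → (σ ∩ τ).card + 1 = σ.card := by
    intro τ hτ h2
    have h3 : (σ ∩ τ).card ≤ σ.card := Finset.card_le_card Finset.inter_subset_left
    have h4 : (σ ∩ τ).card ≠ σ.card := by
      intro h4
      have h5 := Finset.inter_eq_left.1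
        (Finset.eq_of_subset_of_card_le Finset.inter_subset_left h4.ge)
      have := Finset.eq_of_subset_of_card_le h5 (by rw [hσ, hc τ hτ])
      exact hσS (this ▸ hτ)
    omega
  intro τ hτ
  by_cases h2 : 2 ≤ (σ ∩ τ).card
  · exact ⟨τ, hτ, Finset.inter_subset_right, le τ hτ h2⟩
  rcases (σ ∩ τ).eq_empty_or_nonempty with he | ⟨x, hx⟩
  · obtain ⟨τ', hτ', h3⟩ := h0
    exact ⟨τ', hτ', by simp [he], le τ' hτ' h3⟩
  · have hx' := Finset.mem_inter.1 hx
    obtain ⟨τ', hτ', hxτ', h3⟩ := h1 x hx'.1 ⟨τ, hτ, hx'.2⟩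
    refine ⟨τ', hτ', ?_, le τ' hτ' h3⟩
    intro y hy
    have : (σ ∩ τ).card ≤ 1 := by omega
    rw [Finset.card_le_one.1 this y hy x hx]
    exact hxτ'

theorem two_le_card_inter {σ τ : Finset E} {x y : E} (hxy : x ≠ y) (h1 : x ∈ σ) (h2 : y ∈ σ)
    (h3 : x ∈ τ) (h4 : y ∈ τ) : 2 ≤ (σ ∩ τ).card := by
  rw [← Finset.card_pair hxy]
  apply Finset.card_le_card
  intro z hz
  simp only [Finset.mem_insert, Finset.mem_singleton] at hz
  rcases hz with rfl | rfl
  · exact Finset.mem_inter.2 ⟨h1, h3⟩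
  · exact Finset.mem_inter.2 ⟨h2, h4⟩

/-- A triangle attaches if it has an edge `{x, y}` in a triangle of `S`, and its third vertex `z`
is new or `{x, z}` is an edge of a triangle of `S`. -/
theorem attaches_triangle (hc : ∀ σ ∈ S, σ.card = 3) {x y z : E} (hσ : ({x, y, z} : Finset E).card = 3)
    (hxy : x ≠ y) (hxz : x ≠ z) (hS : {x, y, z} ∉ S) (h1 : ∃ τ ∈ S, x ∈ τ ∧ y ∈ τ)
    (h2 : (∀ τ ∈ S, z ∉ τ) ∨ ∃ τ ∈ S, x ∈ τ ∧ z ∈ τ) : Attaches S {x, y, z} := by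
  obtain ⟨τ, hτ, hx, hy⟩ := h1
  have h3 : 2 ≤ (({x, y, z} : Finset E) ∩ τ).card :=
    two_le_card_inter hxy (by simp) (by simp) hx hy
  refine attaches_of_edges hc hσ hS ⟨τ, hτ, h3⟩ ?_
  rintro w hw ⟨τ', hτ', hwτ'⟩
  simp only [Finset.mem_insert, Finset.mem_singleton] at hw
  rcases hw with rfl | rfl | rfl
  · exact ⟨τ, hτ, hx, h3⟩
  · exact ⟨τ, hτ, hy, h3⟩
  · rcases h2 with h2 | ⟨τ₂, hτ₂, hx2, hz2⟩
    · exact absurd hwτ' (h2 τ' hτ')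
    · exact ⟨τ₂, hτ₂, hz2, two_le_card_inter hxz (by simp) (by simp) hx2 hz2⟩

end SufficientAttach

/-! ### Critical families and the separations at their vertices -/

/-- The links of the vertices have no induced `2K₂`. -/
def LinksTwoK2Free (T : Finset (Finset E)) : Prop :=
  ∀ u a b c d : E, Tri T u a b → Tri T u c d → a ≠ c → a ≠ d → b ≠ c → b ≠ d →
    Tri T u a c ∨ Tri T u a d ∨ Tri T u b c ∨ Tri T u b d

namespace Critical

variable {T : Finset (Finset E)}

/-- This is how every bound on the vertex set arises: a restriction that is not shelled must be the
whole family. -/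
theorem subset_of_not_shelled (h : Critical T) {W : Finset E}
    (hW : ¬ Shelled (T.filter (fun σ => σ ⊆ W))) : ∀ σ ∈ T, σ ⊆ W := by
  intro σ hσ
  by_contra hσW
  exact hW (h.shelled_restrict W ⟨σ, hσ, hσW⟩)

theorem shelled_delete (h : Critical T) {v : E} (hv : ∃ σ ∈ T, v ∈ σ) :
    Shelled (T.filter (fun σ => v ∉ σ)) := by
  obtain ⟨σ, hσ, hvσ⟩ := hv
  have := h.shelled_restrict ((T.biUnion id).erase v) ⟨σ, hσ, fun hs => by
    simpa using hs hvσ⟩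
  convert this using 1
  ext τ
  simp only [Finset.mem_filter, and_congr_right_iff]
  intro hτ
  rw [Finset.subset_erase]
  exact ⟨fun hv => ⟨Finset.subset_biUnion_of_mem id hτ, hv⟩, fun hv => hv.2⟩

/-- A separated edge of a link determines the vertex set. -/
theorem subset_of_sep (h : Critical T) {v a b x y z w : E} (hab : Tri T v a b)
    (hs : Sep T v a b) (hx : Tri T a x y) (hz : Tri T b z w) (hvx : v ≠ x) (hvy : v ≠ y)
    (hvz : v ≠ z) (hvw : v ≠ w) : ∀ σ ∈ T, σ ⊆ {v, a, b, x, y, z, w} := by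
  obtain ⟨hva, hvb, -⟩ := hab.ne h.card_eq
  apply h.subset_of_not_shelled
  set W : Finset E := {v, a, b, x, y, z, w} with hW
  have hsub : ∀ p q r, Tri T p q r → p ∈ W → q ∈ W → r ∈ W →
      Tri (T.filter (fun σ => σ ⊆ W)) p q r := by
    intro p q r hT hp hq hr
    refine Finset.mem_filter.2 ⟨hT, ?_⟩
    intro t ht
    simp only [Finset.mem_insert, Finset.mem_singleton] at ht
    rcases ht with rfl | rfl | rfl <;> assumption
  -- The separation at `v` passes to the subfamily inside `W`, and one triangle at `a` and one at
  -- `b` without `v` are enough.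
  refine not_shelled_of_sep (fun σ hσ => h.card_eq σ (Finset.mem_filter.1 hσ).1) (v := v) (a := a)
    (b := b) ?_ (hsub _ _ _ hab (by simp [hW]) (by simp [hW]) (by simp [hW])) ?_ ?_ ?_
  · have := h.shelled_restrict (W.erase v) ⟨_, hab, fun hs => by
      have := hs (Finset.mem_insert_self _ _)
      simp at this⟩
    convert this using 1
    ext τ
    simp only [Finset.mem_filter, Finset.subset_erase, and_assoc]
  · obtain ⟨A, h1, h2, h3⟩ := hs
    refine ⟨A, h1, h2, ?_⟩
    rintro p q hpq ⟨r, hr, hpqr⟩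
    exact h3 p q (Finset.mem_filter.1 hpq).1 ⟨r, hr, (Finset.mem_filter.1 hpqr).1⟩
  · exact ⟨_, hsub _ _ _ hx (by simp [hW]) (by simp [hW]) (by simp [hW]),
      by simp [hva, hvx, hvy], by simp⟩
  · exact ⟨_, hsub _ _ _ hz (by simp [hW]) (by simp [hW]) (by simp [hW]),
      by simp [hvb, hvz, hvw], by simp⟩

/-- If a link has an induced `2K₂`, there are only five vertices. -/
theorem eq_of_link (h : Critical T) {u a b c d : E} (hab : Tri T u a b) (hcd : Tri T u c d)
    (hac : a ≠ c) (had : a ≠ d) (hbc : b ≠ c) (hbd : b ≠ d)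
    (hn : ¬ (Tri T u a c ∨ Tri T u a d ∨ Tri T u b c ∨ Tri T u b d)) :
    ∀ σ ∈ T, σ ⊆ {u, a, b, c, d} := by
  obtain ⟨hua, hub, hab'⟩ := hab.ne h.card_eq
  obtain ⟨huc, hud, hcd'⟩ := hcd.ne h.card_eq
  apply h.subset_of_not_shelled
  intro hS
  -- Inside these five vertices the link of `u` consists of the edges `ab` and `cd` only, so it is
  -- disconnected.
  have key := hS.link_connected (fun σ hσ => h.card_eq σ (Finset.mem_filter.1 hσ).1) (ρ := {u})
    (by simp) (A := {a, b}) (by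
      intro σ hσ hu
      rw [Finset.mem_filter] at hσ
      rw [Finset.singleton_subset_iff] at hu
      obtain ⟨x, y, hxy, rfl⟩ := exists_tri_of_mem h.card_eq hσ.1 hu
      obtain ⟨hux, huy, hxy'⟩ := hxy.ne h.card_eq
      have hx : x ∈ ({u, a, b, c, d} : Finset E) := hσ.2 (by simp)
      have hy : y ∈ ({u, a, b, c, d} : Finset E) := hσ.2 (by simp)
      have hyx := hxy.swap'
      simp only [Finset.mem_insert, Finset.mem_singleton] at hx hy
      simp only [Finset.mem_insert, Finset.mem_singleton, forall_eq_or_imp, forall_eq,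
        Set.mem_insert_iff, Set.mem_singleton_iff]
      rcases hx with rfl | rfl | rfl | rfl | rfl <;> rcases hy with rfl | rfl | rfl | rfl | rfl <;>
        simp_all [eq_comm])
    _ (Finset.mem_filter.2 ⟨hab, by intro t; simp; tauto⟩) (by simp)
    _ (Finset.mem_filter.2 ⟨hcd, by intro t; simp; tauto⟩) (by simp)
    a (by simp) (by simp [hua.symm]) c (by simp) (by simp [huc.symm]) (by simp)
  simp [hac.symm, hbc.symm] at key

/-- In the link of `a` the edges `vb` and `xy` are disjoint and must be joined. The joining edge
cannot start at `b`, because `vab` is the only triangle on the separated edge `ab`. -/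
theorem tri_or_of_sep (hL : LinksTwoK2Free T) {v a b x y : E}
    (hab : Tri T v a b) (hs : Sep T v a b) (hx : Tri T a x y) (hvx : v ≠ x) (hvy : v ≠ y) :
    Tri T v a x ∨ Tri T v a y := by
  have hfree := hs.not_covered hab
  have hb : ∀ t, Tri T a b t → t = v := by
    intro t ht
    by_contra hne
    exact hfree ⟨t, hne, ht⟩
  have hbx : b ≠ x := by
    rintro rfl
    exact hvy (hb _ hx).symm
  have hby : b ≠ y := by
    rintro rfl
    exact hvx (hb _ hx.swap').symm
  rcases hL a v b x y hab.swap hx hvx hvy hbx hby with h1 | h1 | h1 | h1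
  · exact Or.inl h1.swap
  · exact Or.inr h1.swap
  · exact absurd (hb _ h1).symm hvx
  · exact absurd (hb _ h1).symm hvy

/-- Two disjoint triangles. -/
def TwoDisjoint (T : Finset (Finset E)) : Prop :=
  ∃ σ τ : Finset E, σ.card = 3 ∧ τ.card = 3 ∧ Disjoint σ τ ∧ T = {σ, τ}

/-- Extend the family without `v` to a maximal shelled family `S`, and let `A` be the set of
neighbours of `v` in triangles of `S`. Maximality makes `A` closed under covered link edges and
yields a link edge leaving `A`. If `S` has no triangle at `v`, then `T` falls apart into two
disjoint triangles. The triangle `vcd` inside `A` is recorded for `exists_sep`. -/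
theorem exists_sep_aux (h : Critical T) (hL : LinksTwoK2Free T) (hD : ¬ TwoDisjoint T) {v : E}
    (hv : ∃ σ ∈ T, v ∈ σ) :
    ∃ A : Set E, ∃ a b, Tri T v a b ∧ a ∈ A ∧ b ∉ A ∧
      (∀ x y, Tri T v x y → Covered T v x y → (x ∈ A ↔ y ∈ A)) ∧
      (∃ c d, Tri T v c d ∧ c ∈ A ∧ d ∈ A) ∧ ∃ x y, Tri T b x y ∧ v ≠ x ∧ v ≠ y := by
  have hc := h.card_eq
  obtain ⟨S, hS, hdS, hST, hmax⟩ := (h.shelled_delete hv).exists_maximal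
    (Finset.filter_subset _ T)
  have hcS : ∀ σ ∈ S, σ.card = 3 := fun σ hσ => hc σ (hST hσ)
  have del : ∀ {p q r}, Tri T p q r → v ≠ p → v ≠ q → v ≠ r → Tri S p q r := by
    intro p q r hpqr h1 h2 h3
    exact hdS (Finset.mem_filter.2 ⟨hpqr, by simp [h1, h2, h3]⟩)
  obtain ⟨σ₀, hσ₀, hσ₀S⟩ : ∃ σ ∈ T, σ ∉ S := by
    by_contra hcon
    push Not at hcon
    exact h.not_shelled (by rwa [← Finset.Subset.antisymm hST hcon])
  have hvσ₀ : v ∈ σ₀ := by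
    by_contra hn
    exact hσ₀S (hdS (Finset.mem_filter.2 ⟨hσ₀, hn⟩))
  obtain ⟨a₀, b₀, h₀, rfl⟩ := exists_tri_of_mem hc hσ₀ hvσ₀
  have hnS : ¬ Tri S v a₀ b₀ := hσ₀S
  by_cases hvS : ∃ c d, Tri S v c d
  · obtain ⟨c, d, hcd⟩ := hvS
    have hcdT : Tri T v c d := hST hcd
    let A : Set E := {x | ∃ y, Tri S v x y}
    have hcA : c ∈ A := ⟨d, hcd⟩
    have hdA : d ∈ A := ⟨c, hcd.swap'⟩
    have notS : ∀ {x y}, y ∉ A → ¬ Tri S v x y := fun hy h => hy ⟨_, h.swap'⟩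
    -- A missing triangle `vxy` with `x ∈ A` would attach if `y` were new, if `vy` were an edge of
    -- `S`, or if `xy` were one. Maximality excludes all three.
    have noattach : ∀ {x y}, Tri T v x y → ¬ Tri S v x y → x ∈ A →
        (∃ τ ∈ S, y ∈ τ) ∧ y ∉ A ∧ ∀ τ ∈ S, x ∈ τ → y ∉ τ := by
      rintro x y hxy hn ⟨x', hx'⟩
      obtain ⟨h1, h2, h3⟩ := hxy.ne hc
      refine ⟨?_, ?_, ?_⟩
      · by_contra hcon
        push Not at hcon
        exact hmax _ hxy hn (attaches_triangle hcS (hc _ hxy) h1 h2 hn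
          ⟨_, hx', by simp, by simp⟩ (Or.inl hcon))
      · rintro ⟨y', hy'⟩
        exact hmax _ hxy hn (attaches_triangle hcS (hc _ hxy) h1 h2 hn
          ⟨_, hx', by simp, by simp⟩ (Or.inr ⟨_, hy', by simp, by simp⟩))
      · intro τ hτ hxτ hyτ
        have hn' : ¬ Tri S x y v := fun hh => hn hh.rot'
        exact hmax _ hxy.rot hn' (attaches_triangle hcS (hc _ hxy.rot) h3 h1.symm hn'
          ⟨τ, hτ, hxτ, hyτ⟩ (Or.inr ⟨_, hx', by simp, by simp⟩))
    obtain ⟨a, b, hab, haA, hbA⟩ : ∃ a b, Tri T v a b ∧ a ∈ A ∧ b ∉ A := by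
      by_cases ha : a₀ ∈ A
      · exact ⟨a₀, b₀, h₀, ha, (noattach h₀ hnS ha).2.1⟩
      by_cases hb : b₀ ∈ A
      · exact ⟨b₀, a₀, h₀.swap', hb, ha⟩
      have ne : ∀ {x y}, x ∉ A → y ∈ A → x ≠ y := by
        rintro x y hx hy rfl; exact hx hy
      -- If the missing link edge avoids `A`, it is joined to `cd` in the link of `v`, and the
      -- joining edge leaves `A`.
      rcases hL v a₀ b₀ c d h₀ hcdT (ne ha hcA) (ne ha hdA) (ne hb hcA) (ne hb hdA) with
        h1 | h1 | h1 | h1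
      · exact ⟨c, a₀, h1.swap', hcA, ha⟩
      · exact ⟨d, a₀, h1.swap', hdA, ha⟩
      · exact ⟨c, b₀, h1.swap', hcA, hb⟩
      · exact ⟨d, b₀, h1.swap', hdA, hb⟩
    refine ⟨A, a, b, hab, haA, hbA, ?_, ⟨c, d, hcdT, hcA, hdA⟩, ?_⟩
    · have aux : ∀ x y, Tri T v x y → Covered T v x y → x ∈ A → y ∈ A := by
        rintro x y hxy ⟨z, hz, hxyz⟩ hx
        by_contra hy
        obtain ⟨h1, h2, h3⟩ := hxy.ne hc
        exact (noattach hxy (notS hy) hx).2.2 _ (del hxyz h1 h2 hz.symm) (by simp) (by simp)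
      exact fun x y hxy hcov => ⟨aux x y hxy hcov, aux y x hxy.swap' hcov.symm⟩
    · obtain ⟨τ, hτ, hbτ⟩ := (noattach hab (notS hbA) haA).1
      obtain ⟨x, y, hxy, rfl⟩ := exists_tri_of_mem hcS hτ hbτ
      refine ⟨x, y, hST hxy, ?_, ?_⟩
      · rintro rfl
        exact hbA ⟨y, hxy.swap⟩
      · rintro rfl
        exact hbA ⟨x, hxy.rot'⟩
  · exfalso
    have hvτ : ∀ τ ∈ S, v ∉ τ := by
      intro τ hτ hvτ
      obtain ⟨x, y, hxy, -⟩ := exists_tri_of_mem hcS hτ hvτ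
      exact hvS ⟨x, y, hxy⟩
    -- A triangle on a covered link edge would attach, with `v` as its new vertex.
    have nocov : ∀ x y, Tri T v x y → ¬ Covered T v x y := by
      rintro x y hxy ⟨z, hz, hxyz⟩
      obtain ⟨h1, h2, h3⟩ := hxy.ne hc
      have hn : ¬ Tri S x y v := fun hh => hvS ⟨x, y, hh.rot'⟩
      exact hmax _ hxy.rot hn (attaches_triangle hcS (hc _ hxy.rot) h3 h1.symm hn
        ⟨_, del hxyz h1 h2 hz.symm, by simp, by simp⟩ (Or.inl hvτ))
    -- Otherwise the link of `x` contains the edges `vy` and `qr`; a common vertex of the two or an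
    -- edge joining them would make a link edge of `v` covered.
    have outside : ∀ x y, Tri T v x y → ∀ τ ∈ T, v ∉ τ → x ∉ τ := by
      intro x y hxy τ hτ hvτ hxτ
      obtain ⟨q, r, hqr, rfl⟩ := exists_tri_of_mem hc hτ hxτ
      have hnv : v ≠ x ∧ v ≠ q ∧ v ≠ r := by simpa using hvτ
      have hyq : y ≠ q := by
        rintro rfl
        exact nocov x y hxy ⟨r, hnv.2.2.symm, hqr⟩
      have hyr : y ≠ r := by
        rintro rfl
        exact nocov x y hxy ⟨q, hnv.2.1.symm, hqr.swap'⟩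
      rcases hL x v y q r hxy.swap hqr hnv.2.1 hnv.2.2 hyq hyr with h1 | h1 | h1 | h1
      · exact nocov x q h1.swap ⟨r, hnv.2.2.symm, hqr⟩
      · exact nocov x r h1.swap ⟨q, hnv.2.1.symm, hqr.swap'⟩
      · exact nocov x y hxy ⟨q, hnv.2.1.symm, h1⟩
      · exact nocov x y hxy ⟨r, hnv.2.2.symm, h1⟩
    rcases S.eq_empty_or_nonempty with rfl | ⟨τ, hτ⟩
    · exact hmax _ h₀ hnS (attaches_empty _)
    have hvτ' := hvτ τ hτ
    have haτ := outside a₀ b₀ h₀ τ (hST hτ) hvτ'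
    have hbτ := outside b₀ a₀ h₀.swap' τ (hST hτ) hvτ'
    have hdisj : Disjoint ({v, a₀, b₀} : Finset E) τ := by
      rw [Finset.disjoint_left]
      intro t ht
      simp only [Finset.mem_insert, Finset.mem_singleton] at ht
      rcases ht with rfl | rfl | rfl <;> assumption
    have split : ∀ σ ∈ T, σ ⊆ {v, a₀, b₀} ∪ τ → σ ⊆ {v, a₀, b₀} ∨ Disjoint ({v, a₀, b₀} : Finset E) σ := by
      intro σ hσ hsub
      by_cases hvσ : v ∈ σ
      · left
        obtain ⟨x, y, hxy, rfl⟩ := exists_tri_of_mem hc hσ hvσ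
        intro t ht
        have ht' := hsub ht
        rw [Finset.mem_union] at ht'
        refine ht'.resolve_right ?_
        simp only [Finset.mem_insert, Finset.mem_singleton] at ht
        rcases ht with rfl | rfl | rfl
        · exact hvτ'
        · exact outside _ _ hxy τ (hST hτ) hvτ'
        · exact outside _ _ hxy.swap' τ (hST hτ) hvτ'
      · right
        rw [Finset.disjoint_left]
        intro t ht
        simp only [Finset.mem_insert, Finset.mem_singleton] at ht
        rcases ht with rfl | rfl | rfl
        · exact hvσ
        · exact outside _ _ h₀ σ hσ hvσ
        · exact outside _ _ h₀.swap' σ hσ hvσ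
    -- The restriction to the two disjoint triangles is disconnected, so by criticality there are no
    -- other vertices.
    have hall : ∀ σ ∈ T, σ ⊆ {v, a₀, b₀} ∪ τ := by
      apply h.subset_of_not_shelled
      intro hSh
      obtain ⟨t, ht⟩ : τ.Nonempty := by
        rw [← Finset.card_pos, hcS τ hτ]; omega
      have := hSh.connected (fun σ hσ => hc σ (Finset.mem_filter.1 hσ).1)
        (A := (({v, a₀, b₀} : Finset E) : Set E)) (by
          intro σ hσ
          rw [Finset.mem_filter] at hσ
          rcases split σ hσ.1 hσ.2 with h1 | h1
          · exact Or.inl fun x hx => h1 hx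
          · exact Or.inr fun x hx hx' => Finset.disjoint_left.1 h1 hx' hx)
        (Finset.mem_filter.2 ⟨hσ₀, Finset.subset_union_left⟩)
        (Finset.mem_filter.2 ⟨hST hτ, Finset.subset_union_right⟩)
        hvσ₀ ht (by simp)
      exact Finset.disjoint_left.1 hdisj this ht
    apply hD
    refine ⟨_, τ, hc _ h₀, hcS τ hτ, hdisj, ?_⟩
    ext σ
    simp only [Finset.mem_insert, Finset.mem_singleton]
    refine ⟨fun hσ => ?_, ?_⟩
    · rcases split σ hσ (hall σ hσ) with h1 | h1
      · left
        exact Finset.eq_of_subset_of_card_le h1 (by rw [hc _ hσ, hc _ h₀])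
      · right
        refine Finset.eq_of_subset_of_card_le ?_ (by rw [hc _ hσ, hcS _ hτ])
        intro t ht
        exact (Finset.mem_union.1 (hall σ hσ ht)).resolve_left
          fun ht' => Finset.disjoint_left.1 h1 ht' ht
    · rintro (rfl | rfl)
      · exact hσ₀
      · exact hST hτ

/-- Only the triangle at `a` without `v` goes beyond `exists_sep_aux`. If all triangles at `a`
contain `v`, the construction at `a` gives a separated link edge `vb'`, whose only triangle is
`avb'`, and a triangle `b'qr` without `a`. In the link of `b'` the edges `va` and `qr` then cannot
be joined. -/
theorem exists_sep (h : Critical T) (hL : LinksTwoK2Free T) (hD : ¬ TwoDisjoint T) {v : E}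
    (hv : ∃ σ ∈ T, v ∈ σ) :
    ∃ a b, Tri T v a b ∧ Sep T v a b ∧ (∃ x y, Tri T a x y ∧ v ≠ x ∧ v ≠ y) ∧
      ∃ x y, Tri T b x y ∧ v ≠ x ∧ v ≠ y := by
  have hc := h.card_eq
  obtain ⟨A, a, b, hab, haA, hbA, hA, -, hb⟩ := h.exists_sep_aux hL hD hv
  refine ⟨a, b, hab, ⟨A, haA, hbA, hA⟩, ?_, hb⟩
  by_contra hcon
  have hstar : ∀ x y, Tri T a x y → v = x ∨ v = y := by
    intro x y hxy
    by_contra hne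
    rw [not_or] at hne
    exact hcon ⟨x, y, hxy, hne.1, hne.2⟩
  obtain ⟨A', a', b', hab', haA', hbA', hA', ⟨c, d, hcd, hcA, hdA⟩, q, r, hqr, haq, har⟩ :=
    h.exists_sep_aux hL hD (v := a) ⟨_, hab, by simp⟩
  have hvA : v ∈ A' := by
    rcases hstar c d hcd with h1 | h1
    · rw [h1]; exact hcA
    · rw [h1]; exact hdA
  have hva : v = a' := by
    rcases hstar a' b' hab' with h1 | h1
    · exact h1
    · rw [h1] at hvA; exact absurd hvA hbA'
  subst hva
  have hncov : ∀ t, Tri T v b' t → t = a := by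
    intro t ht
    by_contra hne
    exact hbA' ((hA' v b' hab' ⟨t, hne, ht⟩).1 haA')
  obtain ⟨h1, h2, h3⟩ := hqr.ne hc
  obtain ⟨h4, h5, h6⟩ := hab'.ne hc
  have hvq : v ≠ q := by
    rintro rfl
    exact har (hncov r hqr.swap).symm
  have hvr : v ≠ r := by
    rintro rfl
    exact haq (hncov q hqr.rot').symm
  rcases hL b' v a q r hab'.rev hqr hvq hvr haq har with h7 | h7 | h7 | h7
  · exact haq (hncov q h7.swap).symm
  · exact har (hncov r h7.swap).symm
  · rcases hstar _ _ h7.swap with h8 | h8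
    · exact h6 h8
    · exact hvq h8
  · rcases hstar _ _ h7.swap with h8 | h8
    · exact h6 h8
    · exact hvr h8

end Critical

theorem triple_congr {v p t c d : E} (h : (p = c ∧ t = d) ∨ (p = d ∧ t = c)) :
    ({v, p, t} : Finset E) = {v, c, d} := by
  rcases h with ⟨rfl, rfl⟩ | ⟨rfl, rfl⟩
  exacts [rfl, by rw [Finset.pair_comm]]

theorem triple_swap (c d e : E) : ({d, c, e} : Finset E) = {c, d, e} := Finset.insert_comm _ _ _

theorem triple_rot (c d e : E) : ({d, e, c} : Finset E) = {c, d, e} := by ext; simp; tauto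

theorem triple_rev (c d e : E) : ({e, d, c} : Finset E) = {c, d, e} := by ext; simp; tauto

/-! ### The bands on five, six and seven vertices -/

namespace Critical

variable {T : Finset (Finset E)}

theorem mem_of_sep (h : Critical T) {v a b x y z w : E} (hab : Tri T v a b)
    (hs : Sep T v a b) (hx : Tri T a x y) (hz : Tri T b z w) (hvx : v ≠ x) (hvy : v ≠ y)
    (hvz : v ≠ z) (hvw : v ≠ w) {p q r : E} (hp : Tri T p q r) :
    p = v ∨ p = a ∨ p = b ∨ p = x ∨ p = y ∨ p = z ∨ p = w := by
  have := h.subset_of_sep hab hs hx hz hvx hvy hvz hvw _ hp (Finset.mem_insert_self _ _)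
  simpa using this

/-- If `{a, x, y}` is the only triangle at `a` without `v`, its edge `{x, y}` lies in another
triangle without `v`. -/
theorem exists_adjacent_of_unique (h : Critical T) {v a x y b z w : E}
    (hv : ∃ p q, Tri T v p q) (hax : Tri T a x y) (hbz : Tri T b z w)
    (h1 : v ≠ a) (h2 : v ≠ x) (h3 : v ≠ y) (h4 : v ≠ b) (h5 : v ≠ z) (h6 : v ≠ w)
    (hab : b ≠ a) (hbx : b ≠ x) (hby : b ≠ y)
    (huniq : ∀ p q, Tri T a p q → v ≠ p → v ≠ q → (p = x ∧ q = y) ∨ (p = y ∧ q = x)) :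
    ∃ u, u ≠ a ∧ u ≠ v ∧ Tri T x y u := by
  obtain ⟨p, q, hp⟩ := hv
  have hc := h.card_eq
  -- By uniqueness the triangle adjacent to `axy` among those without `v` cannot contain `a`, so it
  -- shares the edge `xy`. The triangle `bzw` only serves as a second member of the family.
  obtain ⟨ρ, hρ, hne, hcard⟩ := (h.shelled_delete (v := v) ⟨_, hp, by simp⟩).exists_adjacent
    (fun σ hσ => hc σ (Finset.mem_filter.1 hσ).1)
    {a, x, y} (Finset.mem_filter.2 ⟨hax, by simp [h1, h2, h3]⟩)
    {b, z, w} (Finset.mem_filter.2 ⟨hbz, by simp [h4, h5, h6]⟩) (by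
      intro he
      have : b ∈ ({a, x, y} : Finset E) := by rw [he]; simp
      simp [hab, hbx, hby] at this)
  rw [Finset.mem_filter] at hρ
  have haρ : a ∉ ρ := by
    intro ha
    obtain ⟨p, q, hpq, rfl⟩ := exists_tri_of_mem hc hρ.1 ha
    have hnv : v ≠ a ∧ v ≠ p ∧ v ≠ q := by simpa using hρ.2
    rcases huniq p q hpq hnv.2.1 hnv.2.2 with ⟨rfl, rfl⟩ | ⟨rfl, rfl⟩
    · exact hne rfl
    · exact hne (by rw [Finset.pair_comm])
  have hsub : ({a, x, y} : Finset E) ∩ ρ ⊆ {x, y} := by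
    intro t ht
    simp only [Finset.mem_inter, Finset.mem_insert, Finset.mem_singleton] at ht ⊢
    rcases ht with ⟨rfl | h | h, ht⟩
    · exact absurd ht haρ
    · exact Or.inl h
    · exact Or.inr h
  have heq := Finset.eq_of_subset_of_card_le hsub (by rw [hcard]; exact Finset.card_le_two)
  have hx : x ∈ ρ := (Finset.mem_inter.1 (heq.symm ▸ (by simp : x ∈ ({x, y} : Finset E)))).2
  have hy : y ∈ ρ := (Finset.mem_inter.1 (heq.symm ▸ (by simp : y ∈ ({x, y} : Finset E)))).2
  obtain ⟨p, q, hpq, rfl⟩ := exists_tri_of_mem hc hρ.1 hx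
  have hxy := (hax.ne hc).2.2
  simp only [Finset.mem_insert, Finset.mem_singleton, not_or] at hy haρ hρ
  rcases hy with hy | rfl | rfl
  · exact absurd hy.symm hxy
  · exact ⟨q, Ne.symm haρ.2.2, Ne.symm hρ.2.2.2, hpq⟩
  · exact ⟨p, Ne.symm haρ.2.1, Ne.symm hρ.2.2.1, hpq.swap'⟩

/-- Separation propagates along covered link edges: `x` is on the side of `a` and `y` on the side of
`b`. The pairs across the two sides other than `ab` are covered, hence not link edges of `v`, and
`ab` lies in no triangle but `vab`. This excludes five of the ten triples. -/
theorem band_of_five (h : Critical T) {v a b x y : E} (hab : Tri T v a b) (hs : Sep T v a b)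
    (hax : Tri T a x y) (hbx : Tri T b x y) (hvax : Tri T v a x)
    (hby : Tri T v b x ∨ Tri T v b y) (hnd : [b, v, a, x, y].Nodup) :
    T = {{b, v, a}, {v, a, x}, {a, x, y}, {x, y, b}, {y, b, v}} := by
  have hV := h.subset_of_sep hab hs hax hbx
  simp only [List.nodup_cons, List.mem_cons, List.not_mem_nil, or_false, not_or] at hnd
  obtain ⟨⟨n1, n2, n3, n4⟩, ⟨n5, n6, n7⟩, ⟨n8, n9⟩, n10, -⟩ := hnd
  specialize hV n6 n7 n6 n7
  have hcov : Covered T v a x := ⟨y, Ne.symm n7, hax⟩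
  have sx := hs.trans_left hvax hcov
  have nbx : ¬ Tri T v b x := fun hb => sx.symm.not_covered hb ⟨y, Ne.symm n7, hbx⟩
  have hvby := hby.resolve_left nbx
  have sxy := sx.trans_right hvby ⟨x, Ne.symm n6, hbx.swap'⟩
  have say := hs.trans_right hvby ⟨x, Ne.symm n6, hbx.swap'⟩
  have nxy : ¬ Tri T v x y := fun hb => sxy.not_covered hb ⟨a, Ne.symm n5, hax.rot⟩
  have nay : ¬ Tri T v a y := fun hb => say.not_covered hb ⟨x, Ne.symm n6, hax.swap'⟩
  have nab : ∀ t, t ≠ v → ¬ Tri T a b t := fun t ht hb => hs.not_covered hab ⟨t, ht, hb⟩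
  apply Finset.Subset.antisymm
  · intro σ hσ
    have hmem : ∀ {p q r}, Tri T p q r → p = v ∨ p = a ∨ p = b ∨ p = x ∨ p = y := by
      intro p q r hp
      have := hV _ hp (Finset.mem_insert_self _ _)
      simp only [Finset.mem_insert, Finset.mem_singleton] at this
      grind
    simp only [Finset.mem_insert, Finset.mem_singleton]
    by_cases hv : v ∈ σ
    · obtain ⟨p, t, hpt, rfl⟩ := exists_tri_of_mem h.card_eq hσ hv
      have := hmem hpt.rot
      have := hmem hpt.rot'
      have := hpt.swap'
      have := hpt.ne h.card_eq
      have : ((p = a ∧ t = b) ∨ (p = b ∧ t = a)) ∨ ((p = a ∧ t = x) ∨ (p = x ∧ t = a)) ∨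
          ((p = b ∧ t = y) ∨ (p = y ∧ t = b)) := by grind
      rcases this with h1 | h1 | h1
      · rw [triple_congr h1, triple_rot b]
        exact Or.inl rfl
      · rw [triple_congr h1]
        simp only [true_or, or_true]
      · rw [triple_congr h1, triple_rev y]
        simp only [or_true]
    by_cases ha : a ∈ σ
    · obtain ⟨p, t, hpt, rfl⟩ := exists_tri_of_mem h.card_eq hσ ha
      have := hmem hpt.rot
      have := hmem hpt.rot'
      have := hpt.swap'
      have := hpt.ne h.card_eq
      simp only [Finset.mem_insert, Finset.mem_singleton, not_or] at hv
      have : (p = x ∧ t = y) ∨ (p = y ∧ t = x) := by grind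
      rw [triple_congr this]
      simp only [true_or, or_true]
    · obtain ⟨p, q, r, -, -, -, rfl⟩ := Finset.card_eq_three.1 (h.card_eq σ hσ)
      have hpt : Tri T p q r := hσ
      have := hmem hpt
      have := hmem hpt.rot
      have := hmem hpt.rot'
      have := hpt.ne h.card_eq
      simp only [Finset.mem_insert, Finset.mem_singleton, not_or] at hv ha
      right; right; right; left
      ext t
      simp only [Finset.mem_insert, Finset.mem_singleton]
      grind
  · intro σ hσ
    simp only [Finset.mem_insert, Finset.mem_singleton] at hσ
    rcases hσ with rfl | rfl | rfl | rfl | rfl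
    exacts [hab.rot', hvax, hax, hbx.rot, hvby.rev]

/-- The separation moves from `v` to the neighbouring vertex `a`. Witness triangles must account for
all seven vertices, so `axy` is the only triangle at `a` without `v`. Its edge `xy` lies in a
further triangle, so the separated link edge at `a` is not `xy` and must contain `v`. -/
theorem exists_sep_at_end (h : Critical T) (hL : LinksTwoK2Free T) (hD : ¬ TwoDisjoint T)
    {v a b x y z w : E} (hab : Tri T v a b) (hs : Sep T v a b)
    (hax : Tri T a x y) (hbz : Tri T b z w) (hvbz : Tri T v b z)
    (hnd : [w, z, b, v, a, x, y].Nodup) :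
    ∃ q, (q = x ∨ q = y) ∧ Tri T a v q ∧ Sep T a v q ∧ ∃ r s, Tri T q r s ∧ a ≠ r ∧ a ≠ s := by
  simp only [List.nodup_cons, List.mem_cons, List.not_mem_nil, or_false, not_or] at hnd
  obtain ⟨⟨m1, m2, m3, m4, m5, m6⟩, ⟨m7, m8, m9, m10, m11⟩, ⟨n1, n2, n3, n4⟩, ⟨n5, n6, n7⟩,
    ⟨n8, n9⟩, n10, -⟩ := hnd
  have huniq : ∀ p q, Tri T a p q → v ≠ p → v ≠ q → (p = x ∧ q = y) ∨ (p = y ∧ q = x) := by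
    intro p q hpq hvp hvq
    have e1 := h.mem_of_sep hab hs hpq hbz hvp hvq (by grind) (by grind) hax.rot
    have e2 := h.mem_of_sep hab hs hpq hbz hvp hvq (by grind) (by grind) hax.rot'
    grind
  obtain ⟨u, hua, huv, hxyu⟩ := h.exists_adjacent_of_unique (v := v) ⟨_, _, hab⟩ hax hbz
    (by grind) (by grind) (by grind) (by grind) (by grind) (by grind) (by grind) (by grind)
    (by grind) huniq
  -- The edges `vb` and `vz` are covered by `vbz`, and `q = w` would confine all vertices to a set
  -- without `x`.
  have main : ∀ q, Tri T a v q → Sep T a v q → (∃ x y, Tri T q x y ∧ a ≠ x ∧ a ≠ y) →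
      ∃ q, (q = x ∨ q = y) ∧ Tri T a v q ∧ Sep T a v q ∧
        ∃ r s, Tri T q r s ∧ a ≠ r ∧ a ≠ s := by
    intro q hq hsq hex
    refine ⟨q, ?_, hq, hsq, hex⟩
    have hnc := hsq.not_covered hq
    obtain ⟨c1, c2, c3⟩ := hq.ne h.card_eq
    have e1 : q ≠ b := by
      rintro rfl
      exact hnc ⟨z, by grind, hvbz⟩
    have e2 : q ≠ z := by
      rintro rfl
      exact hnc ⟨b, by grind, hvbz.swap'⟩
    have e3 : q ≠ w := by
      rintro rfl
      have := h.mem_of_sep hq hsq hvbz hbz.rot' (by grind) (by grind) (by grind) (by grind) hax.rot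
      grind
    have := h.mem_of_sep hab hs hax hbz (by grind) (by grind) (by grind) (by grind) hq.rot'
    grind
  obtain ⟨p, q, hpq, hspq, hp, hq⟩ := h.exists_sep hL hD (v := a) ⟨_, hax, by simp⟩
  by_cases hvp : v = p
  · subst hvp
    exact main q hpq hspq hq
  by_cases hvq : v = q
  · subst hvq
    exact main p hpq.swap' hspq.symm hp
  exfalso
  rcases huniq p q hpq hvp hvq with ⟨rfl, rfl⟩ | ⟨rfl, rfl⟩
  · exact hspq.not_covered hpq ⟨u, hua, hxyu⟩
  · exact hspq.not_covered hpq ⟨u, hua, hxyu.swap⟩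

-- The separations at `v`, `a` and `b` come with witness triangles that must span all seven
-- vertices. This determines the triangles at `v`, at both of its neighbours and at the next vertex
-- on either side, and the band closes up around `y` and `w`.
set_option maxHeartbeats 1000000 in
theorem band_of_seven (h : Critical T) (hL : LinksTwoK2Free T) (hD : ¬ TwoDisjoint T)
    {v a b x y z w : E} (hab : Tri T v a b) (hs : Sep T v a b)
    (hax : Tri T a x y) (hbz : Tri T b z w) (hnd : [w, z, b, v, a, x, y].Nodup) :
    ∃ x₀ x₁ x₂ x₃ x₄ x₅ x₆ : E, [x₀, x₁, x₂, x₃, x₄, x₅, x₆].Nodup ∧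
      T = {{x₀, x₁, x₂}, {x₁, x₂, x₃}, {x₂, x₃, x₄}, {x₃, x₄, x₅}, {x₄, x₅, x₆}, {x₅, x₆, x₀},
        {x₆, x₀, x₁}} := by
  wlog hvbz : Tri T v b z generalizing z w with H
  · have hnd' : [z, w, b, v, a, x, y].Nodup := by grind
    refine H hbz.swap' hnd' ?_
    exact (tri_or_of_sep hL hab.swap' hs.symm hbz (by grind) (by grind)).resolve_left hvbz
  have hc := h.card_eq
  obtain ⟨q, hq, haq, hsq, r, s, hqrs, har, has⟩ :=
    h.exists_sep_at_end hL hD hab hs hax hbz hvbz hnd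
  wlog hqx : q = x generalizing x y with H
  · have hqy := hq.resolve_left hqx
    exact H (x := y) (y := x) hax.swap' (by grind) (Or.inl hqy) hqy
  subst hqx
  obtain ⟨q', hq', hbq', hsq', r', s', hqrs', hbr', hbs'⟩ :=
    h.exists_sep_at_end hL hD (v := v) (a := b) (b := a) (x := z) (y := w) (z := q) (w := y)
      hab.swap' hs.symm hbz hax haq.swap (by grind)
  simp only [List.nodup_cons, List.mem_cons, List.not_mem_nil, or_false, not_or] at hnd
  obtain ⟨⟨m1, m2, m3, m4, m5, m6⟩, ⟨m7, m8, m9, m10, m11⟩, ⟨n1, n2, n3, n4⟩, ⟨n5, n6, n7⟩,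
    ⟨n8, n9⟩, n10, -⟩ := hnd
  have e1 := h.mem_of_sep haq hsq hvbz hqrs (by grind) (by grind) har has hax.rot'
  have e2 := h.mem_of_sep haq hsq hvbz hqrs (by grind) (by grind) har has hbz.rot'
  -- The separation at `a` confines the vertices to `a, v, q, b, z, r, s`, so `r` and `s` must be
  -- the missing `y` and `w`.
  have hxyw : Tri T q y w := by
    have : (r = y ∧ s = w) ∨ (r = w ∧ s = y) := by grind
    rcases this with ⟨rfl, rfl⟩ | ⟨rfl, rfl⟩
    exacts [hqrs, hqrs.swap']
  have uva : ∀ p t, Tri T v p t → a ≠ p → a ≠ t → (p = b ∧ t = z) ∨ (p = z ∧ t = b) := by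
    intro p t hpt hap hat
    have e1 := h.mem_of_sep haq hsq hpt hxyw hap hat (by grind) (by grind) hbz
    have e2 := h.mem_of_sep haq hsq hpt hxyw hap hat (by grind) (by grind) hbz.rot
    grind
  have hqz : q' = z := by
    rcases hq' with h1 | rfl
    · exact h1
    · have := uva _ _ hbq'.swap (by grind) (by grind)
      grind
  subst hqz
  have e3 := h.mem_of_sep hbq' hsq' haq.swap hqrs' (by grind) (by grind) hbr' hbs' hax.rot'
  have e4 := h.mem_of_sep hbq' hsq' haq.swap hqrs' (by grind) (by grind) hbr' hbs' hbz.rot'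
  have hzyw : Tri T q' y w := by
    have : (r' = y ∧ s' = w) ∨ (r' = w ∧ s' = y) := by grind
    rcases this with ⟨rfl, rfl⟩ | ⟨rfl, rfl⟩
    exacts [hqrs', hqrs'.swap']
  have uvb : ∀ p t, Tri T v p t → b ≠ p → b ≠ t → (p = a ∧ t = q) ∨ (p = q ∧ t = a) := by
    intro p t hpt hap hat
    have e1 := h.mem_of_sep hbq' hsq' hpt hzyw hap hat (by grind) (by grind) hax
    have e2 := h.mem_of_sep hbq' hsq' hpt hzyw hap hat (by grind) (by grind) hax.rot
    grind
  have uxa : ∀ p t, Tri T q p t → a ≠ p → a ≠ t → (p = y ∧ t = w) ∨ (p = w ∧ t = y) := by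
    intro p t hpt hap hat
    have e1 := h.mem_of_sep haq hsq hvbz hpt (by grind) (by grind) hap hat hax.rot'
    have e2 := h.mem_of_sep haq hsq hvbz hpt (by grind) (by grind) hap hat hbz.rot'
    grind
  have uzb : ∀ p t, Tri T q' p t → b ≠ p → b ≠ t → (p = y ∧ t = w) ∨ (p = w ∧ t = y) := by
    intro p t hpt hap hat
    have e1 := h.mem_of_sep hbq' hsq' haq.swap hpt (by grind) (by grind) hap hat hax.rot'
    have e2 := h.mem_of_sep hbq' hsq' haq.swap hpt (by grind) (by grind) hap hat hbz.rot'
    grind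
  have ua : ∀ p t, Tri T a p t → v ≠ p → v ≠ t → (p = q ∧ t = y) ∨ (p = y ∧ t = q) := by
    intro p t hpt hap hat
    have e1 := h.mem_of_sep hab hs hpt hbz hap hat (by grind) (by grind) hax.rot
    have e2 := h.mem_of_sep hab hs hpt hbz hap hat (by grind) (by grind) hax.rot'
    grind
  have ub : ∀ p t, Tri T b p t → v ≠ p → v ≠ t → (p = q' ∧ t = w) ∨ (p = w ∧ t = q') := by
    intro p t hpt hap hat
    have e1 := h.mem_of_sep hab hs hax hpt (by grind) (by grind) hap hat hbz.rot
    have e2 := h.mem_of_sep hab hs hax hpt (by grind) (by grind) hap hat hbz.rot'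
    grind
  refine ⟨w, q', b, v, a, q, y, by grind, ?_⟩
  apply Finset.Subset.antisymm
  · intro σ hσ
    simp only [Finset.mem_insert, Finset.mem_singleton]
    by_cases hv : v ∈ σ
    · obtain ⟨p, t, hpt, rfl⟩ := exists_tri_of_mem hc hσ hv
      by_cases h1 : a ≠ p ∧ a ≠ t
      · rw [triple_congr (uva p t hpt h1.1 h1.2)]
        right; left
        rw [triple_rev q']
      by_cases h2 : b ≠ p ∧ b ≠ t
      · rw [triple_congr (uvb p t hpt h2.1 h2.2)]
        right; right; right; left; rfl
      · have : (p = b ∧ t = a) ∨ (p = a ∧ t = b) := by grind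
        rw [triple_congr this, triple_swap b]
        simp only [true_or, or_true]
    by_cases ha : a ∈ σ
    · obtain ⟨p, t, hpt, rfl⟩ := exists_tri_of_mem hc hσ ha
      simp only [Finset.mem_insert, Finset.mem_singleton, not_or] at hv
      rw [triple_congr (ua p t hpt hv.2.1 hv.2.2)]
      simp only [true_or, or_true]
    by_cases hb : b ∈ σ
    · obtain ⟨p, t, hpt, rfl⟩ := exists_tri_of_mem hc hσ hb
      simp only [Finset.mem_insert, Finset.mem_singleton, not_or] at hv
      rw [triple_congr (ub p t hpt hv.2.1 hv.2.2)]
      left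
      exact triple_rev _ _ _
    by_cases hx : q ∈ σ
    · obtain ⟨p, t, hpt, rfl⟩ := exists_tri_of_mem hc hσ hx
      simp only [Finset.mem_insert, Finset.mem_singleton, not_or] at ha
      rw [triple_congr (uxa p t hpt ha.2.1 ha.2.2)]
      simp only [true_or, or_true]
    by_cases hz : q' ∈ σ
    · obtain ⟨p, t, hpt, rfl⟩ := exists_tri_of_mem hc hσ hz
      simp only [Finset.mem_insert, Finset.mem_singleton, not_or] at hb
      rw [triple_congr (uzb p t hpt hb.2.1 hb.2.2)]
      right; right; right; right; right; right
      exact (triple_rot _ _ _).symm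
    exfalso
    have hsub : σ ⊆ {y, w} := by
      intro t ht
      have := h.subset_of_sep hab hs hax hbz (by grind) (by grind) (by grind) (by grind) σ hσ ht
      simp only [Finset.mem_insert, Finset.mem_singleton] at this ⊢
      grind
    have := Finset.card_le_card hsub
    rw [hc σ hσ] at this
    have := Finset.card_le_two (a := y) (b := w)
    omega
  · intro σ hσ
    simp only [Finset.mem_insert, Finset.mem_singleton] at hσ
    rcases hσ with rfl | rfl | rfl | rfl | rfl | rfl | rfl
    exacts [hbz.rev, hvbz.rev, hab.rot', haq.swap, hax, hxyw, hzyw.rot]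

/-- At most one triangle at `b` avoids `v` if there are six vertices. -/
theorem false_of_six (h : Critical T) (hL : LinksTwoK2Free T) (hD : ¬ TwoDisjoint T)
    {v a b x y w : E} (hab : Tri T v a b) (hs : Sep T v a b)
    (hax : Tri T a x y) (hby : Tri T b y w) (hbx : Tri T b x w) (hvax : Tri T v a x)
    (hnd : [x, a, v, b, w, y].Nodup) : False := by
  have hc := h.card_eq
  simp only [List.nodup_cons, List.mem_cons, List.not_mem_nil, or_false, not_or] at hnd
  obtain ⟨⟨m7, m8, m9, m10, m11⟩, ⟨n1, n2, n3, n4⟩, ⟨n5, n6, n7⟩,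
    ⟨n8, n9⟩, n10, -⟩ := hnd
  have hV : ∀ {p q r}, Tri T p q r → p = x ∨ p = a ∨ p = v ∨ p = b ∨ p = w ∨ p = y := by
    intro p q r hp
    have := h.mem_of_sep hab hs hax hby (by grind) (by grind) (by grind) (by grind) hp
    grind
  have sx := hs.trans_left hvax ⟨y, by grind, hax⟩
  have nvbx : ¬ Tri T v b x := fun hb => sx.symm.not_covered hb ⟨w, by grind, hbx⟩
  have hvbw : Tri T v b w :=
    (tri_or_of_sep hL hab.swap' hs.symm hbx (by grind) (by grind)).resolve_left nvbx
  -- With the witnesses `axw` and `bxw` only five vertices would occur, and `y` would be missing.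
  -- The same count excludes other triples.
  have naxw : ¬ Tri T a x w := fun ht => by
    have := h.mem_of_sep hab hs ht hbx (by grind) (by grind) (by grind) (by grind) hax.rot'
    grind
  have nayw : ¬ Tri T a y w := fun ht => by
    have := h.mem_of_sep hab hs ht hby (by grind) (by grind) (by grind) (by grind) hax.rot
    grind
  have nbxy : ¬ Tri T b x y := fun ht => by
    have := h.mem_of_sep hab hs hax ht (by grind) (by grind) (by grind) (by grind) hbx.rot'
    grind
  have nab : ∀ t, t ≠ v → ¬ Tri T a b t := fun t ht hb => hs.not_covered hab ⟨t, ht, hb⟩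
  have ua : ∀ p q, Tri T a p q → v ≠ p → v ≠ q → (p = x ∧ q = y) ∨ (p = y ∧ q = x) := by
    intro p q hpq hvp hvq
    have h1 := hV hpq.rot
    have h2 := hV hpq.rot'
    have h3 := hpq.swap'
    have := hpq.ne hc
    grind
  obtain ⟨u, hua, huv, hxyu⟩ := h.exists_adjacent_of_unique (v := v) ⟨_, _, hab⟩ hax hby
    (by grind) (by grind) (by grind) (by grind) (by grind) (by grind) (by grind) (by grind)
    (by grind) ua
  have hxyw : Tri T x y w := by
    have h1 := hV hxyu.rot'
    have := hxyu.ne hc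
    have := hxyu.rot'
    grind
  have nvy : Tri T b v y → ¬ Sep T b v y := fun ht hsy => by
    have := h.mem_of_sep ht hsy hvax hax.rot' (by grind) (by grind) (by grind) (by grind) hby.rot'
    grind
  -- Of the pairs in the link of `b`, `va`, `xw` and `yw` are covered, `vx`, `xy` and the other
  -- pairs at `a` are not link edges, and `vy` cannot be separated. Only `vw` remains for the
  -- separation at `b`.
  obtain ⟨hbvw, svw⟩ : Tri T b v w ∧ Sep T b v w := by
    obtain ⟨p, q, hpq, hspq, -, -⟩ := h.exists_sep hL hD (v := b) ⟨_, hby, by simp⟩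
    have h1 := hV hpq.rot
    have h2 := hV hpq.rot'
    have h3 := hpq.ne hc
    have c1 : Covered T b v a := ⟨x, by grind, hvax⟩
    have c2 : Covered T b x w := ⟨y, by grind, hxyw.swap'⟩
    have c3 : Covered T b y w := ⟨x, by grind, hxyw.rot⟩
    have h4 := hspq.not_covered hpq
    have h5 := hspq.symm.not_covered hpq.swap'
    have h6 := hpq.swap'
    have h7 := hpq.swap
    have h8 := h6.swap
    have h9 := hspq.symm
    have ha : p ≠ a ∧ q ≠ a := by
      refine ⟨?_, ?_⟩
      · rintro rfl
        have := fun ht => nab _ ht h7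
        grind
      · rintro rfl
        have := fun ht => nab _ ht h8
        grind
    grind
  have hfree : ∀ t, t ≠ b → ¬ Tri T v w t := fun t ht hh => svw.not_covered hbvw ⟨t, ht, hh⟩
  have nvby : ¬ Tri T b v y := fun ht =>
    nvy ht (svw.trans_right hby.swap' ⟨x, by grind, hxyw.rot.swap⟩)
  have nvxy : ¬ Tri T v x y := fun ht => by
    have := h.mem_of_sep hbvw svw ht hxyw.rot' (by grind) (by grind) (by grind) (by grind) hax
    grind
  obtain ⟨p, q, hpq, hspq, -, -⟩ := h.exists_sep hL hD (v := y) ⟨_, hby, by simp⟩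
  -- Every link edge at `y` is covered, although one of them has to be separated.
  have hyp : ∀ p q, Tri T y p q → Covered T y p q := by
    intro p q hpq
    have h1 := hV hpq.rot
    have h2 := hV hpq.rot'
    have h3 := hpq.ne hc
    have c1 : Covered T y a x := ⟨v, by grind, hvax.rot⟩
    have c2 : Covered T y b w := ⟨v, by grind, hvbw.rot⟩
    have c3 : Covered T y x w := ⟨b, by grind, hbx.rot⟩
    have c4 : Covered T y v a := ⟨b, by grind, hab⟩
    have d1 := c1.symm
    have d2 := c2.symm
    have d3 := c3.symm
    have d4 := c4.symm
    have e1 := hpq.rot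
    have e2 := hpq.rot'
    have e3 := hpq.rev
    have e4 := hpq.swap
    have e5 := hpq.swap'
    have f1 : ∀ t, t ≠ v → ¬ Tri T b a t := fun t ht hb => nab t ht hb.swap
    have f2 : ∀ t, t ≠ b → ¬ Tri T w v t := fun t ht hb => hfree t ht hb.swap
    have f3 : ¬ Tri T a w y := fun ht => nayw ht.swap'
    have f4 : ¬ Tri T x b y := fun ht => nbxy ht.swap
    have f5 : ¬ Tri T v b y := fun ht => nvby ht.swap
    grind
  exact hspq.not_covered hpq (hyp p q hpq)

end Critical

namespace Critical

variable {T : Finset (Finset E)}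

theorem false_of_six_symm (h : Critical T) (hL : LinksTwoK2Free T) (hD : ¬ TwoDisjoint T)
    {v a b x y w : E} (hab : Tri T v a b) (hs : Sep T v a b)
    (hax : Tri T a x y) (hby : Tri T b y w) (hbx : Tri T b x w)
    (hnd : [x, a, v, b, w, y].Nodup) : False := by
  have hnd' := hnd
  simp only [List.nodup_cons, List.mem_cons, List.not_mem_nil, or_false, not_or] at hnd'
  rcases tri_or_of_sep hL hab hs hax (by tauto) (by tauto) with h1 | h1
  · exact h.false_of_six hL hD hab hs hax hby hbx h1 hnd
  · exact h.false_of_six hL hD hab hs hax.swap' hbx hby h1 (by grind)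

/-- The six-vertex version of moving the separation from `v` to `a`: away from `v` the only link
edge at `a` is `xy`, and it is covered by `xyw`, so the separated edge contains `v`. -/
theorem exists_sep_of_six (h : Critical T) (hL : LinksTwoK2Free T) (hD : ¬ TwoDisjoint T)
    {v a b x y w : E} (hab : Tri T v a b) (hs : Sep T v a b)
    (hax : Tri T a x y) (hby : Tri T b y w) (naxw : ¬ Tri T a x w)
    (hnd : [x, a, v, b, w, y].Nodup) :
    Tri T x y w ∧ Tri T a v x ∧ Sep T a v x := by
  have hc := h.card_eq
  simp only [List.nodup_cons, List.mem_cons, List.not_mem_nil, or_false, not_or] at hnd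
  obtain ⟨⟨m7, m8, m9, m10, m11⟩, ⟨n1, n2, n3, n4⟩, ⟨n5, n6, n7⟩,
    ⟨n8, n9⟩, n10, -⟩ := hnd
  have hV : ∀ {p q r}, Tri T p q r → p = x ∨ p = a ∨ p = v ∨ p = b ∨ p = w ∨ p = y := by
    intro p q r hp
    have := h.mem_of_sep hab hs hax hby (by grind) (by grind) (by grind) (by grind) hp
    grind
  have nayw : ¬ Tri T a y w := fun ht => by
    have := h.mem_of_sep hab hs ht hby (by grind) (by grind) (by grind) (by grind) hax.rot
    grind
  have nbxy : ¬ Tri T b x y := fun ht => by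
    have := h.mem_of_sep hab hs hax ht (by grind) (by grind) (by grind) (by grind) hby.rot'
    grind
  have nab : ∀ t, t ≠ v → ¬ Tri T a b t := fun t ht hb => hs.not_covered hab ⟨t, ht, hb⟩
  have ua : ∀ p q, Tri T a p q → v ≠ p → v ≠ q → (p = x ∧ q = y) ∨ (p = y ∧ q = x) := by
    intro p q hpq hvp hvq
    have h1 := hV hpq.rot
    have h2 := hV hpq.rot'
    have h3 := hpq.swap'
    have := hpq.ne hc
    grind
  obtain ⟨u, hua, huv, hxyu⟩ := h.exists_adjacent_of_unique (v := v) ⟨_, _, hab⟩ hax hby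
    (by grind) (by grind) (by grind) (by grind) (by grind) (by grind) (by grind) (by grind)
    (by grind) ua
  have hxyw : Tri T x y w := by
    have h1 := hV hxyu.rot'
    have := hxyu.ne hc
    have := hxyu.rot'
    grind
  have hvb : Tri T v b y ∨ Tri T v b w :=
    tri_or_of_sep hL hab.swap' hs.symm hby (by grind) (by grind)
  have main : ∀ q, Tri T a v q → Sep T a v q → q = x := by
    intro q hq hsq
    have hnc := hsq.not_covered hq
    have h1 := hV hq.rot'
    have h2 := hq.ne hc
    have e1 : q ≠ b := by
      rintro rfl
      rcases hvb with h3 | h3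
      · exact hnc ⟨y, by grind, h3⟩
      · exact hnc ⟨w, by grind, h3⟩
    have e2 : q ≠ y := by
      rintro rfl
      rcases hvb with h3 | h3
      · exact hnc ⟨b, by grind, h3.swap'⟩
      · have := h.mem_of_sep hq hsq h3 hby.swap (by grind) (by grind) (by grind) (by grind) hax.rot
        grind
    have e3 : q ≠ w := by
      rintro rfl
      rcases hvb with h3 | h3
      · have := h.mem_of_sep hq hsq h3 hby.rot' (by grind) (by grind) (by grind) (by grind) hax.rot
        grind
      · exact hnc ⟨b, by grind, h3.swap'⟩
    grind
  refine ⟨hxyw, ?_⟩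
  obtain ⟨p, q, hpq, hspq, -, -⟩ := h.exists_sep hL hD (v := a) ⟨_, hax, by simp⟩
  by_cases hvp : v = p
  · subst hvp
    have := main q hpq hspq
    subst this
    exact ⟨hpq, hspq⟩
  by_cases hvq : v = q
  · subst hvq
    have := main p hpq.swap' hspq.symm
    subst this
    exact ⟨hpq.swap', hspq.symm⟩
  exfalso
  rcases ua p q hpq hvp hvq with ⟨rfl, rfl⟩ | ⟨rfl, rfl⟩
  · exact hspq.not_covered hpq ⟨u, hua, hxyu⟩
  · exact hspq.not_covered hpq ⟨u, hua, hxyu.swap⟩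

-- The separation moves from `v` both to `a` and to `b`, so `ab`, `vx` and `vw` each lie in a single
-- triangle. Vertex counts exclude the other unwanted triples.
set_option maxHeartbeats 1000000 in
theorem band_of_six (h : Critical T) (hL : LinksTwoK2Free T) (hD : ¬ TwoDisjoint T)
    {v a b x y w : E} (hab : Tri T v a b) (hs : Sep T v a b)
    (hax : Tri T a x y) (hby : Tri T b y w) (hnd : [x, a, v, b, w, y].Nodup) :
    T = {{x, a, v}, {a, v, b}, {v, b, w}, {b, w, y}, {w, y, x}, {y, x, a}} := by
  have hc := h.card_eq
  have nbxw : ¬ Tri T b x w := fun hb => h.false_of_six_symm hL hD hab hs hax hby hb hnd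
  have naxw : ¬ Tri T a x w := fun ha =>
    h.false_of_six_symm hL hD hab.swap' hs.symm hby.swap' hax.swap' ha.swap' (by grind)
  obtain ⟨hxyw, havx, sax⟩ := h.exists_sep_of_six hL hD hab hs hax hby naxw hnd
  obtain ⟨-, hbvw, sbw⟩ := h.exists_sep_of_six hL hD hab.swap' hs.symm hby.swap' hax.swap'
    (fun hb => nbxw hb.swap') (by grind)
  simp only [List.nodup_cons, List.mem_cons, List.not_mem_nil, or_false, not_or] at hnd
  obtain ⟨⟨m7, m8, m9, m10, m11⟩, ⟨n1, n2, n3, n4⟩, ⟨n5, n6, n7⟩,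
    ⟨n8, n9⟩, n10, -⟩ := hnd
  have hV : ∀ {p q r}, Tri T p q r → p = x ∨ p = a ∨ p = v ∨ p = b ∨ p = w ∨ p = y := by
    intro p q r hp
    have := h.mem_of_sep hab hs hax hby (by grind) (by grind) (by grind) (by grind) hp
    grind
  have nayw : ¬ Tri T a y w := fun ht => by
    have := h.mem_of_sep hab hs ht hby (by grind) (by grind) (by grind) (by grind) hax.rot
    grind
  have nbxy : ¬ Tri T b x y := fun ht => by
    have := h.mem_of_sep hab hs hax ht (by grind) (by grind) (by grind) (by grind) hby.rot'
    grind
  have nab : ∀ t, t ≠ v → ¬ Tri T a b t := fun t ht hb => hs.not_covered hab ⟨t, ht, hb⟩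
  have nvx : ∀ t, t ≠ a → ¬ Tri T v x t := fun t ht hb => sax.not_covered havx ⟨t, ht, hb⟩
  have nvw : ∀ t, t ≠ b → ¬ Tri T v w t := fun t ht hb => sbw.not_covered hbvw ⟨t, ht, hb⟩
  have nvay : ¬ Tri T a v y := fun ht => by
    have := h.mem_of_sep ht (sax.trans_right hax ⟨w, by grind, hxyw⟩) hbvw.swap hby.swap
      (by grind) (by grind) (by grind) (by grind) hxyw
    grind
  have nvby : ¬ Tri T b v y := fun ht => by
    have := h.mem_of_sep ht (sbw.trans_right hby.swap' ⟨x, by grind, hxyw.rot.swap⟩) havx.swap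
      hax.rot' (by grind) (by grind) (by grind) (by grind) hxyw.rot'
    grind
  apply Finset.Subset.antisymm
  · intro σ hσ
    simp only [Finset.mem_insert, Finset.mem_singleton]
    by_cases hv : v ∈ σ
    · obtain ⟨p, t, hpt, rfl⟩ := exists_tri_of_mem hc hσ hv
      have h1 := hV hpt.rot
      have h2 := hV hpt.rot'
      have h3 := hpt.ne hc
      have h4 := hpt.swap'
      have h5 := hpt.swap
      have h6 := hpt.rot'
      have : ((p = a ∧ t = b) ∨ (p = b ∧ t = a)) ∨ ((p = x ∧ t = a) ∨ (p = a ∧ t = x)) ∨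
          ((p = b ∧ t = w) ∨ (p = w ∧ t = b)) := by
        rcases h1 with rfl | rfl | rfl | rfl | rfl | rfl <;> grind
      rcases this with h1 | h1 | h1
      · rw [triple_congr h1, triple_swap a]
        simp only [true_or, or_true]
      · rw [triple_congr h1, ← triple_rot v]
        simp only [true_or]
      · rw [triple_congr h1]
        simp only [true_or, or_true]
    by_cases ha : a ∈ σ
    · obtain ⟨p, t, hpt, rfl⟩ := exists_tri_of_mem hc hσ ha
      have h1 := hV hpt.rot
      have h2 := hV hpt.rot'
      have h3 := hpt.ne hc
      have h4 := hpt.swap'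
      simp only [Finset.mem_insert, Finset.mem_singleton, not_or] at hv
      have : (p = y ∧ t = x) ∨ (p = x ∧ t = y) := by grind
      rw [triple_congr this, ← triple_rot a]
      simp only [or_true]
    by_cases hb : b ∈ σ
    · obtain ⟨p, t, hpt, rfl⟩ := exists_tri_of_mem hc hσ hb
      have h1 := hV hpt.rot
      have h2 := hV hpt.rot'
      have h3 := hpt.ne hc
      have h4 := hpt.swap'
      simp only [Finset.mem_insert, Finset.mem_singleton, not_or] at hv ha
      have : (p = w ∧ t = y) ∨ (p = y ∧ t = w) := by grind
      rw [triple_congr this]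
      simp only [true_or, or_true]
    · obtain ⟨p, q, r, -, -, -, rfl⟩ := Finset.card_eq_three.1 (h.card_eq σ hσ)
      have hpt : Tri T p q r := hσ
      have := hV hpt
      have := hV hpt.rot
      have := hV hpt.rot'
      have := hpt.ne h.card_eq
      simp only [Finset.mem_insert, Finset.mem_singleton, not_or] at hv ha hb
      right; right; right; right; left
      ext t
      simp only [Finset.mem_insert, Finset.mem_singleton]
      grind
  · intro σ hσ
    simp only [Finset.mem_insert, Finset.mem_singleton] at hσ
    rcases hσ with rfl | rfl | rfl | rfl | rfl | rfl
    exacts [havx.rot', hab.swap, hbvw.swap, hby.swap', hxyw.rev, hax.rev]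

/-- The three bands with five, six and seven triangles. -/
def IsBand (T : Finset (Finset E)) : Prop :=
  (∃ x₀ x₁ x₂ x₃ x₄ : E, [x₀, x₁, x₂, x₃, x₄].Nodup ∧
    T = {{x₀, x₁, x₂}, {x₁, x₂, x₃}, {x₂, x₃, x₄}, {x₃, x₄, x₀}, {x₄, x₀, x₁}}) ∨
  (∃ x₀ x₁ x₂ x₃ x₄ x₅ : E, [x₀, x₁, x₂, x₃, x₄, x₅].Nodup ∧
    T = {{x₀, x₁, x₂}, {x₁, x₂, x₃}, {x₂, x₃, x₄}, {x₃, x₄, x₅}, {x₄, x₅, x₀}, {x₅, x₀, x₁}}) ∨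
  (∃ x₀ x₁ x₂ x₃ x₄ x₅ x₆ : E, [x₀, x₁, x₂, x₃, x₄, x₅, x₆].Nodup ∧
    T = {{x₀, x₁, x₂}, {x₁, x₂, x₃}, {x₂, x₃, x₄}, {x₃, x₄, x₅}, {x₄, x₅, x₆}, {x₅, x₆, x₀},
      {x₆, x₀, x₁}})

/-- The edges `xy` and `zw` of the two witness triangles have two, one or no vertices in common,
which gives five, six or seven vertices. -/
theorem isBand (h : Critical T) (hL : LinksTwoK2Free T) (hD : ¬ TwoDisjoint T) : IsBand T := by
  have hc := h.card_eq
  obtain ⟨σ, hσ⟩ : T.Nonempty := by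
    rw [Finset.nonempty_iff_ne_empty]
    rintro rfl
    exact h.not_shelled Shelled.empty
  obtain ⟨v, hv⟩ : σ.Nonempty := by
    rw [← Finset.card_pos, hc σ hσ]; omega
  obtain ⟨a, b, hab, hs, ⟨x, y, hax, hvx, hvy⟩, z, w, hbz, hvz, hvw⟩ :=
    h.exists_sep hL hD ⟨σ, hσ, hv⟩
  have nab : ∀ t, t ≠ v → ¬ Tri T a b t := fun t ht hb => hs.not_covered hab ⟨t, ht, hb⟩
  have hbx : b ≠ x := by rintro rfl; exact nab y hvy.symm hax
  have hby : b ≠ y := by rintro rfl; exact nab x hvx.symm hax.swap'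
  have haz : a ≠ z := by rintro rfl; exact nab w hvw.symm hbz.swap
  have haw : a ≠ w := by rintro rfl; exact nab z hvz.symm hbz.rot'
  have h1 := hab.ne hc
  have h2 := hax.ne hc
  have h3 := hbz.ne hc
  by_cases hxz : x = z
  · subst hxz
    by_cases hyw : y = w
    · subst hyw
      left
      rcases tri_or_of_sep hL hab hs hax hvx hvy with h4 | h4
      · exact ⟨b, v, a, x, y, by grind, h.band_of_five hab hs hax hbz h4
          (tri_or_of_sep hL hab.swap' hs.symm hbz hvz hvw) (by grind)⟩
      · exact ⟨b, v, a, y, x, by grind, h.band_of_five hab hs hax.swap' hbz.swap' h4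
          (tri_or_of_sep hL hab.swap' hs.symm hbz hvz hvw).symm (by grind)⟩
    · right; left
      exact ⟨y, a, v, b, w, x, by grind, h.band_of_six hL hD hab hs hax.swap' hbz (by grind)⟩
  by_cases hyw : y = w
  · subst hyw
    right; left
    exact ⟨x, a, v, b, z, y, by grind, h.band_of_six hL hD hab hs hax hbz.swap' (by grind)⟩
  by_cases hxw : x = w
  · subst hxw
    by_cases hyz : y = z
    · subst hyz
      left
      rcases tri_or_of_sep hL hab hs hax hvx hvy with h4 | h4
      · exact ⟨b, v, a, x, y, by grind, h.band_of_five hab hs hax hbz.swap' h4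
          (tri_or_of_sep hL hab.swap' hs.symm hbz hvz hvw).symm (by grind)⟩
      · exact ⟨b, v, a, y, x, by grind, h.band_of_five hab hs hax.swap' hbz h4
          (tri_or_of_sep hL hab.swap' hs.symm hbz hvz hvw) (by grind)⟩
    · right; left
      exact ⟨y, a, v, b, z, x, by grind, h.band_of_six hL hD hab hs hax.swap' hbz.swap' (by grind)⟩
  by_cases hyz : y = z
  · subst hyz
    right; left
    exact ⟨x, a, v, b, w, y, by grind, h.band_of_six hL hD hab hs hax hbz (by grind)⟩
  · right; right
    exact h.band_of_seven hL hD hab hs hax hbz (by grind)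

end Critical

/-! ### Certificates for the twelve complexes -/

theorem Shelled.image {F : Type*} [DecidableEq F] {S : Finset (Finset F)} (h : Shelled S)
    {f : F → E} {U : Set F} (hf : Set.InjOn f U) (hU : ∀ σ ∈ S, (σ : Set F) ⊆ U) :
    Shelled (S.image (Finset.image f)) := by
  induction h with
  | empty => simpa using Shelled.empty
  | @attach S σ _ ha ih =>
    rw [Finset.image_insert]
    refine (ih fun τ hτ => hU τ (Finset.mem_insert_of_mem hτ)).attach ?_
    have hσ := hU σ (Finset.mem_insert_self _ _)
    have hinter : ∀ τ ∈ S, σ.image f ∩ τ.image f = (σ ∩ τ).image f := by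
      intro τ hτ
      rw [Finset.image_inter_of_injOn]
      exact hf.mono (Set.union_subset hσ (hU τ (Finset.mem_insert_of_mem hτ)))
    intro τ hτ
    obtain ⟨τ, hτS, rfl⟩ := Finset.mem_image.1 hτ
    obtain ⟨τ', hτ', h1, h2⟩ := ha τ hτS
    refine ⟨τ'.image f, Finset.mem_image_of_mem _ hτ', ?_, ?_⟩
    · rw [hinter τ hτS]
      exact Finset.image_subset_image h1
    · rw [hinter τ' hτ', Finset.card_image_of_injOn, Finset.card_image_of_injOn (hf.mono hσ), h2]
      refine hf.mono (subset_trans ?_ hσ)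
      exact_mod_cast Finset.inter_subset_left

theorem shelled_of_subset_singleton {S : Finset (Finset E)} {σ : Finset E} (h : S ⊆ {σ}) :
    Shelled S := by
  rcases Finset.subset_singleton_iff.1 h with rfl | rfl
  · exact Shelled.empty
  · exact Shelled.empty.attach (attaches_empty σ)

/-- Two different triples in a four-element set share two elements, so every order is a shelling
order. -/
theorem shelled_of_card_le_four {S : Finset (Finset E)} {W : Finset E} (hW : W.card ≤ 4)
    (hc : ∀ σ ∈ S, σ.card = 3) (hS : ∀ σ ∈ S, σ ⊆ W) : Shelled S := by
  induction S using Finset.induction_on with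
  | empty => exact Shelled.empty
  | insert σ S hσ ih =>
    refine (ih (fun τ hτ => hc τ (Finset.mem_insert_of_mem hτ))
      (fun τ hτ => hS τ (Finset.mem_insert_of_mem hτ))).attach ?_
    have h1 := hc σ (Finset.mem_insert_self _ _)
    intro τ hτ
    refine ⟨τ, hτ, Finset.inter_subset_right, ?_⟩
    have h2 := hc τ (Finset.mem_insert_of_mem hτ)
    have h3 := Finset.card_union_add_card_inter σ τ
    have h4 := Finset.card_le_card (Finset.union_subset (hS σ (Finset.mem_insert_self _ _))
      (hS τ (Finset.mem_insert_of_mem hτ)))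
    have h5 : (σ ∩ τ).card ≤ σ.card := Finset.card_le_card Finset.inter_subset_left
    have h6 : (σ ∩ τ).card ≠ σ.card := by
      intro h6
      have h7 := Finset.inter_eq_left.1
        (Finset.eq_of_subset_of_card_le Finset.inter_subset_left h6.ge)
      exact hσ (Finset.eq_of_subset_of_card_le h7 (by rw [h1, h2]) ▸ hτ)
    omega

/-- A list in which each member attaches to the members after it. -/
def ShellingList : List (Finset E) → Prop
  | [] => True
  | σ :: l => Attaches l.toFinset σ ∧ ShellingList l

theorem ShellingList.shelled : ∀ {l : List (Finset E)}, ShellingList l → Shelled l.toFinset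
  | [], _ => by simpa using Shelled.empty
  | σ :: l, h => by
    rw [List.toFinset_cons]
    exact (ShellingList.shelled h.2).attach h.1

instance (S : Finset (Finset E)) (σ : Finset E) : Decidable (Attaches S σ) := by
  unfold Attaches
  infer_instance

instance decidableShellingList : ∀ l : List (Finset E), Decidable (ShellingList l)
  | [] => isTrue trivial
  | _ :: l => @instDecidableAnd _ _ _ (decidableShellingList l)

/-- `x` and `y` lie in a common member of `F`. -/
def Joined (F : Finset (Finset E)) (x y : E) : Prop := ∃ t ∈ F, x ∈ t ∧ y ∈ t

instance (F : Finset (Finset E)) (x y : E) : Decidable (Joined F x y) := by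
  unfold Joined
  infer_instance

/-- No two disjoint pairs of vertices are without an edge between them. -/
def NonadjacencyC4Free (F : Finset (Finset (Fin 7))) : Prop :=
  ∀ a, Joined F a a → ∀ c, Joined F c c → ¬ Joined F a c → ∀ d, Joined F d d → d ≠ c →
    ¬ Joined F a d → ∀ b, b ≠ a → Joined F b b → Joined F b c ∨ Joined F b d

instance (F : Finset (Finset (Fin 7))) : Decidable (NonadjacencyC4Free F) := by
  unfold NonadjacencyC4Free
  infer_instance

/-- Every edge outside the triangles is the only edge between two edges of triangles. -/
def EdgesNeeded (F : Finset (Finset (Fin 7))) : Prop :=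
  ∀ x y, x ≠ y → Joined F x y → Joined (F.filter (fun t => t.card = 3)) x y ∨
    ∃ b d, x ≠ b ∧ y ≠ d ∧ Joined (F.filter (fun t => t.card = 3)) x b ∧
      Joined (F.filter (fun t => t.card = 3)) y d ∧
      ¬ Joined F x d ∧ ¬ Joined F b y ∧ ¬ Joined F b d

instance (F : Finset (Finset (Fin 7))) : Decidable (EdgesNeeded F) := by
  unfold EdgesNeeded
  infer_instance

/-- The properties of the generating sets of an edge-minimal obstruction. -/
structure Good (F : Finset (Finset (Fin 7))) : Prop where
  card_le : ∀ t ∈ F, t.card ≤ 3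
  c4Free : NonadjacencyC4Free F
  needed : EdgesNeeded F
  not_shelled : ¬ Shelled (F.filter (fun t => t.card = 3))
  shelled : ∀ W : Finset (Fin 7), (∀ x ∈ W, Joined F x x) → (∃ x, Joined F x x ∧ x ∉ W) →
    Shelled ((F.filter (fun t => t.card = 3)).filter (fun σ => σ ⊆ W))

theorem not_shelled_of_link {T : Finset (Finset E)} (hc : ∀ σ ∈ T, σ.card = 3) {u a b c d : E}
    (hab : {u, a, b} ∈ T) (hcd : {u, c, d} ∈ T)
    (h : ∀ σ ∈ T, u ∈ σ → σ = {u, a, b} ∨ σ = {u, c, d}) (hnd : [u, a, b, c, d].Nodup) :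
    ¬ Shelled T := by
  intro hS
  simp only [List.nodup_cons, List.mem_cons, List.not_mem_nil, or_false, not_or] at hnd
  obtain ⟨⟨n1, n2, n3, n4⟩, ⟨n5, n6, n7⟩, ⟨n8, n9⟩, n10, -⟩ := hnd
  have key := hS.link_connected hc (ρ := {u}) (by simp) (A := {a, b}) (by
      intro σ hσ hu
      rw [Finset.singleton_subset_iff] at hu
      rcases h σ hσ hu with rfl | rfl
      · left; simp
      · right
        simp only [Finset.mem_insert, Finset.mem_singleton, Set.mem_insert_iff,
          Set.mem_singleton_iff]
        grind)
    _ hab (by simp) _ hcd (by simp) a (by simp) (by simp [Ne.symm n1])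
    c (by simp) (by simp [Ne.symm n3]) (by simp)
  simp [Ne.symm n6, Ne.symm n8] at key

/-- The disconnected link of `0` prevents shelling. A proper subset of the at most five vertices has
at most four elements, so its triangles are shelled in any order. -/
theorem good_of_link {F : Finset (Finset (Fin 7))} (hcard : ∀ t ∈ F, t.card ≤ 3)
    (h1 : NonadjacencyC4Free F) (h2 : EdgesNeeded F) (h012 : {0, 1, 2} ∈ F) (h034 : {0, 3, 4} ∈ F)
    (hlink : ∀ σ ∈ F.filter (fun t => t.card = 3), 0 ∈ σ → σ = {0, 1, 2} ∨ σ = {0, 3, 4})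
    (hV : ∀ x, Joined F x x → x < 5) : Good F := by
  have hc : ∀ σ ∈ F.filter (fun t => t.card = 3), σ.card = 3 :=
    fun σ hσ => (Finset.mem_filter.1 hσ).2
  refine ⟨hcard, h1, h2, ?_, ?_⟩
  · exact not_shelled_of_link hc (Finset.mem_filter.2 ⟨h012, by decide⟩)
      (Finset.mem_filter.2 ⟨h034, by decide⟩) hlink (by decide)
  · rintro W hW ⟨x, hx, hxW⟩
    refine shelled_of_card_le_four (W := W) ?_ (fun σ hσ => hc σ (Finset.mem_filter.1 hσ).1)
      (fun σ hσ => (Finset.mem_filter.1 hσ).2)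
    have hsub : W ⊆ (Finset.univ.filter (fun y : Fin 7 => y < 5)).erase x := by
      intro y hy
      rw [Finset.mem_erase, Finset.mem_filter]
      exact ⟨fun h => hxW (h ▸ hy), Finset.mem_univ _, hV y (hW y hy)⟩
    have := Finset.card_le_card hsub
    rw [Finset.card_erase_of_mem (by simp [hV x hx])] at this
    exact this

theorem good_of_disjoint {F : Finset (Finset (Fin 7))} (hcard : ∀ t ∈ F, t.card ≤ 3)
    (h1 : NonadjacencyC4Free F) (h2 : EdgesNeeded F)
    (hT : F.filter (fun t => t.card = 3) = {{0, 1, 2}, {3, 4, 5}})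
    (hV : ∀ x, Joined F x x → x < 6) : Good F := by
  refine ⟨hcard, h1, h2, ?_, ?_⟩
  · rw [hT]
    intro h
    have := h.connected (by decide +kernel) (A := {x | x < 3}) (by
      change ∀ σ ∈ ({{0, 1, 2}, {3, 4, 5}} : Finset (Finset (Fin 7))),
        (∀ x ∈ σ, x < 3) ∨ ∀ x ∈ σ, ¬ x < 3
      decide +kernel) (σ := {0, 1, 2}) (τ := {3, 4, 5}) (by simp) (by simp)
      (x := 0) (y := 3) (by decide) (by decide) (by simp)
    simp at this
  · rintro W - ⟨x, hx, hxW⟩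
    rw [hT]
    have hx6 := hV x hx
    by_cases hx3 : x < 3
    · refine shelled_of_subset_singleton (σ := {3, 4, 5}) ?_
      intro σ hσ
      rw [Finset.mem_filter, Finset.mem_insert] at hσ
      refine hσ.1.resolve_left ?_
      rintro rfl
      have hmem : ∀ x : Fin 7, x < 3 → x ∈ ({0, 1, 2} : Finset (Fin 7)) := by decide
      exact hxW (hσ.2 (hmem x hx3))
    · refine shelled_of_subset_singleton (σ := {0, 1, 2}) ?_
      intro σ hσ
      rw [Finset.mem_filter, Finset.mem_insert, Finset.mem_singleton] at hσ
      rw [Finset.mem_singleton]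
      refine hσ.1.resolve_right ?_
      rintro rfl
      have hmem : ∀ x : Fin 7, ¬ x < 3 → x < 6 → x ∈ ({3, 4, 5} : Finset (Fin 7)) := by decide
      exact hxW (hσ.2 (hmem x hx3 hx6))

/-- The edges of a band on `0, …, m` that pass from `m` to `0`. -/
def winding (x y : Fin 7) : ZMod 2 := if x.val + 3 ≤ y.val ∨ y.val + 3 ≤ x.val then 1 else 0

/-- The cocycle `winding` detects the closed path `0, 1, …, m, 0`: a potential would be constant
along `0, …, m`, but the closing edge has value `1`. -/
theorem not_shelled_of_winding {T : Finset (Finset (Fin 7))} (hc : ∀ σ ∈ T, σ.card = 3) (m : ℕ)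
    (hm : m < 7) (hm3 : 3 ≤ m)
    (hT : ∀ x y z, {x, y, z} ∈ T → winding x y + winding y z + winding x z = 0)
    (hpath : ∀ i j : Fin 7, j.val = i.val + 1 → j.val ≤ m → Joined T i j)
    (hclose : Joined T 0 ⟨m, hm⟩) : ¬ Shelled T := by
  intro h
  have two : ∀ s t : ZMod 2, 0 = s + t → s = t := by decide
  obtain ⟨f, hf⟩ := h.exists_potential hc (φ := winding)
    (fun x y => by simp only [winding, or_comm]) hT
  have hconst : ∀ i (hi : i < 7), i ≤ m → f 0 = f ⟨i, hi⟩ := by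
    intro i
    induction i with
    | zero => intro _ _; rfl
    | succ i ih =>
      intro hi him
      rw [ih (by omega) (by omega)]
      obtain ⟨t, ht, h1, h2⟩ := hpath ⟨i, by omega⟩ ⟨i + 1, hi⟩ rfl him
      have := hf t ht _ h1 _ h2 (by simp)
      rw [winding, if_neg (by simp; omega)] at this
      exact two _ _ this
  obtain ⟨t, ht, h1, h2⟩ := hclose
  have := hf t ht _ h1 _ h2 (by simp [Fin.ext_iff]; omega)
  rw [← hconst m hm le_rfl, winding, if_pos (by left; simpa using hm3)] at this
  have two' : ∀ s : ZMod 2, 1 ≠ s + s := by decide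
  exact two' _ this

/-- Removing a vertex cuts the band open, and a suitable rotation of the cyclic list shells what
remains. Sets with at most four elements need no check. -/
theorem good_of_band {F : Finset (Finset (Fin 7))} (hcard : ∀ t ∈ F, t.card = 3)
    (h1 : NonadjacencyC4Free F) (h2 : EdgesNeeded F) (m : ℕ) (hm : m < 7) (hm3 : 3 ≤ m)
    (hT : ∀ x y z, {x, y, z} ∈ F → winding x y + winding y z + winding x z = 0)
    (hpath : ∀ i j : Fin 7, j.val = i.val + 1 → j.val ≤ m → Joined F i j)
    (hclose : Joined F 0 ⟨m, hm⟩) (l : List (Finset (Fin 7))) (hl : l.toFinset = F)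
    (hW : ∀ W : Finset (Fin 7), 5 ≤ W.card → (∃ x, Joined F x x ∧ x ∉ W) →
      ∃ l' ∈ l.cyclicPermutations, ShellingList (l'.filter (fun σ => σ ⊆ W))) : Good F := by
  have hF : F.filter (fun t => t.card = 3) = F := Finset.filter_true_of_mem hcard
  refine ⟨fun t ht => (hcard t ht).le, h1, h2, ?_, ?_⟩
  · rw [hF]
    exact not_shelled_of_winding hcard m hm hm3 hT hpath hclose
  · intro W _ hx
    rw [hF]
    by_cases hW5 : 5 ≤ W.card
    · obtain ⟨l', hl', h3⟩ := hW W hW5 hx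
      convert h3.shelled using 1
      have hperm : l'.toFinset = F := by
        rw [← hl]
        exact List.toFinset_eq_of_perm _ _ (List.mem_cyclicPermutations_iff.1 hl').perm
      rw [List.toFinset_filter, hperm]
      simp
    · exact shelled_of_card_le_four (W := W) (by omega)
        (fun σ hσ => hcard σ (Finset.mem_filter.1 hσ).1) (fun σ hσ => (Finset.mem_filter.1 hσ).2)

theorem exists_good_of_mem_twelveComplexes {Δ : FinComplex (Fin 7)} (h : Δ ∈ twelveComplexes) :
    ∃ F, Good F ∧ Δ = generatedBy F := by
  simp only [twelveComplexes, List.mem_cons, List.not_mem_nil, or_false] at h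
  rcases h with rfl | rfl | rfl | rfl | rfl | rfl | rfl | rfl | rfl | rfl | rfl | rfl
  · exact ⟨_, good_of_disjoint (by decide +kernel) (by decide +kernel) (by decide +kernel)
      (by decide +kernel) (by decide +kernel), rfl⟩
  · exact ⟨_, good_of_disjoint (by decide +kernel) (by decide +kernel) (by decide +kernel)
      (by decide +kernel) (by decide +kernel), rfl⟩
  · exact ⟨_, good_of_disjoint (by decide +kernel) (by decide +kernel) (by decide +kernel)
      (by decide +kernel) (by decide +kernel), rfl⟩
  · exact ⟨_, good_of_link (by decide +kernel) (by decide +kernel) (by decide +kernel)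
      (by decide +kernel) (by decide +kernel) (by decide +kernel) (by decide +kernel), rfl⟩
  · exact ⟨_, good_of_link (by decide +kernel) (by decide +kernel) (by decide +kernel)
      (by decide +kernel) (by decide +kernel) (by decide +kernel) (by decide +kernel), rfl⟩
  · exact ⟨_, good_of_link (by decide +kernel) (by decide +kernel) (by decide +kernel)
      (by decide +kernel) (by decide +kernel) (by decide +kernel) (by decide +kernel), rfl⟩
  · exact ⟨_, good_of_link (by decide +kernel) (by decide +kernel) (by decide +kernel)
      (by decide +kernel) (by decide +kernel) (by decide +kernel) (by decide +kernel), rfl⟩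
  · exact ⟨_, good_of_link (by decide +kernel) (by decide +kernel) (by decide +kernel)
      (by decide +kernel) (by decide +kernel) (by decide +kernel) (by decide +kernel), rfl⟩
  · exact ⟨_, good_of_link (by decide +kernel) (by decide +kernel) (by decide +kernel)
      (by decide +kernel) (by decide +kernel) (by decide +kernel) (by decide +kernel), rfl⟩
  · exact ⟨_, good_of_band (by decide +kernel) (by decide +kernel) (by decide +kernel) 4
      (by omega) (by omega) (by decide +kernel) (by decide +kernel) (by decide +kernel)
      [{0, 1, 2}, {1, 2, 3}, {2, 3, 4}, {3, 4, 0}, {4, 0, 1}] (by decide +kernel)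
      (by decide +kernel), rfl⟩
  · exact ⟨_, good_of_band (by decide +kernel) (by decide +kernel) (by decide +kernel) 5
      (by omega) (by omega) (by decide +kernel) (by decide +kernel) (by decide +kernel)
      [{0, 1, 2}, {1, 2, 3}, {2, 3, 4}, {3, 4, 5}, {4, 5, 0}, {5, 0, 1}] (by decide +kernel)
      (by decide +kernel), rfl⟩
  · exact ⟨_, good_of_band (by decide +kernel) (by decide +kernel) (by decide +kernel) 6
      (by omega) (by omega) (by decide +kernel) (by decide +kernel) (by decide +kernel)
      [{0, 1, 2}, {1, 2, 3}, {2, 3, 4}, {3, 4, 5}, {4, 5, 6}, {5, 6, 0}, {6, 0, 1}]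
      (by decide +kernel) (by decide +kernel), rfl⟩

/-! ### Transport along injective vertex maps, and added edges -/

/-- The image of a complex under a map of the ground sets. -/
def map {F : Type*} (Δ : FinComplex F) (f : F → E) : FinComplex E where
  faces := Δ.faces.image (Finset.image f)
  empty_mem := Finset.mem_image.2 ⟨∅, Δ.empty_mem, by simp⟩
  down_closed := by
    classical
    intro s hs t hts
    obtain ⟨u, hu, rfl⟩ := Finset.mem_image.1 hs
    refine Finset.mem_image.2 ⟨u.filter (fun x => f x ∈ t),
      Δ.down_closed u hu _ (Finset.filter_subset _ _), ?_⟩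
    ext x
    simp only [Finset.mem_image, Finset.mem_filter]
    constructor
    · rintro ⟨y, ⟨-, hy⟩, rfl⟩
      exact hy
    · intro hx
      obtain ⟨y, hy, rfl⟩ := Finset.mem_image.1 (hts hx)
      exact ⟨y, ⟨hy, hx⟩, rfl⟩

theorem coe_face_subset {F : Type*} {Δ : FinComplex F} {s : Finset F} (hs : s ∈ Δ.faces) :
    (s : Set F) ⊆ Δ.vertexSet := fun x hx =>
  Δ.down_closed s hs _ (by simpa using hx)

theorem vertexSet_map {F : Type*} (Δ : FinComplex F) (f : F → E) :
    (Δ.map f).vertexSet = f '' Δ.vertexSet := by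
  ext x
  simp only [vertexSet, map, Set.mem_image]
  constructor
  · intro h
    obtain ⟨s, hs, he⟩ := Finset.mem_image.1 h
    have : x ∈ s.image f := by rw [he]; simp
    obtain ⟨y, hy, rfl⟩ := Finset.mem_image.1 this
    exact ⟨y, coe_face_subset hs hy, rfl⟩
  · rintro ⟨y, hy, rfl⟩
    exact Finset.mem_image.2 ⟨{y}, hy, by simp⟩

theorem isIso_map {F : Type*} {Δ : FinComplex F} {f : F → E}
    (hf : Set.InjOn f Δ.vertexSet) : (Δ.map f).IsIso Δ := by
  classical
  let e : (Δ.map f).vertexSet ≃ Δ.vertexSet :=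
    (Equiv.setCongr (vertexSet_map Δ f)).trans (Equiv.Set.imageOfInjOn f _ hf).symm
  have he : ∀ x, f (e x) = x := by
    intro x
    have h1 := congrArg Subtype.val
      ((Equiv.Set.imageOfInjOn f _ hf).apply_symm_apply (Equiv.setCongr (vertexSet_map Δ f) x))
    exact h1
  refine ⟨e, fun s => ?_⟩
  set s' : Finset F := (s.map e.toEmbedding).map (Function.Embedding.subtype _) with hs'
  have himg : s.map (Function.Embedding.subtype _) = s'.image f := by
    ext x
    simp only [hs', Finset.mem_map, Finset.mem_image, exists_exists_and_eq_and]
    constructor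
    · rintro ⟨y, hy, rfl⟩
      exact ⟨y, hy, he y⟩
    · rintro ⟨y, hy, rfl⟩
      exact ⟨y, hy, (he y).symm⟩
  have hsub : (s' : Set F) ⊆ Δ.vertexSet := by
    intro x hx
    simp only [hs', Finset.coe_map, Set.mem_image] at hx
    obtain ⟨y, -, rfl⟩ := hx
    exact y.2
  rw [himg]
  constructor
  · intro h
    obtain ⟨u, hu, heq⟩ := Finset.mem_image.1 h
    have : u = s' := by
      have h1 : f '' (u : Set F) = f '' (s' : Set F) := by
        rw [← Finset.coe_image, ← Finset.coe_image, heq]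
      exact_mod_cast (hf.image_eq_image_iff (coe_face_subset hu) hsub).1 h1
    rwa [← this]
  · intro h
    exact Finset.mem_image_of_mem _ h

theorem IsIso.exists_map {F : Type*} {Γ : FinComplex E} {Δ : FinComplex F} (h : Γ.IsIso Δ)
    (hne : Δ.vertexSet.Nonempty) : ∃ f : F → E, Set.InjOn f Δ.vertexSet ∧ Γ = Δ.map f := by
  classical
  obtain ⟨e, he⟩ := h
  obtain ⟨x₀, hx₀⟩ := hne
  -- Off the vertex set the value is irrelevant; a vertex of `Δ` supplies one, as `E` could
  -- otherwise be empty.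
  let f : F → E := fun x => if hx : x ∈ Δ.vertexSet then e.symm ⟨x, hx⟩ else e.symm ⟨x₀, hx₀⟩
  have hf : ∀ x : Δ.vertexSet, f x = e.symm x := by
    intro x
    simp [f]
  have himg : ∀ s : Finset Γ.vertexSet,
      ((s.map e.toEmbedding).map (Function.Embedding.subtype _)).image f =
        s.map (Function.Embedding.subtype _) := by
    intro s
    ext x
    simp only [Finset.mem_map, Finset.mem_image, exists_exists_and_eq_and]
    constructor
    · rintro ⟨y, hy, rfl⟩
      exact ⟨y, hy, by simpa using (hf (e y)).symm⟩
    · rintro ⟨y, hy, rfl⟩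
      exact ⟨y, hy, by simpa using hf (e y)⟩
  refine ⟨f, ?_, ?_⟩
  · intro x hx y hy hxy
    have h1 : f x = e.symm ⟨x, hx⟩ := hf ⟨x, hx⟩
    have h2 : f y = e.symm ⟨y, hy⟩ := hf ⟨y, hy⟩
    rw [h1, h2] at hxy
    simpa using e.symm.injective (Subtype.ext hxy)
  · ext t
    simp only [map, Finset.mem_image]
    constructor
    · intro ht
      have h1 : (t.subtype (· ∈ Γ.vertexSet)).map (Function.Embedding.subtype _) = t :=
        Finset.subtype_map_of_mem fun x hx => coe_face_subset ht hx
      refine ⟨_, (he (t.subtype (· ∈ Γ.vertexSet))).1 (by rwa [h1]), ?_⟩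
      rw [himg, h1]
    · rintro ⟨s, hs, rfl⟩
      have h1 : (s.subtype (· ∈ Δ.vertexSet)).map (Function.Embedding.subtype _) = s :=
        Finset.subtype_map_of_mem fun x hx => coe_face_subset hs hx
      have h2 : ((s.subtype (· ∈ Δ.vertexSet)).map e.symm.toEmbedding).map e.toEmbedding =
          s.subtype (· ∈ Δ.vertexSet) := by
        ext x
        simp
      have h3 := himg ((s.subtype (· ∈ Δ.vertexSet)).map e.symm.toEmbedding)
      rw [h2, h1] at h3
      rw [h3, he, h2, h1]
      exact hs

theorem mem_generatedBy {F : Finset (Finset E)} {s : Finset E} :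
    s ∈ (generatedBy F).faces ↔ s = ∅ ∨ ∃ t ∈ F, s ⊆ t := by
  simp [generatedBy]

theorem mem_vertexSet_generatedBy {F : Finset (Finset E)} {x : E} :
    x ∈ (generatedBy F).vertexSet ↔ Joined F x x := by
  have : x ∈ (generatedBy F).vertexSet ↔ {x} ∈ (generatedBy F).faces := Iff.rfl
  rw [this, mem_generatedBy]
  simp [Joined]

theorem pair_mem_generatedBy {F : Finset (Finset E)} {x y : E} :
    {x, y} ∈ (generatedBy F).faces ↔ Joined F x y := by
  rw [mem_generatedBy]
  simp [Joined, Finset.insert_subset_iff]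

theorem triangles_generatedBy {F : Finset (Finset E)} (hF : ∀ t ∈ F, t.card ≤ 3) :
    (generatedBy F).triangles = F.filter (fun t => t.card = 3) := by
  ext s
  rw [mem_triangles, mem_generatedBy, Finset.mem_filter]
  constructor
  · rintro ⟨rfl | ⟨t, ht, hst⟩, hs⟩
    · simp at hs
    · rw [Finset.eq_of_subset_of_card_le hst (by rw [hs]; exact hF t ht)]
      refine ⟨ht, ?_⟩
      have := Finset.card_le_card hst
      have := hF t ht
      omega
  · rintro ⟨h1, h2⟩
    exact ⟨Or.inr ⟨s, h1, subset_rfl⟩, h2⟩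

theorem card_le_of_mem_map {F : Type*} {Δ : FinComplex F} {f : F → E} {n : ℕ}
    (h : ∀ s ∈ Δ.faces, s.card ≤ n) : ∀ s ∈ (Δ.map f).faces, s.card ≤ n := by
  intro s hs
  obtain ⟨u, hu, rfl⟩ := Finset.mem_image.1 hs
  exact Finset.card_image_le.trans (h u hu)

theorem triangles_map {F : Type*} [DecidableEq F] {Δ : FinComplex F} {f : F → E}
    (hf : Set.InjOn f Δ.vertexSet) :
    (Δ.map f).triangles = Δ.triangles.image (Finset.image f) := by
  ext s
  simp only [mem_triangles, map, Finset.mem_image]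
  constructor
  · rintro ⟨⟨u, hu, rfl⟩, hs⟩
    rw [Finset.card_image_of_injOn (hf.mono (coe_face_subset hu))] at hs
    exact ⟨u, ⟨hu, hs⟩, rfl⟩
  · rintro ⟨u, ⟨hu, hs⟩, rfl⟩
    rw [Finset.card_image_of_injOn (hf.mono (coe_face_subset hu))]
    exact ⟨⟨u, hu, rfl⟩, hs⟩

theorem pair_mem_map {F : Type*} [DecidableEq F] {Δ : FinComplex F} {f : F → E}
    (hf : Set.InjOn f Δ.vertexSet) {x y : F} (hx : x ∈ Δ.vertexSet) (hy : y ∈ Δ.vertexSet) :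
    {f x, f y} ∈ (Δ.map f).faces ↔ {x, y} ∈ Δ.faces := by
  simp only [map, Finset.mem_image]
  constructor
  · rintro ⟨u, hu, he⟩
    have h1 : f '' (u : Set F) = f '' (({x, y} : Finset F) : Set F) := by
      rw [← Finset.coe_image, he, ← Finset.coe_image, Finset.image_insert, Finset.image_singleton]
    have h2 : (({x, y} : Finset F) : Set F) ⊆ Δ.vertexSet := by
      intro z hz
      simp only [Finset.coe_insert, Finset.coe_singleton, Set.mem_insert_iff,
        Set.mem_singleton_iff] at hz
      rcases hz with rfl | rfl <;> assumption
    have : u = {x, y} := by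
      exact_mod_cast (hf.image_eq_image_iff (coe_face_subset hu) h2).1 h1
    rwa [← this]
  · intro h
    exact ⟨_, h, by rw [Finset.image_insert, Finset.image_singleton]⟩

section AddEdges

variable {Γ₀ Γ : FinComplex E}

theorem IsAddEdges.refl (Γ : FinComplex E) : IsAddEdges Γ Γ :=
  ⟨subset_rfl, fun _ h h' => absurd h h'⟩

theorem IsAddEdges.mem_iff (h : IsAddEdges Γ₀ Γ) {s : Finset E} (hs : s.card ≠ 2) :
    s ∈ Γ.faces ↔ s ∈ Γ₀.faces := by
  refine ⟨fun h1 => ?_, fun h1 => h.1 h1⟩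
  by_contra h2
  have := h.2 s h1 h2
  rw [faceDim] at this
  omega

theorem IsAddEdges.triangles_eq (h : IsAddEdges Γ₀ Γ) : Γ.triangles = Γ₀.triangles := by
  ext s
  simp only [mem_triangles]
  exact and_congr_left fun hs => h.mem_iff (by omega)

theorem IsAddEdges.vertexSet_eq (h : IsAddEdges Γ₀ Γ) : Γ.vertexSet = Γ₀.vertexSet := by
  ext x
  exact h.mem_iff (by simp)

theorem IsAddEdges.card_le (h : IsAddEdges Γ₀ Γ) (h₀ : ∀ s ∈ Γ₀.faces, s.card ≤ 3) :
    ∀ s ∈ Γ.faces, s.card ≤ 3 := by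
  intro s hs
  by_cases h2 : s.card = 2
  · omega
  · exact h₀ s ((h.mem_iff h2).1 hs)

end AddEdges

/-- Adding edges changes neither triangles nor vertices, so only the absence of induced `2K₂` is at
stake. It persists because `NonadjacencyC4Free` concerns arbitrary disjoint pairs of vertices and so
is monotone in the edges. -/
theorem Good.isObstruction {F : Finset (Finset (Fin 7))} (hF : Good F) {f : Fin 7 → E}
    (hf : Set.InjOn f (generatedBy F).vertexSet) {Γ : FinComplex E}
    (h : IsAddEdges ((generatedBy F).map f) Γ) : Γ.IsObstruction ∧ Γ.dim = 2 := by
  set Δ := generatedBy F with hΔ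
  have hcΔ : ∀ s ∈ Δ.faces, s.card ≤ 3 := by
    intro s hs
    rcases mem_generatedBy.1 hs with rfl | ⟨t, ht, hst⟩
    · simp
    · exact (Finset.card_le_card hst).trans (hF.card_le t ht)
  have hc := h.card_le (card_le_of_mem_map hcΔ)
  have hT : Γ.triangles = Δ.triangles.image (Finset.image f) := by
    rw [h.triangles_eq, triangles_map hf]
  have hTF : Δ.triangles = F.filter (fun t => t.card = 3) := triangles_generatedBy hF.card_le
  have hV : Γ.vertexSet = f '' Δ.vertexSet := by
    rw [h.vertexSet_eq, vertexSet_map]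
  have hsubV : ∀ σ ∈ Δ.triangles, (σ : Set (Fin 7)) ⊆ Δ.vertexSet :=
    fun σ hσ => coe_face_subset (mem_triangles.1 hσ).1
  have hns : ¬ Shelled Γ.triangles := by
    intro hS
    apply hF.not_shelled
    rw [← hTF]
    -- A shelling of the image would be carried back by the inverse of `f` on the vertex set.
    have hg := hf.leftInvOn_invFunOn
    set g := Function.invFunOn f Δ.vertexSet with hgdef
    have hginj : Set.InjOn g (f '' Δ.vertexSet) := by
      rintro _ ⟨x, hx, rfl⟩ _ ⟨y, hy, rfl⟩ hxy
      rw [hg hx, hg hy] at hxy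
      rw [hxy]
    have := hS.image hginj (by
      intro σ hσ
      rw [← hV]
      exact coe_face_subset (mem_triangles.1 hσ).1)
    rw [hT, Finset.image_image] at this
    convert this using 1
    symm
    rw [← Finset.image_id (s := Δ.triangles)]
    rw [Finset.image_image]
    refine Finset.image_congr ?_
    intro σ hσ
    simp only [Function.comp, id, Finset.image_image]
    ext x
    simp only [Finset.mem_image, Function.comp]
    constructor
    · rintro ⟨y, hy, rfl⟩
      rwa [hg (hsubV σ hσ hy)]
    · intro hx
      exact ⟨x, hx, hg (hsubV σ hσ hx)⟩
  refine ⟨isObstruction_of_triangles hc ?_ hns ?_, ?_⟩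
  · intro a b c d hab hcd h1 h2 hac had hbc hbd
    have vert : ∀ {x y}, {x, y} ∈ Γ.faces → ∃ z, z ∈ Δ.vertexSet ∧ f z = x := by
      intro x y hxy
      have : x ∈ Γ.vertexSet := coe_face_subset hxy (by simp)
      rw [hV] at this
      exact this
    obtain ⟨a', ha', rfl⟩ := vert h1
    obtain ⟨b', hb', rfl⟩ := vert (y := f a') (by rwa [Finset.pair_comm])
    obtain ⟨c', hc', rfl⟩ := vert h2
    obtain ⟨d', hd', rfl⟩ := vert (y := f c') (by rwa [Finset.pair_comm])
    have edge : ∀ {x y}, Joined F x y → {f x, f y} ∈ Γ.faces := by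
      intro x y hxy
      rw [← pair_mem_generatedBy] at hxy
      exact h.1 ((pair_mem_map hf (coe_face_subset hxy (by simp))
        (coe_face_subset hxy (by simp))).2 hxy)
    rw [mem_vertexSet_generatedBy] at ha' hb' hc' hd'
    by_cases e1 : Joined F a' c'
    · exact Or.inl (edge e1)
    by_cases e2 : Joined F a' d'
    · exact Or.inr (Or.inl (edge e2))
    rcases hF.c4Free a' ha' c' hc' e1 d' hd' (fun he => hcd (by rw [he])) e2 b'
      (fun he => hab (by rw [he])) hb' with e3 | e3
    · exact Or.inr (Or.inr (Or.inl (edge e3)))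
    · exact Or.inr (Or.inr (Or.inr (edge e3)))
  · intro W hW
    rw [hV] at hW
    classical
    set W' : Finset (Fin 7) := Finset.univ.filter (fun x => x ∈ Δ.vertexSet ∧ f x ∈ W) with hW'
    have h1 := hF.shelled W' (by
      intro x hx
      rw [← mem_vertexSet_generatedBy]
      exact (Finset.mem_filter.1 hx).2.1) (by
      obtain ⟨_, ⟨x, hx, rfl⟩, hxW⟩ := Set.exists_of_ssubset hW
      exact ⟨x, mem_vertexSet_generatedBy.1 hx, fun hx' => hxW (Finset.mem_filter.1 hx').2.2⟩)
    rw [← hTF] at h1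
    have h2 := h1.image hf (fun σ hσ => hsubV σ (Finset.mem_filter.1 hσ).1)
    convert h2 using 1
    rw [hT, Finset.filter_image]
    congr 1
    refine Finset.filter_congr ?_
    intro σ hσ
    rw [Finset.image_subset_iff]
    constructor
    · intro hs x hx
      exact Finset.mem_filter.2 ⟨Finset.mem_univ _, hsubV σ hσ hx, hs x hx⟩
    · intro hs x hx
      exact (Finset.mem_filter.1 (hs hx)).2.2
  · rw [dim_eq_two_iff]
    refine ⟨hc, ?_⟩
    rw [Finset.nonempty_iff_ne_empty]
    intro he
    rw [he] at hns
    exact hns Shelled.empty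

/-- The triangles of `Θ` are the same, so a missing edge lies in no triangle. By `EdgesNeeded` it is
the only edge between two edges of triangles, and without it these induce a `2K₂`. -/
theorem Good.eq_of_isAddEdges {F : Finset (Finset (Fin 7))} (hF : Good F) {f : Fin 7 → E}
    (hf : Set.InjOn f (generatedBy F).vertexSet) {Θ : FinComplex E} (hΘ : Θ.IsObstruction)
    (hd : Θ.dim = 2) (h : IsAddEdges Θ ((generatedBy F).map f)) :
    Θ = (generatedBy F).map f := by
  have hG := hΘ.twoK2Free hd
  set Δ := generatedBy F with hΔ
  have hTF : Δ.triangles = F.filter (fun t => t.card = 3) := triangles_generatedBy hF.card_le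
  have hT : Θ.triangles = Δ.triangles.image (Finset.image f) := by
    rw [← h.triangles_eq, triangles_map hf]
  ext1
  refine Finset.Subset.antisymm h.1 ?_
  intro s hs
  by_contra hsΘ
  have hs2 : s.card = 2 := by
    have := h.2 s hs hsΘ
    rw [faceDim] at this
    omega
  have hedge : ∀ {x y}, Joined (F.filter (fun t => t.card = 3)) x y → {f x, f y} ∈ Θ.faces := by
    rintro x y ⟨t, ht, hx, hy⟩
    rw [← hTF] at ht
    have : t.image f ∈ Θ.triangles := by
      rw [hT]
      exact Finset.mem_image_of_mem _ ht
    refine Θ.down_closed _ (mem_triangles.1 this).1 _ ?_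
    intro z hz
    simp only [Finset.mem_insert, Finset.mem_singleton] at hz
    rcases hz with rfl | rfl
    · exact Finset.mem_image_of_mem _ hx
    · exact Finset.mem_image_of_mem _ hy
  have hjoin : ∀ {x y}, Joined (F.filter (fun t => t.card = 3)) x y → Joined F x y := by
    rintro x y ⟨t, ht, hx, hy⟩
    exact ⟨t, (Finset.mem_filter.1 ht).1, hx, hy⟩
  have hvert : ∀ {x y}, Joined F x y → x ∈ Δ.vertexSet ∧ y ∈ Δ.vertexSet := by
    rintro x y ⟨t, ht, hx, hy⟩
    exact ⟨mem_vertexSet_generatedBy.2 ⟨t, ht, hx, hx⟩, mem_vertexSet_generatedBy.2 ⟨t, ht, hy, hy⟩⟩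
  have hnot : ∀ {x y}, x ∈ Δ.vertexSet → y ∈ Δ.vertexSet → ¬ Joined F x y →
      {f x, f y} ∉ Θ.faces := by
    intro x y hx hy hn hm
    exact hn (pair_mem_generatedBy.1 ((pair_mem_map hf hx hy).1 (h.1 hm)))
  obtain ⟨u, hu, rfl⟩ := Finset.mem_image.1 hs
  rw [Finset.card_image_of_injOn (hf.mono (coe_face_subset hu))] at hs2
  obtain ⟨x, y, hxy, rfl⟩ := Finset.card_eq_two.1 hs2
  have hxyF : Joined F x y := pair_mem_generatedBy.1 hu
  rw [Finset.image_insert, Finset.image_singleton] at hsΘ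
  rcases hF.needed x y hxy hxyF with h1 | ⟨b, d, hxb, hyd, h1, h2, n1, n2, n3⟩
  · exact hsΘ (hedge h1)
  · obtain ⟨vx, vy⟩ := hvert hxyF
    have vb := (hvert (hjoin h1)).2
    have vd := (hvert (hjoin h2)).2
    have ne : ∀ {p q}, p ∈ Δ.vertexSet → q ∈ Δ.vertexSet → p ≠ q → f p ≠ f q :=
      fun hp hq hpq he => hpq (hf hp hq he)
    have nej : ∀ {p q}, p ∈ Δ.vertexSet → ¬ Joined F p q → p ≠ q := by
      rintro p q hp hn rfl
      exact hn (mem_vertexSet_generatedBy.1 hp)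
    rcases hG (f x) (f b) (f y) (f d) (ne vx vb hxb) (ne vy vd hyd) (hedge h1) (hedge h2)
      (ne vx vy hxy) (ne vx vd (nej vx n1)) (ne vb vy (nej vb n2)) (ne vb vd (nej vb n3)) with
      e | e | e | e
    · exact hsΘ e
    · exact hnot vx vd n1 e
    · exact hnot vb vy n2 e
    · exact hnot vb vd n3 e

/-! ### Every 2-dimensional obstruction contains one of the twelve complexes -/

/-- `Γ` arises by adding edges to a copy of one of the twelve complexes. -/
def ContainsMinimal (Γ : FinComplex E) : Prop :=
  ∃ Δ ∈ twelveComplexes, ∃ Γ₀ : FinComplex E, Γ₀.IsIso Δ ∧ IsAddEdges Γ₀ Γ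

section Contains

variable {Γ : FinComplex E}

/-- The list names the images of `0, 1, …`, with `e` as an irrelevant default. Once the generators
are faces of `Γ`, the bound on the number of triangles makes the triangles agree. The vertices agree
too, as each lies in a triangle, so only edges can be additional. -/
theorem IsObstruction.containsMinimal_of_list (h : Γ.IsObstruction) (hd : Γ.dim = 2)
    {Δ : FinComplex (Fin 7)} (hΔ : Δ ∈ twelveComplexes) {F : Finset (Finset (Fin 7))}
    (hΔF : Δ = generatedBy F) {l : List E} (hl : l.Nodup) (e : E)
    (hF : ∀ t ∈ F, t.card ≤ 3 ∧ ∀ i ∈ t, i.val < l.length)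
    (h1 : ∀ t ∈ F, t.image (fun i => l.getD i.val e) ∈ Γ.faces)
    (h2 : Γ.triangles.card ≤ (F.filter (fun t => t.card = 3)).card) :
    Γ.ContainsMinimal := by
  subst hΔF
  set f : Fin 7 → E := fun i => l.getD i.val e with hfdef
  have hlt : ∀ x ∈ (generatedBy F).vertexSet, x.val < l.length := by
    intro x hx
    obtain ⟨t, ht, hxt, -⟩ := mem_vertexSet_generatedBy.1 hx
    exact (hF t ht).2 x hxt
  have hf : Set.InjOn f (generatedBy F).vertexSet := by
    intro x hx y hy hxy
    simp only [hfdef, List.getD_eq_getElem _ _ (hlt x hx), List.getD_eq_getElem _ _ (hlt y hy)]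
      at hxy
    exact Fin.ext ((hl.getElem_inj_iff).1 hxy)
  have hsub : ((generatedBy F).map f).faces ⊆ Γ.faces := by
    intro s hs
    obtain ⟨u, hu, rfl⟩ := Finset.mem_image.1 hs
    rcases mem_generatedBy.1 hu with rfl | ⟨t, ht, hut⟩
    · simpa using Γ.empty_mem
    · exact Γ.down_closed _ (h1 t ht) _ (Finset.image_subset_image hut)
  have hT : ((generatedBy F).map f).triangles = Γ.triangles := by
    apply Finset.eq_of_subset_of_card_le
    · intro s hs
      rw [mem_triangles] at hs ⊢
      exact ⟨hsub hs.1, hs.2⟩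
    · rw [triangles_map hf, Finset.card_image_of_injOn, triangles_generatedBy fun t ht => (hF t ht).1]
      · exact h2
      · intro s hs t ht hst
        have h3 : f '' (s : Set (Fin 7)) = f '' (t : Set (Fin 7)) := by
          rw [← Finset.coe_image, ← Finset.coe_image]
          exact congrArg _ hst
        exact_mod_cast (hf.image_eq_image_iff (coe_face_subset (mem_triangles.1 hs).1)
          (coe_face_subset (mem_triangles.1 ht).1)).1 h3
  refine ⟨_, hΔ, _, isIso_map hf, hsub, ?_⟩
  intro s hs hs'
  have h3 := (dim_eq_two_iff.1 hd).1 s hs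
  have h4 : s.card ≠ 3 := by
    intro h4
    have : s ∈ ((generatedBy F).map f).triangles := by
      rw [hT]; exact mem_triangles.2 ⟨hs, h4⟩
    exact hs' (mem_triangles.1 this).1
  have h5 : s.card ≠ 1 := by
    intro h5
    obtain ⟨v, rfl⟩ := Finset.card_eq_one.1 h5
    obtain ⟨σ, hσ, hv⟩ := h.exists_triangle hd (v := v) hs
    rw [← hT, mem_triangles] at hσ
    exact hs' (((generatedBy F).map f).down_closed σ hσ.1 _ (by simpa using hv))
  have h6 : s.card ≠ 0 := by
    intro h6
    rw [Finset.card_eq_zero] at h6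
    exact hs' (h6 ▸ ((generatedBy F).map f).empty_mem)
  rw [faceDim]
  omega

theorem IsObstruction.containsMinimal_of_isBand (h : Γ.IsObstruction) (hd : Γ.dim = 2)
    (hB : Critical.IsBand Γ.triangles) : Γ.ContainsMinimal := by
  have mem : ∀ {s}, s ∈ Γ.triangles → s ∈ Γ.faces := fun hs => (mem_triangles.1 hs).1
  rcases hB with ⟨a, b, c, d, e, hnd, hT⟩ | ⟨a, b, c, d, e, g, hnd, hT⟩ |
    ⟨a, b, c, d, e, g, k, hnd, hT⟩
  · refine h.containsMinimal_of_list hd (Δ := complex4a) (by simp [twelveComplexes]) rfl hnd a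
      (by simp only [List.length_cons, List.length_nil]; decide +kernel) ?_ ?_
    · simp only [Finset.forall_mem_insert, Finset.mem_singleton, forall_eq, Finset.image_insert,
        Finset.image_singleton]
      refine ⟨mem ?_, mem ?_, mem ?_, mem ?_, mem ?_⟩ <;> rw [hT] <;> simp
    · rw [hT]
      exact Finset.card_le_five
  · refine h.containsMinimal_of_list hd (Δ := complex4b) (by simp [twelveComplexes]) rfl hnd a
      (by simp only [List.length_cons, List.length_nil]; decide +kernel) ?_ ?_
    · simp only [Finset.forall_mem_insert, Finset.mem_singleton, forall_eq, Finset.image_insert,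
        Finset.image_singleton]
      refine ⟨mem ?_, mem ?_, mem ?_, mem ?_, mem ?_, mem ?_⟩ <;> rw [hT] <;> simp
    · rw [hT]
      exact Finset.card_le_six
  · refine h.containsMinimal_of_list hd (Δ := complex4c) (by simp [twelveComplexes]) rfl hnd a
      (by simp only [List.length_cons, List.length_nil]; decide +kernel) ?_ ?_
    · simp only [Finset.forall_mem_insert, Finset.mem_singleton, forall_eq, Finset.image_insert,
        Finset.image_singleton]
      refine ⟨mem ?_, mem ?_, mem ?_, mem ?_, mem ?_, mem ?_, mem ?_⟩ <;> rw [hT] <;> simp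
    · rw [hT]
      exact (Finset.card_insert_le _ _).trans (Nat.succ_le_succ Finset.card_le_six)

theorem triple_of_subset_five {u a b c d : E} (hab : a ≠ b) (hac : a ≠ c) (had : a ≠ d)
    (hbc : b ≠ c) (hbd : b ≠ d) (hcd : c ≠ d) {σ : Finset E} (hσ : σ ⊆ {u, a, b, c, d})
    (h3 : σ.card = 3) (h1 : σ ≠ {u, a, c}) (h2 : σ ≠ {u, a, d}) (h4 : σ ≠ {u, b, c})
    (h5 : σ ≠ {u, b, d}) : σ = {u, a, b} ∨ σ = {u, c, d} ∨ σ = {a, b, c} ∨ σ = {a, b, d} ∨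
      σ = {a, c, d} ∨ σ = {b, c, d} := by
  have sub : ∀ {x y z : E}, σ ⊆ {x, y, z} → σ = {x, y, z} := fun hs =>
    Finset.eq_of_subset_of_card_le hs (by rw [h3]; exact Finset.card_le_three)
  have hσ' : ∀ y ∈ σ, y = u ∨ y = a ∨ y = b ∨ y = c ∨ y = d := by
    intro y hy
    simpa using hσ hy
  by_cases hu : u ∈ σ
  · obtain ⟨p, q, hpq⟩ : ∃ p q, σ = {u, p, q} := by
      obtain ⟨p, q, -, h⟩ := exists_tri_of_mem (T := {σ}) (by simpa using h3) (by simp) hu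
      exact ⟨p, q, h⟩
    have hne := Tri.ne (T := {σ}) (a := u) (b := p) (c := q) (by simp [Tri, hpq]) (by simpa using h3)
    have hp := hσ' p (by simp [hpq])
    have hq := hσ' q (by simp [hpq])
    have hpq' : σ = {u, q, p} := by rw [hpq, Finset.pair_comm]
    rcases hp with rfl | rfl | rfl | rfl | rfl <;> rcases hq with rfl | rfl | rfl | rfl | rfl <;>
      first
      | exact Or.inl hpq
      | exact Or.inl hpq'
      | exact Or.inr (Or.inl hpq)
      | exact Or.inr (Or.inl hpq')
      | contradiction
      | simp at hne
  · have h4' : ({a, b, c, d} : Finset E).card = 4 := by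
      rw [Finset.card_insert_of_notMem (by simp [hab, hac, had]),
        Finset.card_insert_of_notMem (by simp [hbc, hbd]), Finset.card_pair hcd]
    obtain ⟨x, hx, hxσ⟩ := Finset.exists_mem_notMem_of_card_lt_card
      (s := σ) (t := {a, b, c, d}) (by omega)
    have herase : ∀ y ∈ σ, y ≠ x ∧ (y = a ∨ y = b ∨ y = c ∨ y = d) := by
      intro y hy
      refine ⟨fun he => hxσ (he ▸ hy), (hσ' y hy).resolve_left ?_⟩
      rintro rfl
      exact hu hy
    simp only [Finset.mem_insert, Finset.mem_singleton] at hx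
    right; right
    rcases hx with rfl | rfl | rfl | rfl
    · right; right; right
      refine sub fun y hy => ?_
      obtain ⟨hne, rfl | rfl | rfl | rfl⟩ := herase y hy <;> first | contradiction | simp
    · right; right; left
      refine sub fun y hy => ?_
      obtain ⟨hne, rfl | rfl | rfl | rfl⟩ := herase y hy <;> first | contradiction | simp
    · right; left
      refine sub fun y hy => ?_
      obtain ⟨hne, rfl | rfl | rfl | rfl⟩ := herase y hy <;> first | contradiction | simp
    · left
      refine sub fun y hy => ?_
      obtain ⟨hne, rfl | rfl | rfl | rfl⟩ := herase y hy <;> first | contradiction | simp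

theorem IsObstruction.containsMinimal_of_link (h : Γ.IsObstruction) (hd : Γ.dim = 2)
    {u a b c d : E} (hab : Tri Γ.triangles u a b) (hcd : Tri Γ.triangles u c d)
    (hac : a ≠ c) (had : a ≠ d) (hbc : b ≠ c) (hbd : b ≠ d)
    (hn : ¬ (Tri Γ.triangles u a c ∨ Tri Γ.triangles u a d ∨ Tri Γ.triangles u b c ∨
      Tri Γ.triangles u b d)) : Γ.ContainsMinimal := by
  have hC := h.critical hd
  have hc := hC.card_eq
  have hsub := hC.eq_of_link hab hcd hac had hbc hbd hn
  obtain ⟨hua, hub, hab'⟩ := hab.ne hc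
  obtain ⟨huc, hud, hcd'⟩ := hcd.ne hc
  have mem : ∀ {x y z}, Tri Γ.triangles x y z → {x, y, z} ∈ Γ.faces :=
    fun hs => (mem_triangles.1 hs).1
  have hG := h.twoK2Free hd
  have down : ∀ {x y z}, Tri Γ.triangles x y z → {y, z} ∈ Γ.faces :=
    fun hs => Γ.down_closed _ (mem hs) _ (by simp)
  have cross := hG a b c d hab' hcd' (down hab) (down hcd) hac had hbc hbd
  have six : ∀ σ ∈ Γ.triangles, σ = {u, a, b} ∨ σ = {u, c, d} ∨ σ = {a, b, c} ∨ σ = {a, b, d} ∨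
      σ = {a, c, d} ∨ σ = {b, c, d} := by
    intro σ hσ
    refine triple_of_subset_five hab' hac had hbc hbd hcd' (hsub σ hσ) (hc σ hσ) ?_ ?_ ?_ ?_ <;>
      rintro rfl <;> exact hn (by simp [Tri, hσ])
  have nd1 : [u, a, b, c, d].Nodup := by
    simp [hua, hub, huc, hud, hab', hac, had, hbc, hbd, hcd']
  have nd2 : [u, a, b, d, c].Nodup := by
    simp [hua, hub, huc, hud, hab', hac, had, hbc, hbd, hcd'.symm]
  have nd3 : [u, b, a, c, d].Nodup := by
    simp [hua, hub, huc, hud, hab'.symm, hac, had, hbc, hbd, hcd']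
  have nd4 : [u, b, a, d, c].Nodup := by
    simp [hua, hub, huc, hud, hab'.symm, hac, had, hbc, hbd, hcd'.symm]
  have nd5 : [u, c, d, a, b].Nodup := by
    simp [hua, hub, huc, hud, hab', hac.symm, had.symm, hbc.symm, hbd.symm, hcd']
  have nd6 : [u, c, d, b, a].Nodup := by
    simp [hua, hub, huc, hud, hab'.symm, hac.symm, had.symm, hbc.symm, hbd.symm, hcd']
  have nd7 : [u, d, c, a, b].Nodup := by
    simp [hua, hub, huc, hud, hab', hac.symm, had.symm, hbc.symm, hbd.symm, hcd'.symm]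
  have case2 : ∀ {p q r s : E}, [u, p, q, r, s].Nodup → Tri Γ.triangles u p q →
      Tri Γ.triangles u r s → {p, r} ∈ Γ.faces → Γ.triangles.card ≤ 2 → Γ.ContainsMinimal := by
    intro p q r s hnd h1 h2 h3 h4
    refine h.containsMinimal_of_list hd (Δ := complex2) (by simp [twelveComplexes]) rfl hnd u
      (by simp only [List.length_cons, List.length_nil]; decide +kernel) ?_ h4
    simp only [Finset.forall_mem_insert, Finset.mem_singleton, forall_eq, Finset.image_insert,
      Finset.image_singleton]
    exact ⟨mem h1, mem h2, h3⟩
  have case3a : ∀ {p q r s : E}, [u, p, q, r, s].Nodup → Tri Γ.triangles u p q →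
      Tri Γ.triangles u r s → Tri Γ.triangles p q r → Γ.triangles.card ≤ 3 →
      Γ.ContainsMinimal := by
    intro p q r s hnd h1 h2 h3 h4
    refine h.containsMinimal_of_list hd (Δ := complex3a) (by simp [twelveComplexes]) rfl hnd u
      (by simp only [List.length_cons, List.length_nil]; decide +kernel) ?_ h4
    simp only [Finset.forall_mem_insert, Finset.mem_singleton, forall_eq, Finset.image_insert,
      Finset.image_singleton]
    exact ⟨mem h1, mem h2, mem h3⟩
  have case3b : ∀ {p q r s : E}, [u, p, q, r, s].Nodup → Tri Γ.triangles u p q →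
      Tri Γ.triangles u r s → Tri Γ.triangles p q r → Tri Γ.triangles p q s →
      Γ.triangles.card ≤ 4 → Γ.ContainsMinimal := by
    intro p q r s hnd h1 h2 h3 h4 h5
    refine h.containsMinimal_of_list hd (Δ := complex3b) (by simp [twelveComplexes]) rfl hnd u
      (by simp only [List.length_cons, List.length_nil]; decide +kernel) ?_ h5
    simp only [Finset.forall_mem_insert, Finset.mem_singleton, forall_eq, Finset.image_insert,
      Finset.image_singleton]
    exact ⟨mem h1, mem h2, mem h3, mem h4⟩
  have case3c : ∀ {p q r s : E}, [u, p, q, r, s].Nodup → Tri Γ.triangles u p q →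
      Tri Γ.triangles u r s → Tri Γ.triangles p q r → Tri Γ.triangles p r s →
      Γ.triangles.card ≤ 4 → Γ.ContainsMinimal := by
    intro p q r s hnd h1 h2 h3 h4 h5
    refine h.containsMinimal_of_list hd (Δ := complex3c) (by simp [twelveComplexes]) rfl hnd u
      (by simp only [List.length_cons, List.length_nil]; decide +kernel) ?_ h5
    simp only [Finset.forall_mem_insert, Finset.mem_singleton, forall_eq, Finset.image_insert,
      Finset.image_singleton]
    exact ⟨mem h1, mem h2, mem h3, mem h4⟩
  have case3d : ∀ {p q r s : E}, [u, p, q, r, s].Nodup → Tri Γ.triangles u p q →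
      Tri Γ.triangles u r s → Tri Γ.triangles p q r → Tri Γ.triangles p q s →
      Tri Γ.triangles p r s → Γ.triangles.card ≤ 5 → Γ.ContainsMinimal := by
    intro p q r s hnd h1 h2 h3 h4 h5 h6
    refine h.containsMinimal_of_list hd (Δ := complex3d) (by simp [twelveComplexes]) rfl hnd u
      (by simp only [List.length_cons, List.length_nil]; decide +kernel) ?_ h6
    simp only [Finset.forall_mem_insert, Finset.mem_singleton, forall_eq, Finset.image_insert,
      Finset.image_singleton]
    exact ⟨mem h1, mem h2, mem h3, mem h4, mem h5⟩
  -- Upper bounds on the number of triangles suffice, because the copy of the model already lies in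
  -- `Γ`.
  have bound : ∀ S : Finset (Finset E), (∀ σ, (σ = {u, a, b} ∨ σ = {u, c, d} ∨
      (σ = {a, b, c} ∧ Tri Γ.triangles a b c) ∨ (σ = {a, b, d} ∧ Tri Γ.triangles a b d) ∨
      (σ = {a, c, d} ∧ Tri Γ.triangles a c d) ∨ (σ = {b, c, d} ∧ Tri Γ.triangles b c d)) →
        σ ∈ S) → Γ.triangles.card ≤ S.card := by
    intro S hS
    apply Finset.card_le_card
    intro σ hσ
    apply hS
    rcases six σ hσ with rfl | rfl | rfl | rfl | rfl | rfl
    · exact Or.inl rfl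
    · exact Or.inr (Or.inl rfl)
    · exact Or.inr (Or.inr (Or.inl ⟨rfl, hσ⟩))
    · exact Or.inr (Or.inr (Or.inr (Or.inl ⟨rfl, hσ⟩)))
    · exact Or.inr (Or.inr (Or.inr (Or.inr (Or.inl ⟨rfl, hσ⟩))))
    · exact Or.inr (Or.inr (Or.inr (Or.inr (Or.inr ⟨rfl, hσ⟩))))
  clear six hsub hn hG down
  -- The sixteen sets of triples on `a, b, c, d` reduce, by exchanging `a` with `b`, `c` with `d`,
  -- or the two pairs, to (3a)–(3e) and the empty set. For the empty set an edge between the pairs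
  -- exists by the absence of `2K₂`, which gives (2).
  by_cases t1 : Tri Γ.triangles a b c <;> by_cases t2 : Tri Γ.triangles a b d <;>
    by_cases t3 : Tri Γ.triangles a c d <;> by_cases t4 : Tri Γ.triangles b c d <;>
    simp only [t1, t2, t3, t4, and_true, and_false, or_false, false_or] at bound
  · refine h.containsMinimal_of_list hd (Δ := complex3e) (by simp [twelveComplexes]) rfl nd1 u
      (by simp only [List.length_cons, List.length_nil]; decide +kernel) ?_
      ((bound {{u, a, b}, {u, c, d}, {a, b, c}, {a, b, d}, {a, c, d}, {b, c, d}}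
        (by simp)).trans Finset.card_le_six)
    simp only [Finset.forall_mem_insert, Finset.mem_singleton, forall_eq, Finset.image_insert,
      Finset.image_singleton]
    exact ⟨mem hab, mem hcd, mem t1, mem t2, mem t3, mem t4⟩
  · exact case3d nd1 hab hcd t1 t2 t3
      ((bound {{u, a, b}, {u, c, d}, {a, b, c}, {a, b, d}, {a, c, d}} (by simp)).trans
        Finset.card_le_five)
  · exact case3d nd3 hab.swap' hcd t1.swap t2.swap t4
      ((bound {{u, a, b}, {u, c, d}, {a, b, c}, {a, b, d}, {b, c, d}} (by simp)).trans
        Finset.card_le_five)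
  · exact case3b nd1 hab hcd t1 t2
      ((bound {{u, a, b}, {u, c, d}, {a, b, c}, {a, b, d}} (by simp)).trans Finset.card_le_four)
  · exact case3d nd5 hcd hab t3.rot t4.rot t1.rot'
      ((bound {{u, a, b}, {u, c, d}, {a, b, c}, {a, c, d}, {b, c, d}} (by simp)).trans
        Finset.card_le_five)
  · exact case3c nd1 hab hcd t1 t3
      ((bound {{u, a, b}, {u, c, d}, {a, b, c}, {a, c, d}} (by simp)).trans Finset.card_le_four)
  · exact case3c nd3 hab.swap' hcd t1.swap t4
      ((bound {{u, a, b}, {u, c, d}, {a, b, c}, {b, c, d}} (by simp)).trans Finset.card_le_four)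
  · exact case3a nd1 hab hcd t1
      ((bound {{u, a, b}, {u, c, d}, {a, b, c}} (by simp)).trans Finset.card_le_three)
  · exact case3d nd7 hcd.swap' hab t3.rot.swap t4.rot.swap t2.rot'
      ((bound {{u, a, b}, {u, c, d}, {a, b, d}, {a, c, d}, {b, c, d}} (by simp)).trans
        Finset.card_le_five)
  · exact case3c nd2 hab hcd.swap' t2 t3.swap'
      ((bound {{u, a, b}, {u, c, d}, {a, b, d}, {a, c, d}} (by simp)).trans Finset.card_le_four)
  · exact case3c nd4 hab.swap' hcd.swap' t2.swap t4.swap'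
      ((bound {{u, a, b}, {u, c, d}, {a, b, d}, {b, c, d}} (by simp)).trans Finset.card_le_four)
  · exact case3a nd2 hab hcd.swap' t2
      ((bound {{u, a, b}, {u, c, d}, {a, b, d}} (by simp)).trans Finset.card_le_three)
  · exact case3b nd5 hcd hab t3.rot t4.rot
      ((bound {{u, a, b}, {u, c, d}, {a, c, d}, {b, c, d}} (by simp)).trans Finset.card_le_four)
  · exact case3a nd5 hcd hab t3.rot
      ((bound {{u, a, b}, {u, c, d}, {a, c, d}} (by simp)).trans Finset.card_le_three)
  · exact case3a nd6 hcd hab.swap' t4.rot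
      ((bound {{u, a, b}, {u, c, d}, {b, c, d}} (by simp)).trans Finset.card_le_three)
  · have hb : Γ.triangles.card ≤ 2 :=
      (bound {{u, a, b}, {u, c, d}} (by simp)).trans Finset.card_le_two
    rcases cross with hx | hx | hx | hx
    · exact case2 nd1 hab hcd hx hb
    · exact case2 nd2 hab hcd.swap' hx hb
    · exact case2 nd3 hab.swap' hcd hx hb
    · exact case2 nd4 hab.swap' hcd.swap' hx hb

end Contains

/-! ### Two disjoint triangles -/

section Disjoint

variable {Γ : FinComplex E}

/-- The edges between the two triangles, when a vertex `r` has no neighbour in the other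
triangle. -/
theorem IsObstruction.containsMinimal_of_isolated (h : Γ.IsObstruction) (hd : Γ.dim = 2)
    {x y z r s t : E} (hnd : [x, y, z, s, t, r].Nodup) (hxyz : Tri Γ.triangles x y z)
    (hrst : Tri Γ.triangles r s t) (hcard : Γ.triangles.card ≤ 2)
    (hx : {x, r} ∉ Γ.faces) (hy : {y, r} ∉ Γ.faces) (hz : {z, r} ∉ Γ.faces) :
    Γ.ContainsMinimal := by
  have hG := h.twoK2Free hd
  have mem : ∀ {x y z}, Tri Γ.triangles x y z → {x, y, z} ∈ Γ.faces :=
    fun hs => (mem_triangles.1 hs).1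
  have down : ∀ {x y z}, Tri Γ.triangles x y z → {x, y} ∈ Γ.faces :=
    fun hs => Γ.down_closed _ (mem hs) _ (by intro t; simp; tauto)
  have case1b : ∀ {x y z s t : E}, [x, y, z, s, t, r].Nodup → Tri Γ.triangles x y z →
      Tri Γ.triangles r s t → {z, s} ∈ Γ.faces → {x, s} ∈ Γ.faces → {x, t} ∈ Γ.faces →
      {y, t} ∈ Γ.faces → Γ.ContainsMinimal := by
    intro x y z s t hnd h1 h2 h3 h4 h5 h6
    refine h.containsMinimal_of_list hd (Δ := complex1b) (by simp [twelveComplexes]) rfl hnd x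
      (by simp only [List.length_cons, List.length_nil]; decide +kernel) ?_ hcard
    simp only [Finset.forall_mem_insert, Finset.mem_singleton, forall_eq, Finset.image_insert,
      Finset.image_singleton]
    exact ⟨mem h1, mem h2.rot, h3, h4, h5, h6⟩
  have case1c : ∀ {x y z : E}, [x, y, z, s, t, r].Nodup → Tri Γ.triangles x y z →
      {x, s} ∈ Γ.faces → {y, s} ∈ Γ.faces → {x, t} ∈ Γ.faces →
      {y, t} ∈ Γ.faces → Γ.ContainsMinimal := by
    intro x y z hnd h1 h3 h4 h5 h6
    refine h.containsMinimal_of_list hd (Δ := complex1c) (by simp [twelveComplexes]) rfl hnd x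
      (by simp only [List.length_cons, List.length_nil]; decide +kernel) ?_ hcard
    simp only [Finset.forall_mem_insert, Finset.mem_singleton, forall_eq, Finset.image_insert,
      Finset.image_singleton]
    exact ⟨mem h1, mem hrst.rot, h3, h4, h6, h5⟩
  have hnd' := hnd
  simp only [List.nodup_cons, List.mem_cons, List.not_mem_nil, or_false, not_or] at hnd'
  obtain ⟨⟨n1, n2, n3, n4, n5⟩, ⟨n6, n7, n8, n9⟩, ⟨n10, n11, n12⟩, ⟨n13, n14⟩, n15, -⟩ := hnd'
  -- The edge `rq` must be joined to each edge of `xyz`, necessarily through `q`. So the neighbours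
  -- of `q` meet all three edges of `xyz`, hence include two of its vertices.
  have two : ∀ q : E, {r, q} ∈ Γ.faces → q ≠ r → x ≠ q → y ≠ q → z ≠ q →
      (({x, q} ∈ Γ.faces ∧ {y, q} ∈ Γ.faces) ∨ ({x, q} ∈ Γ.faces ∧ {z, q} ∈ Γ.faces) ∨
        ({y, q} ∈ Γ.faces ∧ {z, q} ∈ Γ.faces)) := by
    intro q hrq hqr hxq hyq hzq
    have e1 := hG x y r q n1 (Ne.symm hqr) (down hxyz) hrq n5 hxq n9 hyq
    have e2 := hG x z r q n2 (Ne.symm hqr) (down hxyz.swap') hrq n5 hxq n12 hzq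
    have e3 := hG y z r q n6 (Ne.symm hqr) (down hxyz.rot) hrq n9 hyq n12 hzq
    simp only [hx, hy, hz, false_or] at e1 e2 e3
    clear case1b case1c
    tauto
  have hs := two s (down hrst) n14 n3 n7 n10
  have ht := two t (down hrst.swap') n15 n4 n8 n11
  clear two
  have nd : ∀ {a b c : E}, (a = x ∧ b = z ∧ c = y) ∨ (a = y ∧ b = z ∧ c = x) ∨
      (a = z ∧ b = y ∧ c = x) ∨ (a = y ∧ b = x ∧ c = z) ∨ (a = z ∧ b = x ∧ c = y) →
      [a, b, c, s, t, r].Nodup := by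
    rintro a b c (⟨rfl, rfl, rfl⟩ | ⟨rfl, rfl, rfl⟩ | ⟨rfl, rfl, rfl⟩ | ⟨rfl, rfl, rfl⟩ |
      ⟨rfl, rfl, rfl⟩) <;>
    simp [n1, n2, n3, n4, n5, n6, n7, n8, n9, n10, n11, n12, n13, n14, n15, Ne.symm n1, Ne.symm n2,
      Ne.symm n6]
  -- If `s` and `t` have the same two neighbours in `xyz`, the joining edges form a four-cycle (1c);
  -- otherwise they form a path (1b).
  rcases hs with ⟨a1, a2⟩ | ⟨a1, a2⟩ | ⟨a1, a2⟩ <;> rcases ht with ⟨b1, b2⟩ | ⟨b1, b2⟩ | ⟨b1, b2⟩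
  · exact case1c hnd hxyz a1 a2 b1 b2
  · exact case1b (nd (by simp)) hxyz.swap' hrst a2 a1 b1 b2
  · exact case1b (nd (by simp)) hxyz.rot hrst a1 a2 b1 b2
  · exact case1b hnd hxyz hrst a2 a1 b1 b2
  · exact case1c (nd (by simp)) hxyz.swap' a1 a2 b1 b2
  · exact case1b (nd (by simp)) hxyz.rev hrst a1 a2 b2 b1
  · exact case1b (nd (by simp)) hxyz.swap hrst a2 a1 b2 b1
  · exact case1b (nd (by simp)) hxyz.rot' hrst a1 a2 b2 b1
  · exact case1c (nd (by simp)) hxyz.rot a1 a2 b1 b2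

/-- König's theorem for a 3×3 matrix: without a transversal there is an empty submatrix whose
numbers of rows and columns add up to four. The hypotheses exclude the 2×2 ones, so a whole row or
column is empty. -/
theorem grid_cases (a b c d e f g h i : Prop) (h1 : a ∨ b ∨ d ∨ e) (h2 : a ∨ c ∨ d ∨ f)
    (h3 : b ∨ c ∨ e ∨ f) (h4 : a ∨ b ∨ g ∨ h) (h5 : a ∨ c ∨ g ∨ i) (h6 : b ∨ c ∨ h ∨ i)
    (h7 : d ∨ e ∨ g ∨ h) (h8 : d ∨ f ∨ g ∨ i) (h9 : e ∨ f ∨ h ∨ i) :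
    ((a ∧ e ∧ i) ∨ (a ∧ f ∧ h) ∨ (b ∧ d ∧ i) ∨ (b ∧ f ∧ g) ∨ (c ∧ d ∧ h) ∨ (c ∧ e ∧ g)) ∨
    ((¬ a ∧ ¬ b ∧ ¬ c) ∨ (¬ d ∧ ¬ e ∧ ¬ f) ∨ (¬ g ∧ ¬ h ∧ ¬ i)) ∨
    ((¬ a ∧ ¬ d ∧ ¬ g) ∨ (¬ b ∧ ¬ e ∧ ¬ h) ∨ (¬ c ∧ ¬ f ∧ ¬ i)) := by
  by_cases a <;> by_cases e <;> by_cases i <;> simp_all <;> by_cases b <;> by_cases d <;>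
    simp_all <;> tauto

theorem IsObstruction.containsMinimal_of_twoDisjoint (h : Γ.IsObstruction) (hd : Γ.dim = 2)
    (hD : Critical.TwoDisjoint Γ.triangles) : Γ.ContainsMinimal := by
  obtain ⟨σ, τ, hσ, hτ, hdisj, hT⟩ := hD
  obtain ⟨x, y, z, hxy, hxz, hyz, rfl⟩ := Finset.card_eq_three.1 hσ
  obtain ⟨p, q, w, hpq, hpw, hqw, rfl⟩ := Finset.card_eq_three.1 hτ
  have hG := h.twoK2Free hd
  have hcard : Γ.triangles.card ≤ 2 := by rw [hT]; exact Finset.card_le_two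
  have t1 : Tri Γ.triangles x y z := by simp [Tri, hT]
  have t2 : Tri Γ.triangles p q w := by simp [Tri, hT]
  have mem : ∀ {x y z}, Tri Γ.triangles x y z → {x, y, z} ∈ Γ.faces :=
    fun hs => (mem_triangles.1 hs).1
  have down : ∀ {x y z}, Tri Γ.triangles x y z → {x, y} ∈ Γ.faces :=
    fun hs => Γ.down_closed _ (mem hs) _ (by intro t; simp; tauto)
  simp only [Finset.disjoint_left, Finset.mem_insert, Finset.mem_singleton, forall_eq_or_imp,
    forall_eq, not_or] at hdisj
  obtain ⟨⟨n1, n2, n3⟩, ⟨n4, n5, n6⟩, n7, n8, n9⟩ := hdisj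
  have nd : ∀ {a b c : E}, (a = p ∧ b = q ∧ c = w) ∨ (a = p ∧ b = w ∧ c = q) ∨
      (a = q ∧ b = p ∧ c = w) ∨ (a = q ∧ b = w ∧ c = p) ∨ (a = w ∧ b = p ∧ c = q) ∨
      (a = w ∧ b = q ∧ c = p) → [x, y, z, a, b, c].Nodup := by
    rintro a b c (⟨rfl, rfl, rfl⟩ | ⟨rfl, rfl, rfl⟩ | ⟨rfl, rfl, rfl⟩ | ⟨rfl, rfl, rfl⟩ |
      ⟨rfl, rfl, rfl⟩ | ⟨rfl, rfl, rfl⟩) <;>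
    simp [hxy, hxz, hyz, hpq, hpw, hqw, hpq.symm, hpw.symm, hqw.symm, n1, n2, n3, n4, n5, n6, n7,
      n8, n9]
  have nd' : ∀ {a b c : E}, (a = x ∧ b = y ∧ c = z) ∨ (a = y ∧ b = z ∧ c = x) ∨
      (a = z ∧ b = x ∧ c = y) → [p, q, w, a, b, c].Nodup := by
    rintro a b c (⟨rfl, rfl, rfl⟩ | ⟨rfl, rfl, rfl⟩ | ⟨rfl, rfl, rfl⟩) <;>
    simp [hxy, hxz, hyz, hpq, hpw, hqw, hxy.symm, hxz.symm, hyz.symm, Ne.symm n1, Ne.symm n2,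
      Ne.symm n3, Ne.symm n4, Ne.symm n5, Ne.symm n6, Ne.symm n7, Ne.symm n8, Ne.symm n9]
  have hnd : [x, y, z, p, q, w].Nodup := nd (by simp)
  have case1a : ∀ {a b c : E}, [x, y, z, a, b, c].Nodup → Tri Γ.triangles a b c →
      {x, a} ∈ Γ.faces → {y, b} ∈ Γ.faces → {z, c} ∈ Γ.faces → Γ.ContainsMinimal := by
    intro a b c hnd h1 h2 h3 h4
    refine h.containsMinimal_of_list hd (Δ := complex1a) (by simp [twelveComplexes]) rfl hnd x
      (by simp only [List.length_cons, List.length_nil]; decide +kernel) ?_ hcard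
    simp only [Finset.forall_mem_insert, Finset.mem_singleton, forall_eq, Finset.image_insert,
      Finset.image_singleton]
    exact ⟨mem t1, mem h1, h2, h3, h4⟩
  have comm : ∀ {a b : E}, {a, b} ∉ Γ.faces → {b, a} ∉ Γ.faces := by
    intro a b hab
    rwa [Finset.pair_comm]
  -- Rows are `x, y, z`, columns `p, q, w`, and the entries are the edges between the triangles. A
  -- transversal is a perfect matching (1a); an empty row or column is a vertex without neighbours
  -- in the other triangle.
  rcases grid_cases _ _ _ _ _ _ _ _ _
    (hG x y p q hxy hpq (down t1) (down t2) n1 n2 n4 n5)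
    (hG x y p w hxy hpw (down t1) (down t2.swap') n1 n3 n4 n6)
    (hG x y q w hxy hqw (down t1) (down t2.rot) n2 n3 n5 n6)
    (hG x z p q hxz hpq (down t1.swap') (down t2) n1 n2 n7 n8)
    (hG x z p w hxz hpw (down t1.swap') (down t2.swap') n1 n3 n7 n9)
    (hG x z q w hxz hqw (down t1.swap') (down t2.rot) n2 n3 n8 n9)
    (hG y z p q hyz hpq (down t1.rot) (down t2) n4 n5 n7 n8)
    (hG y z p w hyz hpw (down t1.rot) (down t2.swap') n4 n6 n7 n9)
    (hG y z q w hyz hqw (down t1.rot) (down t2.rot) n5 n6 n8 n9) with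
    (⟨e1, e2, e3⟩ | ⟨e1, e2, e3⟩ | ⟨e1, e2, e3⟩ | ⟨e1, e2, e3⟩ | ⟨e1, e2, e3⟩ | ⟨e1, e2, e3⟩) |
    (⟨e1, e2, e3⟩ | ⟨e1, e2, e3⟩ | ⟨e1, e2, e3⟩) | (⟨e1, e2, e3⟩ | ⟨e1, e2, e3⟩ | ⟨e1, e2, e3⟩)
  · exact case1a hnd t2 e1 e2 e3
  · exact case1a (nd (by simp)) t2.swap' e1 e2 e3
  · exact case1a (nd (by simp)) t2.swap e1 e2 e3
  · exact case1a (nd (by simp)) t2.rot e1 e2 e3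
  · exact case1a (nd (by simp)) t2.rot' e1 e2 e3
  · exact case1a (nd (by simp)) t2.rev e1 e2 e3
  · exact h.containsMinimal_of_isolated hd (nd' (by simp)) t2 t1 hcard (comm e1) (comm e2)
      (comm e3)
  · exact h.containsMinimal_of_isolated hd (nd' (by simp)) t2 t1.rot hcard (comm e1) (comm e2)
      (comm e3)
  · exact h.containsMinimal_of_isolated hd (nd' (by simp)) t2 t1.rot' hcard (comm e1)
      (comm e2) (comm e3)
  · exact h.containsMinimal_of_isolated hd (nd (by simp)) t1 t2 hcard e1 e2 e3
  · exact h.containsMinimal_of_isolated hd (nd (by simp)) t1 t2.rot hcard e1 e2 e3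
  · exact h.containsMinimal_of_isolated hd (nd (by simp)) t1 t2.rot' hcard e1 e2 e3

theorem IsObstruction.containsMinimal (h : Γ.IsObstruction) (hd : Γ.dim = 2) :
    Γ.ContainsMinimal := by
  by_cases hD : Critical.TwoDisjoint Γ.triangles
  · exact h.containsMinimal_of_twoDisjoint hd hD
  by_cases hL : LinksTwoK2Free Γ.triangles
  · exact h.containsMinimal_of_isBand hd ((h.critical hd).isBand hL hD)
  · simp only [LinksTwoK2Free, not_forall] at hL
    obtain ⟨u, a, b, c, d, hab, hcd, hac, had, hbc, hbd, hn⟩ := hL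
    exact h.containsMinimal_of_link hd hab hcd hac had hbc hbd hn

end Disjoint

/-! ### Obstructions of dimension at most one -/

section DimensionOne

variable {Γ : FinComplex E}

theorem triangles_eq_empty (hc : ∀ s ∈ Γ.faces, s.card ≤ 2) : Γ.triangles = ∅ := by
  rw [Finset.eq_empty_iff_forall_notMem]
  intro s hs
  have := hc s (mem_triangles.1 hs).1
  have := (mem_triangles.1 hs).2
  omega

theorem isShellable_of_dim_le_one (hc : ∀ s ∈ Γ.faces, s.card ≤ 2) (hG : Γ.TwoK2Free) :
    Γ.IsShellable := by
  refine isShellable_of_shelled_triangles (fun s hs => (hc s hs).trans (by omega)) hG ?_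
  rw [triangles_eq_empty hc]
  exact Shelled.empty

/-- Without triangles only an induced `2K₂` can prevent shellability. Its four vertices span a
nonshellable restriction, so there are no further vertices. -/
theorem IsObstruction.isIso_twoK2 (h : Γ.IsObstruction) (hc : ∀ s ∈ Γ.faces, s.card ≤ 2) :
    Γ.IsIso twoK2 := by
  have hG : ¬ Γ.TwoK2Free := fun hG => h.1 (isShellable_of_dim_le_one hc hG)
  simp only [TwoK2Free, not_forall] at hG
  obtain ⟨a, b, c, d, hab, hcd, h1, h2, hac, had, hbc, hbd, hn⟩ := hG
  obtain ⟨h3, h4⟩ := not_isShellable_restrict hab hcd hac had hbc hbd h1 h2 hn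
  have hsub : ((({a, b, c, d} : Finset E)) : Set E) ⊆ Γ.vertexSet := by
    intro x hx
    simp only [Finset.coe_insert, Finset.coe_singleton, Set.mem_insert_iff,
      Set.mem_singleton_iff] at hx
    rcases hx with rfl | rfl | rfl | rfl
    · exact vertex_of_mem h1 (by simp)
    · exact vertex_of_mem h1 (by simp)
    · exact vertex_of_mem h2 (by simp)
    · exact vertex_of_mem h2 (by simp)
  have hV : Γ.vertexSet ⊆ (({a, b, c, d} : Finset E) : Set E) := by
    by_contra hV
    exact h4 (h.2 _ ⟨hsub, hV⟩)
  have hfaces : ∀ s ∈ Γ.faces, s ⊆ {a, b} ∨ s ⊆ {c, d} := by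
    intro s hs
    refine h3 s (mem_restrict.2 ⟨hs, fun x hx => ?_⟩)
    exact_mod_cast hV (coe_face_subset hs hx)
  have hinj : Function.Injective ![a, b, c, d] := by
    have : [a, b, c, d].Nodup := by simp [hab, hac, had, hbc, hbd, hcd]
    exact List.nodup_ofFn.1 (by simpa using this)
  have hmap : Γ = twoK2.map ![a, b, c, d] := by
    ext s
    simp only [map, Finset.mem_image, twoK2, mem_generatedBy]
    constructor
    · intro hs
      rcases hfaces s hs with h5 | h5
      · have : s ⊆ ({0, 1} : Finset (Fin 4)).image ![a, b, c, d] := by simpa using h5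
        obtain ⟨u, hu, rfl⟩ := Finset.subset_image_iff.1 this
        exact ⟨u, Or.inr ⟨{0, 1}, by simp, by exact_mod_cast hu⟩, rfl⟩
      · have : s ⊆ ({2, 3} : Finset (Fin 4)).image ![a, b, c, d] := by simpa using h5
        obtain ⟨u, hu, rfl⟩ := Finset.subset_image_iff.1 this
        exact ⟨u, Or.inr ⟨{2, 3}, by simp, by exact_mod_cast hu⟩, rfl⟩
    · rintro ⟨u, rfl | ⟨t, ht, hut⟩, rfl⟩
      · simpa using Γ.empty_mem
      · refine Γ.down_closed (t.image ![a, b, c, d]) ?_ _ (Finset.image_subset_image hut)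
        simp only [Finset.mem_insert, Finset.mem_singleton] at ht
        rcases ht with rfl | rfl
        · simpa using h1
        · simpa using h2
  rw [hmap]
  exact isIso_map hinj.injOn

/-- A proper set of vertices has at most three elements and so contains no two disjoint edges. -/
theorem isObstruction_of_isIso_twoK2 (h : Γ.IsIso twoK2) :
    Γ.IsObstruction ∧ ∀ s ∈ Γ.faces, s.card ≤ 2 := by
  have hvert : ∀ x : Fin 4, x ∈ twoK2.vertexSet := by
    intro x
    rw [twoK2, mem_vertexSet_generatedBy]
    revert x
    decide +kernel
  obtain ⟨f, hf, rfl⟩ := h.exists_map ⟨0, hvert 0⟩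
  have hinj : Function.Injective f := fun x y hxy => hf (hvert x) (hvert y) hxy
  have hcΔ : ∀ s ∈ twoK2.faces, s.card ≤ 2 := by
    intro s hs
    rcases mem_generatedBy.1 hs with rfl | ⟨t, ht, hst⟩
    · simp
    · refine (Finset.card_le_card hst).trans ?_
      clear hst
      revert t
      decide +kernel
  have hc := card_le_of_mem_map (f := f) hcΔ
  have ne : ∀ {x y : Fin 4}, x ≠ y → f x ≠ f y := fun hxy he => hxy (hinj he)
  refine ⟨⟨?_, ?_⟩, hc⟩
  · have e : ∀ {x y : Fin 4}, Joined ({{0, 1}, {2, 3}} : Finset (Finset (Fin 4))) x y →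
        {f x, f y} ∈ (twoK2.map f).faces := fun hxy =>
      (pair_mem_map hf (hvert _) (hvert _)).2 (pair_mem_generatedBy.2 hxy)
    refine not_isShellable_of_disjoint_edges (a := f 0) (b := f 1) (c := f 2) (d := f 3)
      (ne (by decide)) (ne (by decide)) (ne (by decide)) (ne (by decide)) (ne (by decide))
      (ne (by decide)) (e (by decide +kernel)) (e (by decide +kernel)) ?_
    intro s hs
    obtain ⟨u, hu, rfl⟩ := Finset.mem_image.1 hs
    rcases mem_generatedBy.1 hu with rfl | ⟨t, ht, hut⟩
    · simp
    · simp only [Finset.mem_insert, Finset.mem_singleton] at ht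
      rcases ht with rfl | rfl
      · left
        simpa using Finset.image_subset_image (f := f) hut
      · right
        simpa using Finset.image_subset_image (f := f) hut
  · intro W hW
    refine isShellable_of_dim_le_one (fun s hs => hc s (mem_restrict.1 hs).1) ?_
    intro a b c d hab hcd h1 h2 hac had hbc hbd
    exfalso
    rw [mem_restrict] at h1 h2
    have hsub : ({a, b, c, d} : Finset E) ⊆ W := by
      intro x hx
      simp only [Finset.mem_insert, Finset.mem_singleton] at hx
      rcases hx with rfl | rfl | rfl | rfl
      · exact h1.2 (by simp)
      · exact h1.2 (by simp)
      · exact h2.2 (by simp)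
      · exact h2.2 (by simp)
    have h4 : ({a, b, c, d} : Finset E).card = 4 := by
      rw [Finset.card_insert_of_notMem (by simp [hab, hac, had]),
        Finset.card_insert_of_notMem (by simp [hbc, hbd]), Finset.card_pair hcd]
    have hWc := Finset.card_le_card hsub
    have hV : (twoK2.map f).vertexSet = ((Finset.univ.image f : Finset E) : Set E) := by
      rw [vertexSet_map, Finset.coe_image, Finset.coe_univ]
      congr 1
      exact Set.eq_univ_of_forall hvert
    rw [hV] at hW
    have hlt := Finset.card_lt_card (Finset.coe_ssubset.1 hW)
    have hle : (Finset.univ.image f).card ≤ 4 := Finset.card_image_le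
    omega

end DimensionOne

/-! ### Conclusion -/

theorem Good.vertexSet_nonempty {F : Finset (Finset (Fin 7))} (hF : Good F) :
    (generatedBy F).vertexSet.Nonempty := by
  by_contra hne
  apply hF.not_shelled
  have : F.filter (fun t => t.card = 3) = ∅ := by
    rw [Finset.eq_empty_iff_forall_notMem]
    intro t ht
    rw [Finset.mem_filter] at ht
    obtain ⟨x, hx⟩ : t.Nonempty := by rw [← Finset.card_pos]; omega
    exact hne ⟨x, mem_vertexSet_generatedBy.2 ⟨t, ht.1, hx, hx⟩⟩
  rw [this]
  exact Shelled.empty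

theorem isObstruction_of_isAddEdges {Δ : FinComplex (Fin 7)} (hΔ : Δ ∈ twelveComplexes)
    {Γ₀ Γ : FinComplex E} (h₀ : Γ₀.IsIso Δ) (h : IsAddEdges Γ₀ Γ) :
    Γ.IsObstruction ∧ Γ.dim = 2 := by
  obtain ⟨F, hF, rfl⟩ := exists_good_of_mem_twelveComplexes hΔ
  obtain ⟨f, hf, rfl⟩ := h₀.exists_map (hF.vertexSet_nonempty)
  exact hF.isObstruction hf h

end FinComplex

theorem theorem2 {E : Type*} [DecidableEq E] (Γ : FinComplex E) :
    (Γ.IsEdgeMinimalObstruction ↔ ∃ Δ ∈ FinComplex.twelveComplexes, Γ.IsIso Δ) ∧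
    ((Γ.IsObstruction ∧ Γ.dim ≤ 2) ↔
      (Γ.IsIso FinComplex.twoK2 ∨
        ∃ Δ ∈ FinComplex.twelveComplexes, ∃ Γ₀ : FinComplex E,
          Γ₀.IsIso Δ ∧ FinComplex.IsAddEdges Γ₀ Γ)) := by
  refine ⟨⟨?_, ?_⟩, ?_, ?_⟩
  · rintro ⟨⟨h, hd⟩, hmin⟩
    obtain ⟨Δ, hΔ, Γ₀, hiso, hadd⟩ := h.containsMinimal hd
    -- The copy `Γ₀` inside `Γ` is itself a 2-dimensional obstruction, so minimality forces `Γ₀ =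
    -- Γ`.
    obtain ⟨h₀, hd₀⟩ := FinComplex.isObstruction_of_isAddEdges hΔ hiso (.refl Γ₀)
    rw [hmin Γ₀ h₀ hd₀ hadd] at hiso
    exact ⟨Δ, hΔ, hiso⟩
  · rintro ⟨Δ, hΔ, hiso⟩
    refine ⟨FinComplex.isObstruction_of_isAddEdges hΔ hiso (.refl Γ), ?_⟩
    intro Θ hΘ hd hadd
    obtain ⟨F, hF, rfl⟩ := FinComplex.exists_good_of_mem_twelveComplexes hΔ
    obtain ⟨f, hf, rfl⟩ :=
      hiso.exists_map (hF.vertexSet_nonempty)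
    exact hF.eq_of_isAddEdges hf hΘ hd hadd
  · rintro ⟨h, hd⟩
    by_cases hd2 : Γ.dim = 2
    · exact Or.inr (h.containsMinimal hd2)
    · left
      have hd1 : Γ.dim ≤ (1 : ℕ) := by push_cast; omega
      exact h.isIso_twoK2 (FinComplex.dim_le_iff.1 hd1)
  · rintro (h | ⟨Δ, hΔ, Γ₀, hiso, hadd⟩)
    · obtain ⟨h1, h2⟩ := FinComplex.isObstruction_of_isIso_twoK2 h
      have hd1 : Γ.dim ≤ (1 : ℕ) := FinComplex.dim_le_iff.2 h2
      push_cast at hd1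
      exact ⟨h1, by omega⟩
    · obtain ⟨h1, h2⟩ := FinComplex.isObstruction_of_isAddEdges hΔ hiso hadd
      exact ⟨h1, h2.le⟩
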